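/- Let $\mathbb{K}\in\{\mathbb{R},\mathbb{C}\}$, $1\le p<\infty$, and let $\rho\neq 0$ be a nonnegative locally finite Borel measure on $\mathbb{R}$ with $\|\rho\|_{\mathrm{unif}}:=\sup_{t\in\mathbb{R}}\rho((t,t+1])<\infty$ whose set of periods $\mathrm{Per}(\rho):=\{r\in\mathbb{R}\setminus\{0\}:\rho(\cdot+r)=\rho\}$ is nonempty. A real local measure is a real set function $\mu$ on the bounded Borel sets such that $\mu(\cdot\cap K)$ is a finite signed measure for every compact $K$; $|\mu|$ is its total variation. Let $\mathcal{AM}(\mathbb{R})$ be the set of pairs $(a,\mu)$ with $a:\mathbb{R}\to[0,\infty)$ measurable, $a,\frac1a\in L_\infty(\mathbb{R})$ (in particular $a>0$ a.e.), and $\mu$ a real local measure with $\sup_t|\mu|((t,t+1])<\infty$ and $\operatorname{spt}\mu\subseteq\operatorname{spt}\rho$. Write $\int_s^t=\int_{(s,t]}$ for $s\le t$ and $\int_s^t=-\int_{(t,s]}$ for $t<s$. For $(a,\mu)\in\mathcal{AM}(\mathbb{R})$ and $u\in W^1_{1,\mathrm{loc}}(\mathbb{R})$ put $A_{a,\mu}u(t):=-(au')(t)+\int_0^t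 u\,d\mu$ (for a.a. $t$). The operator $H=H_{p,\rho,a,\mu}$ in $L_p(\mathbb{R},\rho)$ (with values in $\mathbb{K}$) has as domain all $u\in L_p(\mathbb{R},\rho)$ with $u\in W^1_{1,\mathrm{loc}}(\mathbb{R})$ such that, after modification on a Lebesgue null set, $A_{a,\mu}u(t)=A_{a,\mu}u(c)+\int_c^t h\,d\rho$ for all $t\in\mathbb{R}$, for some $c\in\mathbb{R}$ and some locally $\rho$-integrable $h$ which belongs to $L_p(\mathbb{R},\rho)$; and $Hu:=h$. An eigenvalue of $H$ is a $z\in\mathbb{K}$ for which there is $u\ne0$ in the domain (as an element of $L_p(\mathbb{R},\rho)$) with $Hu=zu$. For a local measure $\mu$ and $I\subseteq\mathbb{R}$ let $$\|\mu\|_I:=\sup\Bigl\{\Bigl|\int u\,d\mu\Bigr| : u\in W^1_{1,\mathrm{loc}}(\mathbb{R}),\ \operatorname{spt}u\subseteq I,\ \operatorname{diam}\operatorname{spt}u\le2,\ \|u'\|_\infty\le1\Bigr\}.$$ The pair $(a,\mu)$ satisfies the weak Gordon condition with weight $C$ with period sequence $(r_m)$ if $r_m\in(0,\infty)$, $r_m\to\infty$,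 and $$\lim_{m\to\infty}e^{Cr_m}\Bigl(\|a-a(\cdot+r_m)\|_{L_1(-r_m,r_m)}+\|\mu-\mu(\cdot+r_m)\|_{[-r_m,r_m]}\Bigr)=0 .$$ **(1)** Let $(a,\mu)\in\mathcal{AM}(\mathbb{R})$, and suppose that for every $C>0$ the pair $(a,\mu)$ satisfies the weak Gordon condition with weight $C$ with some period sequence in $\mathrm{Per}(\rho)$. Then $H_{p,\rho,a,\mu}$ has no eigenvalues. **(2)** Let $\tau\in\mathrm{Per}(\rho)$, $\tau>0$, and let $\alpha>0$ be irrational such that there are $B>0$ and $k_m\in\mathbb{Z}$, $q_m\in\mathbb{N}$, $q_m\ge1$, with $|\alpha-\frac{k_m}{q_m}|\le Bm^{-q_m}$ for all integers $m\ge1$. Let $(a_1,\mu_1),(a_2,\mu_2)\in\mathcal{AM}(\mathbb{R})$, where $(a_1,\mu_1)$ is $\tau$-periodic, $(a_2,\mu_2)$ is $\alpha\tau$-periodic, and $a_2$ is Hölder continuous with some exponent $\beta>0$, i.e. $|a_2(x)-a_2(y)|\le c|x-y|^\beta$ for all $x,y\in\mathbb{R}$ and some $c>0$. Then $(a_1+a_2,\mu_1+\mu_2)\in\mathcal{AM}(\mathbb{R})$,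 this pair satisfies the weak Gordon condition with every weight $C>0$ with a period sequence in $\mathrm{Per}(\rho)$, and $H_{p,\rho,a_1+a_2,\mu_1+\mu_2}$ has no eigenvalues. -/

import Mathlib

open MeasureTheory Set Filter Topology
open scoped ENNReal

noncomputable section

/-- A real local measure on `ℝ`: a set function, relevant only on bounded Borel sets, such that for
every compact `K` the set function `B ↦ μ (B ∩ K)` is a finite signed Borel measure. -/
structure LocalMeasure where
  toFun : Set ℝ → ℝ
  exists_signedMeasure : ∀ K : Set ℝ, IsCompact K →
    ∃ s : SignedMeasure ℝ, ∀ B : Set ℝ, MeasurableSet B → s B = toFun (B ∩ K)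

namespace LocalMeasure

instance : CoeFun LocalMeasure (fun _ => Set ℝ → ℝ) := ⟨toFun⟩

instance : Add LocalMeasure where
  add μ ν :=
    { toFun := fun B => μ B + ν B
      exists_signedMeasure := by
        intro K hK
        obtain ⟨s, hs⟩ := μ.exists_signedMeasure K hK
        obtain ⟨t, ht⟩ := ν.exists_signedMeasure K hK
        exact ⟨s + t, fun B hB => by simp [hs B hB, ht B hB]⟩ }

instance : Sub LocalMeasure where
  sub μ ν :=
    { toFun := fun B => μ B - ν B
      exists_signedMeasure := by
        intro K hK
        obtain ⟨s, hs⟩ := μ.exists_signedMeasure K hK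
        obtain ⟨t, ht⟩ := ν.exists_signedMeasure K hK
        exact ⟨s - t, fun B hB => by simp [hs B hB, ht B hB]⟩ }

/-- The translate `μ(· + r)`, that is `B ↦ μ (B + r)`, where `B + r = {x | x - r ∈ B}`. -/
def translate (μ : LocalMeasure) (r : ℝ) : LocalMeasure where
  toFun B := μ ((fun x => x - r) ⁻¹' B)
  exists_signedMeasure := by
    intro K hK
    have hK' : IsCompact ((fun x : ℝ => x - r) ⁻¹' K) := by
      have h := hK.image (f := fun x : ℝ => x + r) (by fun_prop)
      convert h using 1
      ext x
      simp only [mem_preimage, mem_image]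
      exact ⟨fun hx => ⟨x - r, hx, by ring⟩, fun ⟨y, hy, hyx⟩ => by simpa [← hyx] using hy⟩
    obtain ⟨s, hs⟩ := μ.exists_signedMeasure _ hK'
    have hm : Measurable (fun x : ℝ => x - r) := by fun_prop
    refine ⟨s.map (fun x => x - r), fun B hB => ?_⟩
    rw [VectorMeasure.map_apply _ hm hB, hs _ (hm hB), preimage_inter]

/-- `μ` is `r`-periodic: `μ(· + r) = μ` on bounded Borel sets. -/
def Periodic (μ : LocalMeasure) (r : ℝ) : Prop :=
  ∀ B : Set ℝ, MeasurableSet B → Bornology.IsBounded B → μ.translate r B = μ B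

/-- The finite signed measure `B ↦ μ (B ∩ (k, k + 1])`. -/
def piece (μ : LocalMeasure) (k : ℤ) : SignedMeasure ℝ :=
  (μ.exists_signedMeasure (Icc (k : ℝ) (k + 1)) isCompact_Icc).choose.restrict
    (Ioc (k : ℝ) (k + 1))

theorem piece_apply (μ : LocalMeasure) (k : ℤ) {B : Set ℝ} (hB : MeasurableSet B) :
    μ.piece k B = μ (B ∩ Ioc (k : ℝ) (k + 1)) := by
  unfold piece
  rw [VectorMeasure.restrict_apply _ measurableSet_Ioc hB,
    (μ.exists_signedMeasure (Icc (k : ℝ) (k + 1)) isCompact_Icc).choose_spec _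
      (hB.inter measurableSet_Ioc), inter_assoc, inter_eq_left.2 Ioc_subset_Icc_self]

/-- The positive part of the Jordan decomposition of `μ`, glued from the unit intervals. -/
def posPart (μ : LocalMeasure) : Measure ℝ :=
  Measure.sum fun k : ℤ => (μ.piece k).toJordanDecomposition.posPart

/-- The negative part of the Jordan decomposition of `μ`, glued from the unit intervals. -/
def negPart (μ : LocalMeasure) : Measure ℝ :=
  Measure.sum fun k : ℤ => (μ.piece k).toJordanDecomposition.negPart

/-- The total variation measure `|μ|`. -/
def variation (μ : LocalMeasure) : Measure ℝ := μ.posPart + μ.negPart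

/-- The integral `∫ f dμ` (used for continuous `f` with compact support). -/
def integral {E : Type*} [NormedAddCommGroup E] [NormedSpace ℝ E]
    (μ : LocalMeasure) (f : ℝ → E) : E :=
  (∫ x, f x ∂μ.posPart) - ∫ x, f x ∂μ.negPart

/-- The oriented integral `∫_s^t f dμ`: over `(s, t]` if `s ≤ t`, and minus the integral over
`(t, s]` if `t < s`. -/
def integralFromTo {E : Type*} [NormedAddCommGroup E] [NormedSpace ℝ E]
    (μ : LocalMeasure) (f : ℝ → E) (s t : ℝ) : E :=
  (∫ x in s..t, f x ∂μ.posPart) - ∫ x in s..t, f x ∂μ.negPart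

end LocalMeasure

namespace SturmLiouville

/-- The uniform local norm `sup_t ν((t, t + 1])` of a nonnegative measure (for a local measure `μ`
it is applied to `ν = |μ|`). -/
def unifNorm (ν : Measure ℝ) : ℝ≥0∞ := ⨆ t : ℝ, ν (Ioc t (t + 1))

/-- The set of periods of `ρ`: all `r ≠ 0` with `ρ(· + r) = ρ`. -/
def periods (ρ : Measure ℝ) : Set ℝ := {r | r ≠ 0 ∧ ρ.map (fun x => x - r) = ρ}

/-- `F` is locally absolutely continuous with respect to `ν`, with `∂_ν F = h`.
For Lebesgue measure `ν` this says that `F` (as continuous representative) belongs to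
`W^1_{1,loc}(ℝ)` and that `F' = h`. -/
def HasDensity {E : Type*} [NormedAddCommGroup E] [NormedSpace ℝ E]
    (ν : Measure ℝ) (F h : ℝ → E) : Prop :=
  LocallyIntegrable h ν ∧ ∃ c : ℝ, ∀ t : ℝ, F t = F c + ∫ x in c..t, h x ∂ν

/-- The Wasserstein-type seminorm `‖μ‖_I`: the supremum of `|∫ u dμ|` over all
`u ∈ W^1_{1,loc}(ℝ)` with `spt u ⊆ I`, `diam (spt u) ≤ 2` and `‖u'‖_∞ ≤ 1`. -/
def wNorm (μ : LocalMeasure) (I : Set ℝ) : ℝ≥0∞ :=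
  ⨆ u ∈ {u : ℝ → ℝ | tsupport u ⊆ I ∧ Metric.ediam (tsupport u) ≤ 2 ∧
    ∃ u' : ℝ → ℝ, HasDensity volume u u' ∧ ∀ᵐ x, |u' x| ≤ 1}, ‖μ.integral u‖ₑ

/-- The admissible class of coefficients `(a, μ)`: `a ≥ 0`, `a, 1/a ∈ L_∞(ℝ)`, and `μ` is a real
uniformly locally bounded local measure with `spt μ ⊆ spt ρ`. -/
structure Admissible (ρ : Measure ℝ) (a : ℝ → ℝ) (μ : LocalMeasure) : Prop where
  nonneg : ∀ x, 0 ≤ a x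
  memLp : MemLp a ∞ volume
  ne_zero : ∀ᵐ x, a x ≠ 0
  memLp_inv : MemLp (fun x => (a x)⁻¹) ∞ volume
  unif : unifNorm μ.variation < ∞
  support_subset : μ.variation.support ⊆ ρ.support

/-- `(a, μ)` satisfies the weak Gordon condition with weight `C` along the sequence `r`: it is a
sequence in `(0, ∞)` tending to `∞`, and
`exp (C r_m) * (‖a - a(· + r_m)‖_{L_1(-r_m, r_m)} + ‖μ - μ(· + r_m)‖_{[-r_m, r_m]}) → 0`. -/
def WeakGordonAlong (a : ℝ → ℝ) (μ : LocalMeasure) (C : ℝ) (r : ℕ → ℝ) : Prop :=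
  (∀ m, 0 < r m) ∧ Tendsto r atTop atTop ∧
    Tendsto (fun m => ENNReal.ofReal (Real.exp (C * r m)) *
      (eLpNorm (fun x => a x - a (x + r m)) 1 (volume.restrict (Ioo (-(r m)) (r m))) +
        wNorm (μ - μ.translate (r m)) (Icc (-(r m)) (r m)))) atTop (𝓝 0)

/-- For every `C > 0`, the weak Gordon condition with weight `C` holds along some sequence of
periods of `ρ`. -/
def GordonForAllWeights (ρ : Measure ℝ) (a : ℝ → ℝ) (μ : LocalMeasure) : Prop :=
  ∀ C : ℝ, 0 < C → ∃ r : ℕ → ℝ, (∀ m, r m ∈ periods ρ) ∧ WeakGordonAlong a μ C r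

/-- The expression `A_{a,μ} u (t) = -(a u')(t) + ∫_0^t u dμ`, where `u'` is the derivative of `u`;
it is defined up to Lebesgue null sets. -/
def quasiDeriv {𝕜 : Type*} [RCLike 𝕜] (a : ℝ → ℝ) (μ : LocalMeasure) (u u' : ℝ → 𝕜) (t : ℝ) : 𝕜 :=
  -((a t : 𝕜) * u' t) + μ.integralFromTo u 0 t

/-- The graph of the Sturm-Liouville operator `H` in `L_p(ℝ, ρ)`: all pairs `(f, g)` such that `f`
is the class of some `u ∈ W^1_{1,loc}(ℝ)` for which `A_{a,μ} u` is (after modification on a Lebesgue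
null set) locally absolutely continuous with respect to `ρ`, and `∂_ρ A_{a,μ} u = g`. -/
def operatorGraph (𝕜 : Type*) [RCLike 𝕜] (p : ℝ≥0∞) (ρ : Measure ℝ) (a : ℝ → ℝ)
    (μ : LocalMeasure) : Set (Lp 𝕜 p ρ × Lp 𝕜 p ρ) :=
  {fg | ∃ u u' F : ℝ → 𝕜, u =ᵐ[ρ] fg.1 ∧ HasDensity volume u u' ∧
    F =ᵐ[volume] quasiDeriv a μ u u' ∧ HasDensity ρ F fg.2}

/-- `z` is an eigenvalue of `H`: there is `f ≠ 0` in `L_p(ℝ, ρ)` in the domain of `H` with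
`H f = z f`. -/
def IsEigenvalue {𝕜 : Type*} [RCLike 𝕜] (p : ℝ≥0∞) (ρ : Measure ℝ) (a : ℝ → ℝ)
    (μ : LocalMeasure) (z : 𝕜) : Prop :=
  ∃ f : Lp 𝕜 p ρ, f ≠ 0 ∧ (f, z • f) ∈ operatorGraph 𝕜 p ρ a μ

/-- The strong Liouville condition: `|α - p_m / q_m| ≤ B m^(-q_m)` for `m = 1, 2, …`, for some
`B > 0` and some sequence of fractions `p_m / q_m`. -/
def StrongLiouville (α : ℝ) : Prop :=
  ∃ B : ℝ, 0 < B ∧ ∃ (num : ℕ → ℤ) (den : ℕ → ℕ), (∀ m, 0 < den m) ∧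
    ∀ m : ℕ, 1 ≤ m → |α - (num m : ℝ) / (den m : ℝ)| ≤ B / (m : ℝ) ^ den m

end SturmLiouville

end

/-!
The eigenvalue equation `H u = z u` is the first order system `u' = b w`, `dw = u (dμ - z dρ)` with
`b = 1 / a` and `w = a u'`. The quasi-derivative `w` may jump, but it enters the equation for `u`
only through a Lebesgue integral, so that solutions grow at most exponentially
(`exists_growth_bound`).

*Gordon's argument.* Let `r` be a period of `ρ`. If `a` and `μ` were `r`-periodic, then the
translates of a solution `y = (u, w)` by `r` and by `-r` would be solutions, and constancy of the
Wronskian would make `y(· + r) + y(· - r)` a multiple `d y`. At `r` this reads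
`y(2 r) + y(0) = d y(r)`, and it bounds `y(0)` by the values of `y` at `-r`, `r` and `2 r`. For
coefficients that are only almost periodic the same holds up to an error (`gordon_estimate`), which
the weak Gordon condition makes small in spite of the exponential growth of `y`. An eigenfunction,
however, tends to `0` at `±∞` together with its quasi-derivative (`exists_forall_norm_le`): it lies
in `L_p` of a periodic measure, and `μ` lives on the support of that measure. So `y(0) = 0`, and
`y` vanishes.

*The weak seminorm.* The difference of `μ` and `μ(· + r)` is small only against Lipschitz functions,
so it is no small perturbation of the equation for `w`. By duality, smallness in the seminorm means
that the difference of the distribution functions is close to a constant in `L_1`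
(`exists_const_integral_abs_cdf_sub_le`). Adding that difference times `u(· + r)` to `w(· + r)`
turns the translate into a solution up to errors that are integrable against Lebesgue measure and
controlled by this `L_1` distance (`ApproxSolution.shift`).

*Sums of periodic pairs.* If `n / q` is a very good approximation of `α`, then `n τ` is a period of
the first pair and differs from the period `q α τ` of the second one by a tiny number. Hölder
continuity of `a₂`, and Lipschitz continuity of translations in the weak seminorm
(`wNorm_le_of_translate`), turn this into the weak Gordon condition (`gordonForAllWeights_add`).
-/

/-! ### Primitives with respect to a measure -/

namespace SturmLiouville

theorem intervalIntegrable_of_locallyIntegrable {E : Type*} [NormedAddCommGroup E]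
    {ν : Measure ℝ} {f : ℝ → E} (hf : LocallyIntegrable f ν) (s t : ℝ) :
    IntervalIntegrable f ν s t :=
  ⟨(hf.integrableOn_isCompact isCompact_Icc).mono_set Ioc_subset_Icc_self,
    (hf.integrableOn_isCompact isCompact_Icc).mono_set Ioc_subset_Icc_self⟩

section HasDensity

variable {E : Type*} [NormedAddCommGroup E] [NormedSpace ℝ E] {ν : Measure ℝ} {F G f g : ℝ → E}

theorem HasDensity.intervalIntegrable (hF : HasDensity ν F f) (s t : ℝ) :
    IntervalIntegrable f ν s t :=
  intervalIntegrable_of_locallyIntegrable hF.1 s t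

theorem HasDensity.sub_eq (hF : HasDensity ν F f) (s t : ℝ) :
    F t - F s = ∫ x in s..t, f x ∂ν := by
  obtain ⟨c, hc⟩ := hF.2
  rw [hc t, hc s, add_sub_add_left_eq_sub,
    intervalIntegral.integral_interval_sub_left (hF.intervalIntegrable _ _)
      (hF.intervalIntegrable _ _)]

theorem HasDensity.eq_add (hF : HasDensity ν F f) (s t : ℝ) :
    F t = F s + ∫ x in s..t, f x ∂ν := by
  rw [← hF.sub_eq]; abel

theorem hasDensity_integral (hf : LocallyIntegrable f ν) (c : ℝ) :
    HasDensity ν (fun t => ∫ x in c..t, f x ∂ν) f :=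
  ⟨hf, c, fun t => by simp⟩

theorem HasDensity.of_sub_eq (hf : LocallyIntegrable f ν)
    (h : ∀ s t, F t - F s = ∫ x in s..t, f x ∂ν) : HasDensity ν F f :=
  ⟨hf, 0, fun t => by rw [← h]; abel⟩

theorem HasDensity.add (hF : HasDensity ν F f) (hG : HasDensity ν G g) :
    HasDensity ν (fun t => F t + G t) (fun t => f t + g t) := by
  refine .of_sub_eq (hF.1.add hG.1) fun s t => ?_
  rw [intervalIntegral.integral_add (hF.intervalIntegrable _ _) (hG.intervalIntegrable _ _),
    ← hF.sub_eq, ← hG.sub_eq]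
  abel

theorem HasDensity.const_mul {𝕜 : Type*} [RCLike 𝕜] {F f : ℝ → 𝕜} (hF : HasDensity ν F f)
    (c : 𝕜) : HasDensity ν (fun t => c * F t) (fun t => c * f t) := by
  refine .of_sub_eq (hF.1.smul c) fun s t => ?_
  rw [intervalIntegral.integral_const_mul, ← hF.sub_eq, mul_sub]

theorem HasDensity.congr_density (hF : HasDensity ν F f) (h : f =ᵐ[ν] g) :
    HasDensity ν F g := by
  refine .of_sub_eq ?_ fun s t => ?_
  · intro x
    obtain ⟨U, hU, hi⟩ := hF.1 x
    exact ⟨U, hU, hi.congr (ae_restrict_of_ae h)⟩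
  · rw [hF.sub_eq]
    exact intervalIntegral.integral_congr_ae (h.mono fun x hx _ => hx)

theorem HasDensity.continuous {F f : ℝ → E} (hF : HasDensity volume F f) : Continuous F := by
  have : F = fun t => F 0 + ∫ x in (0 : ℝ)..t, f x := funext fun t => hF.eq_add 0 t
  rw [this]
  exact continuous_const.add (intervalIntegral.continuous_primitive
    (fun a b => hF.intervalIntegrable a b) 0)

/-- A primitive with respect to a locally finite measure is measurable. -/
theorem HasDensity.measurable {𝕜 : Type*} [RCLike 𝕜] {F f : ℝ → 𝕜} [IsLocallyFiniteMeasure ν]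
    (hF : HasDensity ν F f) : Measurable F := by
  obtain ⟨f', hf', hff'⟩ := hF.1.aestronglyMeasurable
  -- `F` is an integral over the sections of a measurable set in the plane
  have key : ∀ A : Set (ℝ × ℝ), MeasurableSet A →
      Measurable fun t : ℝ => ∫ x, A.indicator (fun z => f' z.2) (t, x) ∂ν := by
    intro A hA
    refine (StronglyMeasurable.integral_prod_right ?_).measurable
    exact (hf'.comp_measurable measurable_snd).indicator hA
  have h1 := key {z | 0 < z.2 ∧ z.2 ≤ z.1} ((measurableSet_lt measurable_const measurable_snd).inter
    (measurableSet_le measurable_snd measurable_fst))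
  have h2 := key {z | z.1 < z.2 ∧ z.2 ≤ 0} ((measurableSet_lt measurable_fst measurable_snd).inter
    (measurableSet_le measurable_snd measurable_const))
  have : F = fun t => F 0 + ((∫ x, {z : ℝ × ℝ | 0 < z.2 ∧ z.2 ≤ z.1}.indicator
      (fun z => f' z.2) (t, x) ∂ν) - ∫ x, {z : ℝ × ℝ | z.1 < z.2 ∧ z.2 ≤ 0}.indicator
      (fun z => f' z.2) (t, x) ∂ν) := by
    funext t
    rw [hF.eq_add 0 t, intervalIntegral.integral_congr_ae (hff'.mono fun x hx _ => hx),
      intervalIntegral, ← integral_indicator measurableSet_Ioc,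
      ← integral_indicator measurableSet_Ioc]
    rfl
  rw [this]
  exact measurable_const.add (h1.sub h2)

theorem norm_intervalIntegral_le_setIntegral (s t : ℝ) {p q : ℝ} (hs : s ∈ Icc p q)
    (ht : t ∈ Icc p q) (hf : LocallyIntegrable f ν) :
    ‖∫ x in s..t, f x ∂ν‖ ≤ ∫ x in Ioc p q, ‖f x‖ ∂ν := by
  refine (intervalIntegral.norm_integral_le_integral_norm_uIoc).trans ?_
  refine setIntegral_mono_set ?_ (Eventually.of_forall fun _ => norm_nonneg _)
    (Eventually.of_forall ?_)
  · exact ((hf.integrableOn_isCompact isCompact_Icc).mono_set Ioc_subset_Icc_self).norm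
  · exact Ioc_subset_Ioc (le_min hs.1 ht.1) (max_le hs.2 ht.2)

theorem HasDensity.exists_bound (hF : HasDensity ν F f) (p q : ℝ) :
    ∃ B, 0 ≤ B ∧ ∀ t ∈ Icc p q, ‖F t‖ ≤ B := by
  refine ⟨‖F p‖ + ∫ x in Ioc p q, ‖f x‖ ∂ν, by positivity, fun t ht => ?_⟩
  rw [hF.eq_add p t]
  exact (norm_add_le _ _).trans (add_le_add le_rfl (norm_intervalIntegral_le_setIntegral p t
    ⟨le_rfl, ht.1.trans ht.2⟩ ht hF.1))

end HasDensity

section Product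

variable {𝕜 : Type*} [RCLike 𝕜]

theorem locallyIntegrable_of_bound {F : ℝ → 𝕜} {ν : Measure ℝ} [IsLocallyFiniteMeasure ν]
    (hm : AEStronglyMeasurable F ν)
    (hb : ∀ p q : ℝ, ∃ B, 0 ≤ B ∧ ∀ t ∈ Icc p q, ‖F t‖ ≤ B) : LocallyIntegrable F ν := by
  intro x
  obtain ⟨B, -, hB⟩ := hb (x - 1) (x + 1)
  refine ⟨Icc (x - 1) (x + 1), Icc_mem_nhds (by linarith) (by linarith), ?_⟩
  exact IntegrableOn.of_bound isCompact_Icc.measure_lt_top hm.restrict B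
    (ae_restrict_of_forall_mem measurableSet_Icc hB)

theorem locallyIntegrable_bounded_mul {F f : ℝ → 𝕜} {ν : Measure ℝ} [IsLocallyFiniteMeasure ν]
    (hf : LocallyIntegrable f ν) (hm : AEStronglyMeasurable F ν)
    (hb : ∀ p q : ℝ, ∃ B, 0 ≤ B ∧ ∀ t ∈ Icc p q, ‖F t‖ ≤ B) :
    LocallyIntegrable (fun x => F x * f x) ν := by
  intro x
  obtain ⟨B, -, hB⟩ := hb (x - 1) (x + 1)
  refine ⟨Icc (x - 1) (x + 1), Icc_mem_nhds (by linarith) (by linarith), ?_⟩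
  have := hf.integrableOn_isCompact (isCompact_Icc (a := x - 1) (b := x + 1))
  exact this.bdd_mul (c := B) hm.restrict (ae_restrict_of_forall_mem measurableSet_Icc hB)

/-- Integration by parts for `U` absolutely continuous with respect to Lebesgue measure and `W` a
primitive with respect to an arbitrary locally finite measure. There is no jump term, since `U` is
continuous. The proof integrates `f(x) g(y)` over the two triangles `x < y` and `y ≤ x`. -/
theorem HasDensity.mul_sub_mul {U W f g : ℝ → 𝕜} {ν : Measure ℝ} [IsLocallyFiniteMeasure ν]
    (hU : HasDensity volume U f) (hW : HasDensity ν W g) (s t : ℝ) :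
    U t * W t - U s * W s = (∫ x in s..t, U x * g x ∂ν) + ∫ x in s..t, f x * W x := by
  wlog hst : s ≤ t generalizing s t
  · have := this t s (le_of_not_ge hst)
    rw [intervalIntegral.integral_symm t s, intervalIntegral.integral_symm t s, ← neg_add, ← this]
    ring
  have hf : Integrable f (volume.restrict (Ioc s t)) :=
    (hU.1.integrableOn_isCompact isCompact_Icc).mono_set (Ioc_subset_Icc_self (a := s) (b := t))
  have hg : Integrable g (ν.restrict (Ioc s t)) :=
    (hW.1.integrableOn_isCompact isCompact_Icc).mono_set (Ioc_subset_Icc_self (a := s) (b := t))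
  have hfg := hf.mul_prod hg
  set A : Set (ℝ × ℝ) := {z | z.1 < z.2} with hA_def
  have hA : MeasurableSet A := measurableSet_lt measurable_fst measurable_snd
  have e1 : ∫ z in A, f z.1 * g z.2 ∂((volume.restrict (Ioc s t)).prod (ν.restrict (Ioc s t))) =
      ∫ y in Ioc s t, (U y - U s) * g y ∂ν := by
    rw [← integral_indicator hA, integral_prod_symm _ (hfg.indicator hA)]
    refine setIntegral_congr_fun measurableSet_Ioc fun y hy => ?_
    rw [hU.sub_eq, intervalIntegral.integral_of_le hy.1.le, ← integral_mul_const,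
      integral_Ioc_eq_integral_Ioo (f := fun x => f x * g y), ← integral_indicator measurableSet_Ioo,
      ← integral_indicator measurableSet_Ioc]
    congr 1
    funext x
    by_cases h1 : x < y <;> by_cases h2 : s < x <;> by_cases h3 : x ≤ t <;>
      simp [indicator, hA_def, h1, h2, h3]
    exact absurd (h1.le.trans hy.2) h3
  have e2 : ∫ z in Aᶜ, f z.1 * g z.2 ∂((volume.restrict (Ioc s t)).prod (ν.restrict (Ioc s t))) =
      ∫ x in Ioc s t, f x * (W x - W s) := by
    rw [← integral_indicator hA.compl, integral_prod _ (hfg.indicator hA.compl)]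
    refine setIntegral_congr_fun measurableSet_Ioc fun x hx => ?_
    rw [hW.sub_eq, intervalIntegral.integral_of_le hx.1.le, ← integral_const_mul,
      ← integral_indicator measurableSet_Ioc, ← integral_indicator measurableSet_Ioc]
    congr 1
    funext y
    by_cases h1 : y ≤ x <;> by_cases h2 : s < y <;> by_cases h3 : y ≤ t <;>
      simp [indicator, hA_def, h1, h2, h3]
    exact absurd (h1.trans hx.2) h3
  have e3 := integral_add_compl hA hfg
  rw [e1, e2, integral_prod_mul, ← intervalIntegral.integral_of_le hst,
    ← intervalIntegral.integral_of_le hst, ← intervalIntegral.integral_of_le hst,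
    ← intervalIntegral.integral_of_le hst, ← hU.sub_eq, ← hW.sub_eq] at e3
  have hUg : IntervalIntegrable (fun y => U y * g y) ν s t :=
    intervalIntegrable_of_locallyIntegrable (locallyIntegrable_bounded_mul hW.1
      hU.continuous.aestronglyMeasurable hU.exists_bound) s t
  have hfW : IntervalIntegrable (fun y => W y * f y) volume s t :=
    intervalIntegrable_of_locallyIntegrable (locallyIntegrable_bounded_mul hU.1
      hW.measurable.aestronglyMeasurable hW.exists_bound) s t
  have e4 : ∫ y in s..t, (U y - U s) * g y ∂ν = (∫ y in s..t, U y * g y ∂ν) - U s * (W t - W s) := by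
    simp_rw [sub_mul]
    rw [intervalIntegral.integral_sub hUg ((hW.intervalIntegrable s t).const_mul _),
      intervalIntegral.integral_const_mul, ← hW.sub_eq]
  have e5 : ∫ y in s..t, f y * (W y - W s) = (∫ y in s..t, f y * W y) - (U t - U s) * W s := by
    simp_rw [mul_sub]
    rw [intervalIntegral.integral_sub (by simpa only [mul_comm] using hfW)
      ((hU.intervalIntegrable s t).mul_const _),
      intervalIntegral.integral_mul_const, ← hU.sub_eq]
  rw [e4, e5] at e3
  linear_combination -e3

/-- The product rule for functions in `W^1_{1,loc}(ℝ)`. -/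
theorem HasDensity.mul {U V f g : ℝ → 𝕜} (hU : HasDensity volume U f)
    (hV : HasDensity volume V g) :
    HasDensity volume (fun x => U x * V x) (fun x => U x * g x + V x * f x) := by
  have h1 : LocallyIntegrable (fun x => U x * g x) volume :=
    locallyIntegrable_bounded_mul hV.1 hU.continuous.aestronglyMeasurable hU.exists_bound
  have h2 : LocallyIntegrable (fun x => V x * f x) volume :=
    locallyIntegrable_bounded_mul hU.1 hV.continuous.aestronglyMeasurable hV.exists_bound
  refine .of_sub_eq (h1.add h2) fun s t => ?_
  rw [hU.mul_sub_mul hV, intervalIntegral.integral_add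
    (intervalIntegrable_of_locallyIntegrable h1 s t)
    (intervalIntegrable_of_locallyIntegrable h2 s t)]
  simp_rw [mul_comm (V _)]

end Product

end SturmLiouville

/-! ### The first order system with error terms -/

namespace SturmLiouville

section ApproxSolution

variable {𝕜 : Type*} [RCLike 𝕜]

/-- `(u, w)` solves the first order system `u' = b w + f`, `dw = k u dν + g dx`. With `b = 1 / a`
and `k dν = dμ - z dρ` and without the error terms `f` and `g`, this is the eigenvalue equation
`H u = z u`, with `w = a u'`. -/
structure ApproxSolution (ν : Measure ℝ) (b k u w f g : ℝ → 𝕜) : Prop where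
  locallyIntegrable : LocallyIntegrable f volume
  left : HasDensity volume u (fun x => b x * w x + f x)
  right : ∃ w₂, HasDensity volume w₂ g ∧ HasDensity ν (fun t => w t - w₂ t) (fun x => k x * u x)

variable {ν : Measure ℝ} {b k u w f g u₁ w₁ f₁ g₁ u₂ w₂ f₂ g₂ : ℝ → 𝕜}

theorem ApproxSolution.add (h₁ : ApproxSolution ν b k u₁ w₁ f₁ g₁)
    (h₂ : ApproxSolution ν b k u₂ w₂ f₂ g₂) :
    ApproxSolution ν b k (fun t => u₁ t + u₂ t) (fun t => w₁ t + w₂ t) (fun t => f₁ t + f₂ t)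
      (fun t => g₁ t + g₂ t) where
  locallyIntegrable := h₁.locallyIntegrable.add h₂.locallyIntegrable
  left := by
    convert h₁.left.add h₂.left using 2
    ring
  right := by
    obtain ⟨v₁, hv₁, hw₁⟩ := h₁.right
    obtain ⟨v₂, hv₂, hw₂⟩ := h₂.right
    refine ⟨_, hv₁.add hv₂, ?_⟩
    convert hw₁.add hw₂ using 2 <;> ring

theorem ApproxSolution.const_mul (h₁ : ApproxSolution ν b k u w f g) (c : 𝕜) :
    ApproxSolution ν b k (fun t => c * u t) (fun t => c * w t) (fun t => c * f t)
      (fun t => c * g t) where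
  locallyIntegrable := h₁.locallyIntegrable.smul c
  left := by
    convert h₁.left.const_mul c using 2
    ring
  right := by
    obtain ⟨v₁, hv₁, hw₁⟩ := h₁.right
    refine ⟨_, hv₁.const_mul c, ?_⟩
    convert hw₁.const_mul c using 2 <;> ring

theorem ApproxSolution.right_sub_eq (h : ApproxSolution ν b k u w f g) (s t : ℝ) :
    w t - w s = (∫ x in s..t, k x * u x ∂ν) + ∫ x in s..t, g x := by
  obtain ⟨v, hv, hw⟩ := h.right
  rw [← hv.sub_eq, ← hw.sub_eq]
  ring

theorem ApproxSolution.locallyIntegrable_right (h : ApproxSolution ν b k u w f g) :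
    LocallyIntegrable g volume := by
  obtain ⟨v, hv, hw⟩ := h.right
  exact hv.1

theorem ApproxSolution.exists_bound (h : ApproxSolution ν b k u w f g) (p q : ℝ) :
    ∃ B, 0 ≤ B ∧ ∀ t ∈ Icc p q, ‖w t‖ ≤ B := by
  obtain ⟨v, hv, hw⟩ := h.right
  obtain ⟨B, hB, hB'⟩ := (hv.exists_bound p q)
  obtain ⟨C, hC, hC'⟩ := (hw.exists_bound p q)
  refine ⟨B + C, by positivity, fun t ht => ?_⟩
  have : w t = v t + (w t - v t) := by ring
  rw [this]
  exact (norm_add_le _ _).trans (add_le_add (hB' t ht) (hC' t ht))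

theorem norm_intervalIntegral_le_mul_measure {h : ℝ → 𝕜} {C m : ℝ} (hC : 0 ≤ C) (hm : 0 ≤ m)
    {s t : ℝ} (hb : ∀ x ∈ uIoc s t, ‖h x‖ ≤ C) (hν : ν (uIoc s t) ≤ ENNReal.ofReal m) :
    ‖∫ x in s..t, h x ∂ν‖ ≤ C * m := by
  rw [intervalIntegral.norm_intervalIntegral_eq]
  refine (norm_setIntegral_le_of_norm_le_const (hν.trans_lt ENNReal.ofReal_lt_top) hb).trans ?_
  exact mul_le_mul_of_nonneg_left (ENNReal.toReal_le_of_le_ofReal hm hν) hC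

theorem uIoc_subset_uIoc {s t x y : ℝ} (hx : x ∈ uIcc s t) (hy : y ∈ uIcc s t) :
    uIoc x y ⊆ uIoc s t :=
  Ioc_subset_Ioc (le_min hx.1 hy.1) (max_le hx.2 hy.2)

/-- A Gronwall type estimate over a short interval. No integral inequality is needed: `w` enters
the equation for `u` only through a Lebesgue integral, which is small for a short interval, while
`u` is continuous, so that atoms of `ν` do no harm. -/
theorem ApproxSolution.norm_add_norm_le_of_short (h : ApproxSolution ν b k u w f g)
    {β κ Λ ℓ δ s t : ℝ} (hκ : 0 ≤ κ) (hΛ : 0 ≤ Λ) (hδ : 0 ≤ δ)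
    (hb : ∀ x, ‖b x‖ ≤ β) (hk : ∀ x, ‖k x‖ ≤ κ)
    (hν : ∀ t, ν (Ioc t (t + 1)) ≤ ENNReal.ofReal Λ)
    (hℓ₁ : ℓ ≤ 1) (hℓ₂ : β * ℓ ≤ 1) (hℓ₃ : β * ℓ * (κ * Λ) ≤ 1 / 2) (hst : |t - s| ≤ ℓ)
    (hf : ∫ x in uIoc s t, ‖f x‖ ≤ δ) (hg : ∫ x in uIoc s t, ‖g x‖ ≤ δ) :
    ‖u t‖ + ‖w t‖ + δ ≤ (6 + 4 * (κ * Λ)) * (‖u s‖ + ‖w s‖ + δ) := by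
  have hβ : 0 ≤ β := (norm_nonneg _).trans (hb 0)
  have hℓ : 0 ≤ ℓ := (abs_nonneg _).trans hst
  obtain ⟨x₀, hx₀, hmax⟩ := isCompact_uIcc.exists_isMaxOn ⟨s, left_mem_uIcc (b := t)⟩
    h.left.continuous.norm.continuousOn
  have hmax' : ∀ x ∈ uIcc s t, ‖u x‖ ≤ ‖u x₀‖ := fun x hx => hmax hx
  set U := ‖u x₀‖
  have hU : 0 ≤ U := norm_nonneg _
  have hsub : ∀ x ∈ uIcc s t, uIoc s x ⊆ uIoc s t := fun x hx =>
    uIoc_subset_uIoc left_mem_uIcc hx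
  have hint : ∀ (q : ℝ → 𝕜), LocallyIntegrable q volume → ∫ x in uIoc s t, ‖q x‖ ≤ δ →
      ∀ x ∈ uIcc s t, ‖∫ y in s..x, q y‖ ≤ δ := by
    intro q hq hqδ x hx
    refine intervalIntegral.norm_integral_le_integral_norm_uIoc.trans (le_trans ?_ hqδ)
    refine setIntegral_mono_set ?_ (Eventually.of_forall fun _ => norm_nonneg _)
      (hsub x hx).eventuallyLE
    exact ((hq.integrableOn_isCompact isCompact_uIcc).mono_set uIoc_subset_uIcc).norm
  have hν' : ∀ x ∈ uIcc s t, ν (uIoc s x) ≤ ENNReal.ofReal Λ := by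
    intro x hx
    refine (measure_mono ((hsub x hx).trans ?_)).trans (hν (min s t))
    refine Ioc_subset_Ioc le_rfl ?_
    have := max_sub_min_eq_abs' s t
    rw [abs_sub_comm] at this
    linarith
  have hw : ∀ x ∈ uIcc s t, ‖w x‖ ≤ ‖w s‖ + κ * Λ * U + δ := by
    intro x hx
    have e := h.right_sub_eq s x
    have e1 : ‖∫ y in s..x, k y * u y ∂ν‖ ≤ (κ * U) * Λ := by
      refine norm_intervalIntegral_le_mul_measure (by positivity) hΛ (fun y hy => ?_) (hν' x hx)
      rw [norm_mul]
      exact mul_le_mul (hk y) (hmax' y (uIoc_subset_uIcc (hsub x hx hy))) (norm_nonneg _) hκ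
    have e2 := hint g h.locallyIntegrable_right hg x hx
    have e3 : w x = w s + ((∫ y in s..x, k y * u y ∂ν) + ∫ y in s..x, g y) := by
      rw [← e]; ring
    rw [e3]
    refine (norm_add_le _ _).trans ?_
    have := norm_add_le (∫ y in s..x, k y * u y ∂ν) (∫ y in s..x, g y)
    nlinarith
  set W := ‖w s‖ + κ * Λ * U + δ
  have hW : 0 ≤ W := by positivity
  have hU' : U ≤ ‖u s‖ + β * ℓ * W + δ := by
    have hbw : IntervalIntegrable (fun y => b y * w y) volume s x₀ := by
      have := intervalIntegrable_of_locallyIntegrable (h.left.1.sub h.locallyIntegrable) s x₀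
      simpa [Pi.sub_def] using this
    have e := h.left.eq_add s x₀
    rw [intervalIntegral.integral_add hbw
      (intervalIntegrable_of_locallyIntegrable h.locallyIntegrable s x₀)] at e
    have e1 : ‖∫ y in s..x₀, b y * w y‖ ≤ (β * W) * ℓ := by
      refine norm_intervalIntegral_le_mul_measure (by positivity) hℓ (fun y hy => ?_) ?_
      · rw [norm_mul]
        exact mul_le_mul (hb y) (hw y (uIoc_subset_uIcc (hsub _ hx₀ hy))) (norm_nonneg _) hβ
      · refine (measure_mono (hsub _ hx₀)).trans ?_
        rw [uIoc, Real.volume_Ioc, max_sub_min_eq_abs]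
        exact ENNReal.ofReal_le_ofReal hst
    have e2 := hint f h.locallyIntegrable hf x₀ hx₀
    have h3 := norm_add_le (∫ y in s..x₀, b y * w y) (∫ y in s..x₀, f y)
    have h4 := norm_add_le (u s) ((∫ y in s..x₀, b y * w y) + ∫ y in s..x₀, f y)
    rw [← e] at h4
    nlinarith
  have h1 := hmax' t right_mem_uIcc
  have h2 := hw t right_mem_uIcc
  have hus := norm_nonneg (u s)
  have hws := norm_nonneg (w s)
  have hκΛ : 0 ≤ κ * Λ := by positivity
  -- the term with `U` on the right of `hU'` has a factor of at most `1 / 2` and is absorbed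
  have hU2 : U ≤ 4 * (‖u s‖ + ‖w s‖ + δ) := by
    have : β * ℓ * W = β * ℓ * (‖w s‖ + δ) + β * ℓ * (κ * Λ) * U := by
      simp only [W]; ring
    have h5 : β * ℓ * (‖w s‖ + δ) ≤ 1 * (‖w s‖ + δ) :=
      mul_le_mul_of_nonneg_right hℓ₂ (by positivity)
    have h6 : β * ℓ * (κ * Λ) * U ≤ 1 / 2 * U := mul_le_mul_of_nonneg_right hℓ₃ hU
    linarith
  have h7 : κ * Λ * U ≤ κ * Λ * (4 * (‖u s‖ + ‖w s‖ + δ)) := mul_le_mul_of_nonneg_left hU2 hκΛ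
  simp only [W] at h2
  linarith

/-- The short-interval estimate, iterated over `n` intervals of length at most `ℓ`. -/
theorem ApproxSolution.norm_add_norm_le_pow (h : ApproxSolution ν b k u w f g)
    {β κ Λ ℓ δ : ℝ} (hκ : 0 ≤ κ) (hΛ : 0 ≤ Λ) (hδ : 0 ≤ δ)
    (hb : ∀ x, ‖b x‖ ≤ β) (hk : ∀ x, ‖k x‖ ≤ κ)
    (hν : ∀ t, ν (Ioc t (t + 1)) ≤ ENNReal.ofReal Λ)
    (hℓ₁ : ℓ ≤ 1) (hℓ₂ : β * ℓ ≤ 1) (hℓ₃ : β * ℓ * (κ * Λ) ≤ 1 / 2) {s : ℝ} (n : ℕ) :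
    ∀ t : ℝ, |t - s| ≤ n * ℓ → ∫ x in uIoc s t, ‖f x‖ ≤ δ → ∫ x in uIoc s t, ‖g x‖ ≤ δ →
    ‖u t‖ + ‖w t‖ + δ ≤ (6 + 4 * (κ * Λ)) ^ n * (‖u s‖ + ‖w s‖ + δ) := by
  induction n with
  | zero =>
    intro t ht _ _
    have : t = s := by
      simp only [Nat.cast_zero, zero_mul, abs_nonpos_iff] at ht
      linarith
    simp [this]
  | succ n ih =>
    intro t ht hf hg
    -- the point that divides the way from `s` to `t` in the ratio `n : 1`
    set c : ℝ := n / (n + 1) with hc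
    have hc0 : 0 ≤ c := by positivity
    have hc1 : c ≤ 1 := by rw [hc, div_le_one (by positivity)]; linarith
    set s' := s + c * (t - s) with hs'
    have hmem : s' ∈ uIcc s t := by
      rcases le_total s t with hst | hst
      · rw [uIcc_of_le hst]; constructor <;> nlinarith
      · rw [uIcc_of_ge hst]; constructor <;> nlinarith
    have mono : ∀ (q : ℝ → 𝕜), LocallyIntegrable q volume → ∀ A ⊆ uIoc s t,
        ∫ x in uIoc s t, ‖q x‖ ≤ δ → ∫ x in A, ‖q x‖ ≤ δ := by
      intro q hq A hA hqδ
      refine le_trans (setIntegral_mono_set ?_ (Eventually.of_forall fun _ => norm_nonneg _)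
        hA.eventuallyLE) hqδ
      exact ((hq.integrableOn_isCompact isCompact_uIcc).mono_set uIoc_subset_uIcc).norm
    have s1 : uIoc s s' ⊆ uIoc s t := uIoc_subset_uIoc left_mem_uIcc hmem
    have s2 : uIoc s' t ⊆ uIoc s t := uIoc_subset_uIoc hmem right_mem_uIcc
    push_cast at ht
    have hn : (0 : ℝ) < n + 1 := by positivity
    have d1 : |s' - s| ≤ n * ℓ := by
      rw [hs', add_sub_cancel_left, abs_mul, abs_of_nonneg hc0, hc, div_mul_eq_mul_div,
        div_le_iff₀ hn]
      nlinarith [mul_le_mul_of_nonneg_left ht (Nat.cast_nonneg (α := ℝ) n)]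
    have d2 : |t - s'| ≤ ℓ := by
      have : t - s' = (1 / (n + 1)) * (t - s) := by
        rw [hs', hc]; field_simp; ring
      rw [this, abs_mul, abs_of_nonneg (by positivity), one_div, inv_mul_le_iff₀ hn]
      exact ht
    have h1 := ih s' d1 (mono f h.locallyIntegrable _ s1 hf)
      (mono g h.locallyIntegrable_right _ s1 hg)
    have h2 := h.norm_add_norm_le_of_short hκ hΛ hδ hb hk hν hℓ₁ hℓ₂ hℓ₃ d2
      (mono f h.locallyIntegrable _ s2 hf) (mono g h.locallyIntegrable_right _ s2 hg)
    refine h2.trans ?_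
    rw [pow_succ', mul_assoc]
    exact mul_le_mul_of_nonneg_left h1 (by positivity)

/-- The growth estimate for approximate solutions: the constants depend only on the bounds for the
coefficients. -/
theorem exists_growth_bound (𝕜 : Type*) [RCLike 𝕜] (β κ Λ : ℝ) :
    ∃ A γ : ℝ, 1 ≤ A ∧ 1 ≤ γ ∧ ∀ (ν : Measure ℝ)
      (b k u w f g : ℝ → 𝕜), ApproxSolution ν b k u w f g →
      (∀ x, ‖b x‖ ≤ β) → (∀ x, ‖k x‖ ≤ κ) → (∀ t, ν (Ioc t (t + 1)) ≤ ENNReal.ofReal Λ) →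
      ∀ s t δ : ℝ, 0 ≤ δ → ∫ x in uIoc s t, ‖f x‖ ≤ δ → ∫ x in uIoc s t, ‖g x‖ ≤ δ →
      ‖u t‖ + ‖w t‖ ≤ A * Real.exp (γ * |t - s|) * (‖u s‖ + ‖w s‖ + δ) := by
  set Λ' := max Λ 0
  set κ' := max κ 0
  set β' := max β 0
  have hΛ' : 0 ≤ Λ' := le_max_right _ _
  have hκ' : 0 ≤ κ' := le_max_right _ _
  have hβ' : 0 ≤ β' := le_max_right _ _
  set ℓ : ℝ := 1 / (2 * (1 + β') * (1 + κ' * Λ')) with hℓ_def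
  have hκΛ : 0 ≤ κ' * Λ' := by positivity
  have hD : 0 < 2 * (1 + β') * (1 + κ' * Λ') := by positivity
  have hℓ : 0 < ℓ := by positivity
  have hβκ : 0 ≤ β' * (κ' * Λ') := by positivity
  have hℓ₁ : ℓ ≤ 1 := by
    rw [hℓ_def, div_le_one hD]; nlinarith
  have hℓ₂ : β' * ℓ ≤ 1 := by
    rw [hℓ_def, mul_one_div, div_le_one hD]; nlinarith
  have hℓ₃ : β' * ℓ * (κ' * Λ') ≤ 1 / 2 := by
    rw [hℓ_def, mul_one_div, div_mul_eq_mul_div, div_le_iff₀ hD]; nlinarith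
  set G : ℝ := 6 + 4 * (κ' * Λ')
  have hG : 1 ≤ G := by simp only [G]; linarith
  have hlog : 0 ≤ Real.log G := Real.log_nonneg hG
  refine ⟨G, Real.log G / ℓ + 1, hG, by have : 0 ≤ Real.log G / ℓ := by positivity
                                        linarith, ?_⟩
  intro ν b k u w f g h hb hk hν s t δ hδ hf hg
  set n := ⌈|t - s| / ℓ⌉₊
  have hn : |t - s| ≤ n * ℓ := by
    rw [← div_le_iff₀ hℓ]; exact Nat.le_ceil _
  have := h.norm_add_norm_le_pow hκ' hΛ' hδ (fun x => (hb x).trans (le_max_left _ _))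
    (fun x => (hk x).trans (le_max_left _ _))
    (fun t => (hν t).trans (ENNReal.ofReal_le_ofReal (le_max_left _ _))) hℓ₁ hℓ₂ hℓ₃ n t hn hf hg
  have hpow : G ^ n ≤ G * Real.exp ((Real.log G / ℓ + 1) * |t - s|) := by
    have hn' : (n : ℝ) ≤ |t - s| / ℓ + 1 := (Nat.ceil_lt_add_one (by positivity)).le
    calc G ^ n = Real.exp (n * Real.log G) := by
          rw [mul_comm, Real.exp_mul, Real.exp_log (by linarith), Real.rpow_natCast]
      _ ≤ Real.exp ((|t - s| / ℓ + 1) * Real.log G) :=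
          Real.exp_le_exp.2 (mul_le_mul_of_nonneg_right hn' hlog)
      _ = G * Real.exp (Real.log G / ℓ * |t - s|) := by
          rw [add_mul, one_mul, Real.exp_add, Real.exp_log (by linarith), mul_comm]
          congr 2; ring
      _ ≤ _ := by
          refine mul_le_mul_of_nonneg_left (Real.exp_le_exp.2 ?_) (by linarith)
          nlinarith [abs_nonneg (t - s)]
  have hN : 0 ≤ ‖u s‖ + ‖w s‖ + δ := by positivity
  have := this.trans (mul_le_mul_of_nonneg_right hpow hN)
  linarith

variable [IsLocallyFiniteMeasure ν]

theorem ApproxSolution.measurable (h : ApproxSolution ν b k u w f g) : Measurable w := by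
  obtain ⟨v, hv, hw⟩ := h.right
  have := hv.measurable.add hw.measurable
  simpa [Pi.add_def] using this

/-- Integration by parts for the component `w`, tested with a `W^1_{1,loc}` function `v`. -/
theorem ApproxSolution.mul_sub_mul {v v' : ℝ → 𝕜} (h : ApproxSolution ν b k u w f g)
    (hv : HasDensity volume v v') (s t : ℝ) :
    v t * w t - v s * w s = (∫ x in s..t, v x * (k x * u x) ∂ν) +
      ∫ x in s..t, (v' x * w x + v x * g x) := by
  obtain ⟨y, hy, hw⟩ := h.right
  have e1 := hv.mul_sub_mul hw s t
  have e2 := hv.mul_sub_mul hy s t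
  have i1 : LocallyIntegrable (fun x => w x * v' x) volume :=
    locallyIntegrable_bounded_mul hv.1 h.measurable.aestronglyMeasurable h.exists_bound
  have i2 : LocallyIntegrable (fun x => v x * g x) volume :=
    locallyIntegrable_bounded_mul hy.1 hv.continuous.aestronglyMeasurable hv.exists_bound
  have i3 : LocallyIntegrable (fun x => y x * v' x) volume :=
    locallyIntegrable_bounded_mul hv.1 hy.measurable.aestronglyMeasurable hy.exists_bound
  simp_rw [mul_comm (w _) (v' _)] at i1
  simp_rw [mul_comm (y _) (v' _)] at i3
  simp_rw [mul_sub (v' _)] at e1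
  rw [intervalIntegral.integral_sub (intervalIntegrable_of_locallyIntegrable i1 s t)
    (intervalIntegrable_of_locallyIntegrable i3 s t)] at e1
  rw [intervalIntegral.integral_add (intervalIntegrable_of_locallyIntegrable i1 s t)
    (intervalIntegrable_of_locallyIntegrable i2 s t)]
  linear_combination e1 + e2

/-- The Wronskian of two approximate solutions: the contributions of `b` and of the measure
cancel. -/
theorem ApproxSolution.wronskian_sub (h₁ : ApproxSolution ν b k u₁ w₁ f₁ g₁)
    (h₂ : ApproxSolution ν b k u₂ w₂ f₂ g₂) (s t : ℝ) :
    (u₁ t * w₂ t - u₂ t * w₁ t) - (u₁ s * w₂ s - u₂ s * w₁ s) =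
      ∫ x in s..t, (f₁ x * w₂ x + u₁ x * g₂ x - (f₂ x * w₁ x + u₂ x * g₁ x)) := by
  have e1 := h₂.mul_sub_mul h₁.left s t
  have e2 := h₁.mul_sub_mul h₂.left s t
  have i1 : IntervalIntegrable (fun x => (b x * w₁ x + f₁ x) * w₂ x + u₁ x * g₂ x)
      volume s t := by
    refine intervalIntegrable_of_locallyIntegrable (LocallyIntegrable.add ?_ ?_) s t
    · simpa only [mul_comm] using locallyIntegrable_bounded_mul h₁.left.1
        h₂.measurable.aestronglyMeasurable h₂.exists_bound
    · exact locallyIntegrable_bounded_mul h₂.locallyIntegrable_right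
        h₁.left.continuous.aestronglyMeasurable h₁.left.exists_bound
  have i2 : IntervalIntegrable (fun x => (b x * w₂ x + f₂ x) * w₁ x + u₂ x * g₁ x)
      volume s t := by
    refine intervalIntegrable_of_locallyIntegrable (LocallyIntegrable.add ?_ ?_) s t
    · simpa only [mul_comm] using locallyIntegrable_bounded_mul h₂.left.1
        h₁.measurable.aestronglyMeasurable h₁.exists_bound
    · exact locallyIntegrable_bounded_mul h₁.locallyIntegrable_right
        h₂.left.continuous.aestronglyMeasurable h₂.left.exists_bound
  have e3 : ∫ x in s..t, u₁ x * (k x * u₂ x) ∂ν = ∫ x in s..t, u₂ x * (k x * u₁ x) ∂ν := by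
    congr 1; funext x; ring
  have e4 : ∫ x in s..t, (f₁ x * w₂ x + u₁ x * g₂ x - (f₂ x * w₁ x + u₂ x * g₁ x)) =
      ∫ x in s..t, (((b x * w₁ x + f₁ x) * w₂ x + u₁ x * g₂ x) -
        ((b x * w₂ x + f₂ x) * w₁ x + u₂ x * g₁ x)) := by
    congr 1; funext x; ring
  rw [e4, intervalIntegral.integral_sub i1 i2]
  linear_combination e1 - e2 + e3

end ApproxSolution

end SturmLiouville

/-! ### Jordan decomposition of local measures -/

namespace LocalMeasure

variable (μ ν : LocalMeasure)

theorem apply_empty : μ ∅ = 0 := by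
  obtain ⟨s, hs⟩ := μ.exists_signedMeasure ∅ isCompact_empty
  simpa using (hs ∅ MeasurableSet.empty).symm

/-- On a Hahn set, the positive part of a piece is the local measure itself. -/
theorem piece_posPart_spec (k : ℤ) : ∃ i : Set ℝ, MeasurableSet i ∧ ∀ B, MeasurableSet B →
    (μ.piece k).toJordanDecomposition.posPart B =
      ENNReal.ofReal (μ (i ∩ B ∩ Ioc (k : ℝ) (k + 1))) := by
  obtain ⟨i, hi₁, hi₂, hi₃, hp, hn⟩ := (μ.piece k).toJordanDecomposition_spec
  refine ⟨i, hi₁, fun B hB => ?_⟩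
  rw [hp, SignedMeasure.toMeasureOfZeroLE_apply _ hi₂ hi₁ hB, ← μ.piece_apply k (hi₁.inter hB),
    ENNReal.ofReal_eq_coe_nnreal]

theorem piece_negPart_spec (k : ℤ) : ∃ i : Set ℝ, MeasurableSet i ∧ ∀ B, MeasurableSet B →
    (μ.piece k).toJordanDecomposition.negPart B =
      ENNReal.ofReal (-μ (i ∩ B ∩ Ioc (k : ℝ) (k + 1))) := by
  obtain ⟨i, hi₁, hi₂, hi₃, hp, hn⟩ := (μ.piece k).toJordanDecomposition_spec
  refine ⟨iᶜ, hi₁.compl, fun B hB => ?_⟩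
  rw [hn, SignedMeasure.toMeasureOfLEZero_apply _ hi₃ hi₁.compl hB,
    ← μ.piece_apply k (hi₁.compl.inter hB), ENNReal.ofReal_eq_coe_nnreal]

theorem disjoint_Ioc_intCast {j k : ℤ} (h : j ≠ k) :
    Disjoint (Ioc (j : ℝ) (j + 1)) (Ioc (k : ℝ) (k + 1)) :=
  pairwise_disjoint_Ioc_intCast ℝ h

theorem posPart_apply_of_subset {B : Set ℝ} (hB : MeasurableSet B) {k : ℤ}
    (hBk : B ⊆ Ioc (k : ℝ) (k + 1)) :
    μ.posPart B = (μ.piece k).toJordanDecomposition.posPart B := by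
  rw [posPart, Measure.sum_apply _ hB]
  refine tsum_eq_single k fun j hj => ?_
  obtain ⟨i, -, hi⟩ := μ.piece_posPart_spec j
  rw [hi B hB, inter_assoc, ((disjoint_Ioc_intCast hj.symm).mono_left hBk).inter_eq]
  simp [apply_empty]

theorem negPart_apply_of_subset {B : Set ℝ} (hB : MeasurableSet B) {k : ℤ}
    (hBk : B ⊆ Ioc (k : ℝ) (k + 1)) :
    μ.negPart B = (μ.piece k).toJordanDecomposition.negPart B := by
  rw [negPart, Measure.sum_apply _ hB]
  refine tsum_eq_single k fun j hj => ?_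
  obtain ⟨i, -, hi⟩ := μ.piece_negPart_spec j
  rw [hi B hB, inter_assoc, ((disjoint_Ioc_intCast hj.symm).mono_left hBk).inter_eq]
  simp [apply_empty]

theorem isLocallyFiniteMeasure_of_Ioc_intCast {m : Measure ℝ}
    (h : ∀ k : ℤ, m (Ioc (k : ℝ) (k + 1)) < ∞) : IsLocallyFiniteMeasure m := by
  refine ⟨fun x => ⟨Ioo (⌊x⌋ - 1) (⌊x⌋ + 1), Ioo_mem_nhds ?_ (Int.lt_floor_add_one x), ?_⟩⟩
  · linarith [Int.floor_le x]
  · have h1 := h (⌊x⌋ - 1)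
    have h2 := h ⌊x⌋
    push_cast at h1
    rw [sub_add_cancel] at h1
    refine (measure_mono ?_).trans_lt ((measure_union_le _ _).trans_lt (ENNReal.add_lt_top.2
      ⟨h1, h2⟩))
    intro y hy
    rcases le_or_gt y ⌊x⌋ with hyx | hyx
    · exact .inl ⟨hy.1, hyx⟩
    · exact .inr ⟨hyx, hy.2.le⟩

instance : IsLocallyFiniteMeasure μ.posPart :=
  isLocallyFiniteMeasure_of_Ioc_intCast fun k => by
    rw [μ.posPart_apply_of_subset measurableSet_Ioc subset_rfl]; exact measure_lt_top _ _

instance : IsLocallyFiniteMeasure μ.negPart :=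
  isLocallyFiniteMeasure_of_Ioc_intCast fun k => by
    rw [μ.negPart_apply_of_subset measurableSet_Ioc subset_rfl]; exact measure_lt_top _ _

instance isLocallyFiniteMeasure_add (m n : Measure ℝ) [IsLocallyFiniteMeasure m]
    [IsLocallyFiniteMeasure n] : IsLocallyFiniteMeasure (m + n) :=
  isLocallyFiniteMeasure_of_Ioc_intCast fun k => by
    rw [Measure.add_apply]
    exact ENNReal.add_lt_top.2 ⟨measure_Ioc_lt_top, measure_Ioc_lt_top⟩

instance : IsLocallyFiniteMeasure μ.variation :=
  inferInstanceAs (IsLocallyFiniteMeasure (μ.posPart + μ.negPart))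

/-- `μ = m₁ - m₂` on the bounded Borel sets. -/
def IsDifference (m₁ m₂ : Measure ℝ) : Prop :=
  ∀ B : Set ℝ, MeasurableSet B → Bornology.IsBounded B → μ B = m₁.real B - m₂.real B

theorem isDifference_posPart_negPart : μ.IsDifference μ.posPart μ.negPart := by
  intro B hB hb
  have hK : IsCompact (closure B) := hb.isCompact_closure
  obtain ⟨s, hs⟩ := μ.exists_signedMeasure _ hK
  have hsub : ∀ A ⊆ B, MeasurableSet A → s A = μ A := fun A hA hAm => by
    rw [hs A hAm, inter_eq_left.2 (hA.trans subset_closure)]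
  have hU : ⋃ k : ℤ, B ∩ Ioc (k : ℝ) (k + 1) = B := by
    rw [← inter_iUnion, iUnion_Ioc_intCast, inter_univ]
  have hm : ∀ k : ℤ, MeasurableSet (B ∩ Ioc (k : ℝ) (k + 1)) := fun k => hB.inter measurableSet_Ioc
  have hd : Pairwise (Function.onFun Disjoint fun k : ℤ => B ∩ Ioc (k : ℝ) (k + 1)) :=
    fun j k hjk => (disjoint_Ioc_intCast hjk).mono inter_subset_right inter_subset_right
  have h1 := VectorMeasure.hasSum_of_disjoint_iUnion (v := s) hm hd
  have hmeas : ∀ m : Measure ℝ, IsLocallyFiniteMeasure m →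
      HasSum (fun k : ℤ => m.real (B ∩ Ioc (k : ℝ) (k + 1))) (m.real B) := by
    intro m hlf
    have e : m B = ∑' k : ℤ, m (B ∩ Ioc (k : ℝ) (k + 1)) := by
      rw [← measure_iUnion hd hm, hU]
    have hfin : m B ≠ ∞ := hb.measure_lt_top.ne
    have := ENNReal.hasSum_toReal (e ▸ hfin)
    rw [← ENNReal.tsum_toReal_eq (fun k => (hb.subset inter_subset_left).measure_lt_top.ne), ← e]
      at this
    exact this
  have h2 := (hmeas μ.posPart inferInstance).sub (hmeas μ.negPart inferInstance)
  rw [hU, hsub B subset_rfl hB] at h1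
  refine h1.unique ((funext fun k => ?_ : (fun k : ℤ => s (B ∩ Ioc (k : ℝ) (k + 1))) = _) ▸ h2)
  rw [hsub _ inter_subset_left (hm k)]
  have h3 := μ.piece_apply k (hm k)
  rw [inter_assoc, inter_self] at h3
  rw [← h3, SignedMeasure.apply_eq_posPart_real_sub_negPart_real _ (hm k), measureReal_def,
    measureReal_def, measureReal_def, measureReal_def,
    μ.posPart_apply_of_subset (hm k) inter_subset_right,
    μ.negPart_apply_of_subset (hm k) inter_subset_right]

variable {μ ν} {m₁ m₂ n₁ n₂ : Measure ℝ}

theorem sum_restrict_Ioc_intCast (m : Measure ℝ) :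
    Measure.sum (fun k : ℤ => m.restrict (Ioc (k : ℝ) (k + 1))) = m := by
  rw [← Measure.restrict_iUnion (pairwise_disjoint_Ioc_intCast ℝ) fun _ => measurableSet_Ioc,
    iUnion_Ioc_intCast, Measure.restrict_univ]

theorem measure_sum_mono {f g : ℤ → Measure ℝ} (h : ∀ k, f k ≤ g k) :
    Measure.sum f ≤ Measure.sum g := by
  refine Measure.le_iff.2 fun B hB => ?_
  rw [Measure.sum_apply _ hB, Measure.sum_apply _ hB]
  exact ENNReal.tsum_le_tsum fun k => h k B

/-- Minimality of the Jordan decomposition, positive part. -/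
theorem IsDifference.posPart_le [IsLocallyFiniteMeasure m₁] (h : μ.IsDifference m₁ m₂) :
    μ.posPart ≤ m₁ := by
  conv_rhs => rw [← sum_restrict_Ioc_intCast m₁]
  refine measure_sum_mono fun k => Measure.le_iff.2 fun B hB => ?_
  obtain ⟨i, him, hi⟩ := μ.piece_posPart_spec k
  have hb : Bornology.IsBounded (i ∩ B ∩ Ioc (k : ℝ) (k + 1)) :=
    (Metric.isBounded_Ioc _ _).subset inter_subset_right
  rw [hi B hB, Measure.restrict_apply hB, h _ ((him.inter hB).inter measurableSet_Ioc) hb]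
  refine ENNReal.ofReal_le_of_le_toReal ?_
  refine (sub_le_self _ measureReal_nonneg).trans (measureReal_mono ?_ ?_)
  · exact inter_subset_inter_left _ inter_subset_right
  · exact ((Metric.isBounded_Ioc _ _).subset inter_subset_right).measure_lt_top.ne

/-- Minimality of the Jordan decomposition, negative part. -/
theorem IsDifference.negPart_le [IsLocallyFiniteMeasure m₂] (h : μ.IsDifference m₁ m₂) :
    μ.negPart ≤ m₂ := by
  conv_rhs => rw [← sum_restrict_Ioc_intCast m₂]
  refine measure_sum_mono fun k => Measure.le_iff.2 fun B hB => ?_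
  obtain ⟨i, him, hi⟩ := μ.piece_negPart_spec k
  have hb : Bornology.IsBounded (i ∩ B ∩ Ioc (k : ℝ) (k + 1)) :=
    (Metric.isBounded_Ioc _ _).subset inter_subset_right
  rw [hi B hB, Measure.restrict_apply hB, h _ ((him.inter hB).inter measurableSet_Ioc) hb, neg_sub]
  refine ENNReal.ofReal_le_of_le_toReal ?_
  refine (sub_le_self _ measureReal_nonneg).trans (measureReal_mono ?_ ?_)
  · exact inter_subset_inter_left _ inter_subset_right
  · exact ((Metric.isBounded_Ioc _ _).subset inter_subset_right).measure_lt_top.ne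

theorem IsDifference.add [IsLocallyFiniteMeasure m₁] [IsLocallyFiniteMeasure m₂]
    [IsLocallyFiniteMeasure n₁] [IsLocallyFiniteMeasure n₂] (hμ : μ.IsDifference m₁ m₂)
    (hν : ν.IsDifference n₁ n₂) : (μ + ν).IsDifference (m₁ + n₁) (m₂ + n₂) := by
  intro B hB hb
  change μ B + ν B = _
  rw [hμ B hB hb, hν B hB hb, measureReal_add_apply hb.measure_lt_top.ne hb.measure_lt_top.ne,
    measureReal_add_apply hb.measure_lt_top.ne hb.measure_lt_top.ne]
  ring

theorem IsDifference.sub [IsLocallyFiniteMeasure m₁] [IsLocallyFiniteMeasure m₂]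
    [IsLocallyFiniteMeasure n₁] [IsLocallyFiniteMeasure n₂] (hμ : μ.IsDifference m₁ m₂)
    (hν : ν.IsDifference n₁ n₂) : (μ - ν).IsDifference (m₁ + n₂) (m₂ + n₁) := by
  intro B hB hb
  change μ B - ν B = _
  rw [hμ B hB hb, hν B hB hb, measureReal_add_apply hb.measure_lt_top.ne hb.measure_lt_top.ne,
    measureReal_add_apply hb.measure_lt_top.ne hb.measure_lt_top.ne]
  ring

theorem isLocallyFiniteMeasure_map_sub (m : Measure ℝ) [IsLocallyFiniteMeasure m] (r : ℝ) :
    IsLocallyFiniteMeasure (m.map (fun x => x - r)) := by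
  refine isLocallyFiniteMeasure_of_Ioc_intCast fun k => ?_
  rw [Measure.map_apply (by fun_prop) measurableSet_Ioc]
  simp only [preimage_sub_const_Ioc]
  exact measure_Ioc_lt_top

theorem isBounded_preimage_sub {B : Set ℝ} (hb : Bornology.IsBounded B) (r : ℝ) :
    Bornology.IsBounded ((fun x => x - r) ⁻¹' B) := by
  obtain ⟨C, hC⟩ := hb.exists_norm_le
  refine (isBounded_iff_forall_norm_le).2 ⟨C + |r|, fun x hx => ?_⟩
  have h1 := hC _ hx
  have h2 := norm_add_le (x - r) r
  rw [sub_add_cancel] at h2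
  simp only [Real.norm_eq_abs] at *
  linarith

theorem IsDifference.translate (hμ : μ.IsDifference m₁ m₂) (r : ℝ) :
    (μ.translate r).IsDifference (m₁.map (fun x => x - r)) (m₂.map (fun x => x - r)) := by
  intro B hB hb
  have hm : Measurable fun x : ℝ => x - r := by fun_prop
  change μ ((fun x => x - r) ⁻¹' B) = _
  rw [map_measureReal_apply hm hB, map_measureReal_apply hm hB]
  exact hμ _ (hm hB) (isBounded_preimage_sub hb r)

/-- The integral of a function can be computed from any representation of the local measure as a
difference of two locally finite measures. -/
theorem IsDifference.integral_eq {E : Type*} [NormedAddCommGroup E] [NormedSpace ℝ E]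
    [IsLocallyFiniteMeasure m₁] [IsLocallyFiniteMeasure m₂]
    (hμ : μ.IsDifference m₁ m₂) {f : ℝ → E} (hf : Continuous f) (hc : HasCompactSupport f) :
    μ.integral f = (∫ x, f x ∂m₁) - ∫ x, f x ∂m₂ := by
  have hi : ∀ m : Measure ℝ, IsLocallyFiniteMeasure m → Integrable f m := fun m hm =>
    hf.integrable_of_hasCompactSupport hc
  -- only sums of measures can be compared, since differences of infinite measures make no sense
  have e : μ.posPart + m₂ = m₁ + μ.negPart := by
    refine Measure.ext_of_Ioc _ _ fun a b _ => ?_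
    have h1 := hμ (Ioc a b) measurableSet_Ioc (Metric.isBounded_Ioc _ _)
    have h2 := μ.isDifference_posPart_negPart (Ioc a b) measurableSet_Ioc (Metric.isBounded_Ioc _ _)
    rw [← measureReal_eq_measureReal_iff measure_Ioc_lt_top.ne measure_Ioc_lt_top.ne,
      measureReal_add_apply measure_Ioc_lt_top.ne measure_Ioc_lt_top.ne,
      measureReal_add_apply measure_Ioc_lt_top.ne measure_Ioc_lt_top.ne]
    linarith
  have e2 := congrArg (fun m => ∫ x, f x ∂m) e
  rw [integral_add_measure (hi _ inferInstance) (hi _ inferInstance),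
    integral_add_measure (hi _ inferInstance) (hi _ inferInstance)] at e2
  rw [LocalMeasure.integral, sub_eq_sub_iff_add_eq_add]
  exact e2

theorem isDifference_congr (h : ∀ B, MeasurableSet B → Bornology.IsBounded B → μ B = ν B)
    (hμ : μ.IsDifference m₁ m₂) : ν.IsDifference m₁ m₂ :=
  fun B hB hb => (h B hB hb).symm.trans (hμ B hB hb)

theorem variation_add_le (μ ν : LocalMeasure) : (μ + ν).variation ≤ μ.variation + ν.variation := by
  have h := μ.isDifference_posPart_negPart.add ν.isDifference_posPart_negPart
  have h1 := add_le_add h.posPart_le h.negPart_le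
  rw [add_add_add_comm] at h1
  exact h1

theorem integral_sub_translate (μ : LocalMeasure) (r : ℝ) {f : ℝ → ℝ} (hf : Continuous f)
    (hc : HasCompactSupport f) :
    (μ - μ.translate r).integral f = μ.integral f - μ.integral (fun x => f (x - r)) := by
  have := isLocallyFiniteMeasure_map_sub μ.posPart r
  have := isLocallyFiniteMeasure_map_sub μ.negPart r
  have h := μ.isDifference_posPart_negPart
  have hi : ∀ m : Measure ℝ, IsLocallyFiniteMeasure m → Integrable f m := fun m hm =>
    hf.integrable_of_hasCompactSupport hc
  have hm : Measurable fun x : ℝ => x - r := by fun_prop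
  rw [(h.sub (h.translate r)).integral_eq hf hc,
    integral_add_measure (hi _ inferInstance) (hi _ inferInstance),
    integral_add_measure (hi _ inferInstance) (hi _ inferInstance),
    integral_map hm.aemeasurable hf.aestronglyMeasurable,
    integral_map hm.aemeasurable hf.aestronglyMeasurable, LocalMeasure.integral,
    LocalMeasure.integral]
  ring

end LocalMeasure

/-! ### Distribution functions, and the system of an eigenfunction -/

namespace LocalMeasure

open SturmLiouville

variable {𝕜 : Type*} [RCLike 𝕜]

/-- The normalized distribution function of a local measure, `t ↦ μ((0, t])` for `t ≥ 0` and
`t ↦ -μ((t, 0])` for `t < 0`. -/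
noncomputable def cdf (μ : LocalMeasure) (t : ℝ) : ℝ :=
  μ.integralFromTo (fun _ => (1 : ℝ)) 0 t

theorem coe_cdf (μ : LocalMeasure) (t : ℝ) :
    ((μ.cdf t : ℝ) : 𝕜) =
      (∫ _ in (0 : ℝ)..t, (1 : 𝕜) ∂μ.posPart) - ∫ _ in (0 : ℝ)..t, (1 : 𝕜) ∂μ.negPart := by
  simp only [cdf, integralFromTo, intervalIntegral.integral_const', RCLike.real_smul_eq_coe_mul,
    smul_eq_mul, mul_one]
  push_cast
  rfl

theorem hasDensity_integral_one (m : Measure ℝ) [IsLocallyFiniteMeasure m] :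
    HasDensity m (fun t => ∫ _ in (0 : ℝ)..t, (1 : 𝕜) ∂m) fun _ => 1 :=
  hasDensity_integral continuous_const.locallyIntegrable 0

theorem measurable_cdf (μ : LocalMeasure) : Measurable μ.cdf :=
  (hasDensity_integral_one (𝕜 := ℝ) μ.posPart).measurable.sub
    (hasDensity_integral_one (𝕜 := ℝ) μ.negPart).measurable

theorem integralFromTo_sub (μ : LocalMeasure) {f : ℝ → 𝕜} (hf : Continuous f) (r s t : ℝ) :
    μ.integralFromTo f r t - μ.integralFromTo f r s = μ.integralFromTo f s t := by
  have h : ∀ (m : Measure ℝ) [IsLocallyFiniteMeasure m] (s t : ℝ), IntervalIntegrable f m s t :=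
    fun m _ s t => hf.intervalIntegrable s t
  simp only [integralFromTo]
  rw [← intervalIntegral.integral_interval_sub_left (h μ.posPart r t) (h μ.posPart r s),
    ← intervalIntegral.integral_interval_sub_left (h μ.negPart r t) (h μ.negPart r s)]
  ring

theorem abs_cdf_sub_le (μ : LocalMeasure) (s t : ℝ) :
    |μ.cdf t - μ.cdf s| ≤ μ.variation.real (uIoc s t) := by
  rw [cdf, cdf, integralFromTo_sub _ continuous_const, integralFromTo, variation, uIoc,
    measureReal_add_apply measure_Ioc_lt_top.ne measure_Ioc_lt_top.ne]
  have h : ∀ (m : Measure ℝ) [IsLocallyFiniteMeasure m],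
      |∫ _ in s..t, (1 : ℝ) ∂m| ≤ m.real (Ioc (min s t) (max s t)) := by
    intro m _
    rw [intervalIntegral.abs_intervalIntegral_eq, uIoc]
    simp [abs_of_nonneg measureReal_nonneg]
  exact (abs_sub _ _).trans (add_le_add (h _) (h _))

theorem exists_bound_cdf (μ : LocalMeasure) (p q : ℝ) :
    ∃ B, 0 ≤ B ∧ ∀ t ∈ Icc p q, |μ.cdf t| ≤ B := by
  obtain ⟨B, hB, h1⟩ := (hasDensity_integral_one (𝕜 := ℝ) μ.posPart).exists_bound p q
  obtain ⟨C, hC, h2⟩ := (hasDensity_integral_one (𝕜 := ℝ) μ.negPart).exists_bound p q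
  refine ⟨B + C, by positivity, fun t ht => ?_⟩
  exact (abs_sub _ _).trans (add_le_add (h1 t ht) (h2 t ht))

/-- Integration by parts for a local measure. -/
theorem integralFromTo_eq (μ : LocalMeasure) {f f' : ℝ → 𝕜} (hf : HasDensity volume f f')
    (s t : ℝ) :
    μ.integralFromTo f s t =
      f t * (μ.cdf t : 𝕜) - f s * (μ.cdf s : 𝕜) - ∫ x in s..t, f' x * (μ.cdf x : 𝕜) := by
  have h1 := hf.mul_sub_mul (hasDensity_integral_one (𝕜 := 𝕜) μ.posPart) s t
  have h2 := hf.mul_sub_mul (hasDensity_integral_one (𝕜 := 𝕜) μ.negPart) s t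
  have hi : ∀ (m : Measure ℝ) [IsLocallyFiniteMeasure m], IntervalIntegrable
      (fun x => f' x * ∫ _ in (0 : ℝ)..x, (1 : 𝕜) ∂m) volume s t := by
    intro m _
    have h := hasDensity_integral_one (𝕜 := 𝕜) m
    have := locallyIntegrable_bounded_mul hf.1 h.measurable.aestronglyMeasurable h.exists_bound
    simp_rw [mul_comm _ (f' _)] at this
    exact intervalIntegrable_of_locallyIntegrable this s t
  simp_rw [coe_cdf, mul_sub]
  rw [intervalIntegral.integral_sub (hi _) (hi _), integralFromTo]
  simp only [mul_one] at h1 h2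
  linear_combination h2 - h1

/-- A measure `m ≤ ν` has a density with values in `[0, 1]`. -/
theorem exists_density_of_le {m ν : Measure ℝ} [IsLocallyFiniteMeasure m]
    [IsLocallyFiniteMeasure ν] (h : m ≤ ν) :
    ∃ d : ℝ → ℝ, Measurable d ∧ (∀ x, 0 ≤ d x) ∧ (∀ x, d x ≤ 1) ∧ ∀ (f : ℝ → 𝕜) (s t : ℝ),
      ∫ x in s..t, f x ∂m = ∫ x in s..t, (d x : 𝕜) * f x ∂ν := by
  have hac : m ≪ ν := h.absolutelyContinuous
  -- the Radon-Nikodym derivative is truncated, so as to have the bound everywhere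
  have hae : ∀ᵐ x ∂ν, min (m.rnDeriv ν x).toReal 1 = (m.rnDeriv ν x).toReal := by
    filter_upwards [Measure.rnDeriv_le_one_of_le h] with x hx
    refine min_eq_left ?_
    simpa using ENNReal.toReal_mono ENNReal.one_ne_top hx
  refine ⟨fun x => min (m.rnDeriv ν x).toReal 1,
    (m.measurable_rnDeriv ν).ennreal_toReal.min measurable_const, fun x => by positivity,
    fun x => min_le_right _ _, fun f s t => ?_⟩
  have key : ∀ A : Set ℝ, MeasurableSet A → ∫ x in A, f x ∂m =
      ∫ x in A, ((min (m.rnDeriv ν x).toReal 1 : ℝ) : 𝕜) * f x ∂ν := by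
    intro A hA
    rw [← setIntegral_rnDeriv_smul hac hA]
    refine integral_congr_ae (ae_restrict_of_ae ?_)
    filter_upwards [hae] with x hx
    rw [hx, RCLike.real_smul_eq_coe_mul]
  rw [intervalIntegral, intervalIntegral, key _ measurableSet_Ioc, key _ measurableSet_Ioc]

end LocalMeasure

namespace SturmLiouville

variable {𝕜 : Type*} [RCLike 𝕜]

/-- The bounded function `k` is a density of the charge `μ - z ρ` with respect to `|μ| + ρ`. -/
structure IsChargeDensity (μ : LocalMeasure) (ρ : Measure ℝ) (z : 𝕜) (k : ℝ → 𝕜) : Prop where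
  measurable : Measurable k
  norm_le : ∀ x, ‖k x‖ ≤ 2 + ‖z‖
  integral_eq : ∀ f : ℝ → 𝕜, Continuous f → ∀ s t,
    μ.integralFromTo f s t - z * ∫ x in s..t, f x ∂ρ = ∫ x in s..t, k x * f x ∂(μ.variation + ρ)

theorem IsChargeDensity.locallyIntegrable_mul {μ : LocalMeasure} {ρ : Measure ℝ}
    [IsLocallyFiniteMeasure ρ] {z : 𝕜} {k : ℝ → 𝕜} (hk : IsChargeDensity μ ρ z k) {f : ℝ → 𝕜}
    (hf : Continuous f) : LocallyIntegrable (fun x => k x * f x) (μ.variation + ρ) :=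
  locallyIntegrable_bounded_mul hf.locallyIntegrable hk.measurable.aestronglyMeasurable
    fun _ _ => ⟨_, by positivity, fun x _ => hk.norm_le x⟩

theorem exists_isChargeDensity (μ : LocalMeasure) (ρ : Measure ℝ) [IsLocallyFiniteMeasure ρ]
    (z : 𝕜) : ∃ k : ℝ → 𝕜, IsChargeDensity μ ρ z k := by
  have hP : μ.posPart ≤ μ.variation + ρ := by
    rw [LocalMeasure.variation, add_assoc]
    exact Measure.le_add_right le_rfl
  have hN : μ.negPart ≤ μ.variation + ρ := by
    rw [LocalMeasure.variation, add_comm μ.posPart, add_assoc]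
    exact Measure.le_add_right le_rfl
  have hρ : ρ ≤ μ.variation + ρ := Measure.le_add_left le_rfl
  obtain ⟨d₁, hm₁, h0₁, h1₁, hd₁⟩ := LocalMeasure.exists_density_of_le (𝕜 := 𝕜) hP
  obtain ⟨d₂, hm₂, h0₂, h1₂, hd₂⟩ := LocalMeasure.exists_density_of_le (𝕜 := 𝕜) hN
  obtain ⟨d₃, hm₃, h0₃, h1₃, hd₃⟩ := LocalMeasure.exists_density_of_le (𝕜 := 𝕜) hρ
  have hn : ∀ {c : ℝ}, 0 ≤ c → c ≤ 1 → ‖(c : 𝕜)‖ ≤ 1 := fun h0 h1 => by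
    rwa [RCLike.norm_ofReal, abs_of_nonneg h0]
  refine ⟨fun x => (d₁ x : 𝕜) - d₂ x - z * d₃ x, ?_, fun x => ?_, fun f hf s t => ?_⟩
  · have c : Measurable fun x : ℝ => (x : 𝕜) := RCLike.measurable_ofReal
    exact ((c.comp hm₁).sub (c.comp hm₂)).sub ((c.comp hm₃).const_mul z)
  · refine (norm_sub_le _ _).trans (add_le_add ((norm_sub_le _ _).trans ?_) ?_)
    · linarith [hn (h0₁ x) (h1₁ x), hn (h0₂ x) (h1₂ x)]
    · rw [norm_mul]
      exact mul_le_of_le_one_right (norm_nonneg _) (hn (h0₃ x) (h1₃ x))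
  · have hi : ∀ d : ℝ → ℝ, Measurable d → (∀ x, 0 ≤ d x) → (∀ x, d x ≤ 1) →
        IntervalIntegrable (fun x => (d x : 𝕜) * f x) (μ.variation + ρ) s t := by
      intro d hd h0 h1
      refine intervalIntegrable_of_locallyIntegrable (locallyIntegrable_bounded_mul
        hf.locallyIntegrable (RCLike.measurable_ofReal.comp hd).aestronglyMeasurable
        fun _ _ => ⟨1, zero_le_one, fun x _ => hn (h0 x) (h1 x)⟩) s t
    have e : ∀ x, ((d₁ x : 𝕜) - d₂ x - z * d₃ x) * f x =
        (d₁ x : 𝕜) * f x - d₂ x * f x - z * (d₃ x * f x) := fun x => by ring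
    simp_rw [e]
    rw [intervalIntegral.integral_sub ((hi _ hm₁ h0₁ h1₁).sub (hi _ hm₂ h0₂ h1₂))
      ((hi _ hm₃ h0₃ h1₃).const_mul z), intervalIntegral.integral_sub (hi _ hm₁ h0₁ h1₁)
      (hi _ hm₂ h0₂ h1₂), intervalIntegral.integral_const_mul, ← hd₁, ← hd₂, ← hd₃]
    rfl

/-- An eigenfunction yields a solution `(u, w)` of the first order system, with
`w = ∫_0^t u dμ - F`, where `F` is the `ρ`-absolutely continuous version of `A_{a,μ} u`; hence
`w = a u'` almost everywhere. -/
theorem exists_solution_of_isEigenvalue {p : ℝ≥0∞} {ρ : Measure ℝ} [IsLocallyFiniteMeasure ρ]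
    {a : ℝ → ℝ} {μ : LocalMeasure} {z : 𝕜} (ha : ∀ᵐ x, a x ≠ 0) {b : ℝ → ℝ}
    (hb : b =ᵐ[volume] fun x => (a x)⁻¹) {k : ℝ → 𝕜} (hk : IsChargeDensity μ ρ z k)
    (hz : IsEigenvalue p ρ a μ z) :
    ∃ u w : ℝ → 𝕜, ApproxSolution (μ.variation + ρ) (fun x => (b x : 𝕜)) k u w 0 0 ∧
      MemLp u p ρ ∧ ¬ u =ᵐ[ρ] 0 := by
  obtain ⟨f, hf0, u, u', F, huf, hu, hF, hFd⟩ := hz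
  have huc := hu.continuous
  refine ⟨u, fun t => μ.integralFromTo u 0 t - F t, ⟨?_, ?_, 0, ?_, ?_⟩, ?_, ?_⟩
  · exact continuous_const.locallyIntegrable
  · refine hu.congr_density ?_
    filter_upwards [hF, ha, hb] with x hx hax hbx
    rw [hx, hbx, quasiDeriv]
    have : (a x : 𝕜) ≠ 0 := by exact_mod_cast hax
    push_cast
    field_simp
    simp
  · exact HasDensity.of_sub_eq continuous_const.locallyIntegrable fun s t => by simp
  · refine HasDensity.of_sub_eq (hk.locallyIntegrable_mul huc) fun s t => ?_
    have e1 : F t - F s = z * ∫ x in s..t, u x ∂ρ := by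
      rw [hFd.sub_eq, ← intervalIntegral.integral_const_mul]
      refine intervalIntegral.integral_congr_ae ?_
      filter_upwards [Lp.coeFn_smul z f, huf] with x hx hux _
      rw [hx, hux]
      rfl
    rw [← hk.integral_eq u huc, ← μ.integralFromTo_sub huc 0 s t, ← e1]
    simp only [Pi.zero_apply]
    ring
  · exact (memLp_congr_ae huf).2 (Lp.memLp f)
  · intro h
    exact hf0 ((Lp.eq_zero_iff_ae_eq_zero).2 (huf.symm.trans h))

end SturmLiouville

/-! ### The weak seminorm and distribution functions -/

namespace SturmLiouville

theorem HasDensity.comp_add_right {E : Type*} [NormedAddCommGroup E] [NormedSpace ℝ E]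
    {F f : ℝ → E} (hF : HasDensity volume F f) (r : ℝ) :
    HasDensity volume (fun x => F (x + r)) (fun x => f (x + r)) := by
  refine .of_sub_eq ?_ fun s t => ?_
  · intro x
    obtain ⟨U, hU, hi⟩ := hF.1 (x + r)
    refine ⟨(fun x => x + r) ⁻¹' U, (continuous_add_const r).continuousAt hU, ?_⟩
    exact ((measurePreserving_add_right volume r).integrableOn_comp_preimage
      (MeasurableEquiv.addRight r).measurableEmbedding).2 hi
  · rw [intervalIntegral.integral_comp_add_right, ← hF.sub_eq]

theorem hasDensity_of_lipschitzWith {f : ℝ → ℝ} {K : NNReal} (hf : LipschitzWith K f) :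
    HasDensity volume f (deriv f) := by
  refine .of_sub_eq ?_ fun s t => ?_
  · refine locallyIntegrable_of_bound (measurable_deriv f).aestronglyMeasurable fun p q =>
      ⟨K, K.2, fun t _ => norm_deriv_le_of_lipschitz hf⟩
  · exact (hf.lipschitzOnWith.absolutelyContinuousOnInterval).integral_deriv_eq_sub.symm

theorem hasCompactSupport_of_tsupport_subset_Icc {v : ℝ → ℝ} {p q : ℝ}
    (h : tsupport v ⊆ Icc p q) : HasCompactSupport v :=
  HasCompactSupport.of_support_subset_isCompact isCompact_Icc ((subset_tsupport v).trans h)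

theorem eq_zero_of_tsupport_subset {v : ℝ → ℝ} {A : Set ℝ} (h : tsupport v ⊆ A) {x : ℝ}
    (hx : x ∉ A) : v x = 0 :=
  image_eq_zero_of_notMem_tsupport fun h' => hx (h h')

/-- The seminorm bound for a test function with Lipschitz constant `K`, by homogeneity. -/
theorem abs_integral_le_of_wNorm_le {η : LocalMeasure} {I : Set ℝ} {ε : ℝ} (hε : 0 ≤ ε)
    (h : wNorm η I ≤ ENNReal.ofReal ε) {v v' : ℝ → ℝ} (hv : HasDensity volume v v') {K : ℝ}
    (hK : 0 < K) (hv' : ∀ᵐ x, |v' x| ≤ K) (hI : tsupport v ⊆ I) {j : ℝ}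
    (hj : tsupport v ⊆ Icc j (j + 2)) : |η.integral v| ≤ K * ε := by
  have hts : tsupport (fun x => K⁻¹ * v x) ⊆ tsupport v :=
    closure_mono fun x hx hx' => hx (by simp [hx'])
  have key : ‖η.integral (fun x => K⁻¹ * v x)‖ₑ ≤ wNorm η I := by
    refine le_iSup₂_of_le (f := fun (u : ℝ → ℝ) _ => ‖η.integral u‖ₑ) (fun x => K⁻¹ * v x) ?_ le_rfl
    refine ⟨hts.trans hI, ?_, _, hv.const_mul K⁻¹, ?_⟩
    · refine (Metric.ediam_mono (hts.trans hj)).trans ?_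
      rw [Real.ediam_Icc]
      simp
    · filter_upwards [hv'] with x hx
      rw [abs_mul, abs_of_pos (inv_pos.2 hK), inv_mul_le_iff₀ hK, mul_one]
      exact hx
  have e : η.integral (fun x => K⁻¹ * v x) = K⁻¹ * η.integral v := by
    simp only [LocalMeasure.integral, integral_const_mul]
    ring
  have h2 := key.trans h
  rw [e, Real.enorm_eq_ofReal_abs, ENNReal.ofReal_le_ofReal_iff hε, abs_mul,
    abs_of_pos (inv_pos.2 hK), inv_mul_le_iff₀ hK] at h2
  exact h2

/-- The Lipschitz function that climbs from `0` to `1` on `[0, 1]`. -/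
noncomputable def ramp (x : ℝ) : ℝ := max 0 (min 1 x)

theorem lipschitzWith_ramp : LipschitzWith 1 ramp :=
  (LipschitzWith.id.const_min 1).const_max 0

theorem ramp_of_nonpos {x : ℝ} (h : x ≤ 0) : ramp x = 0 :=
  max_eq_left ((min_le_right _ _).trans h)

theorem ramp_of_one_le {x : ℝ} (h : 1 ≤ x) : ramp x = 1 := by
  rw [ramp, min_eq_left h, max_eq_right zero_le_one]

theorem ramp_mem_Icc (x : ℝ) : ramp x ∈ Icc (0 : ℝ) 1 :=
  ⟨le_max_left _ _, max_le zero_le_one (min_le_left _ _)⟩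

/-- The tent function supported in `[0, 2]`; its integer translates form a partition of unity. -/
noncomputable def tent (x : ℝ) : ℝ := ramp x - ramp (x - 1)

theorem lipschitzWith_tent_sub (c : ℝ) : LipschitzWith 2 fun x => tent (x - c) := by
  have h1 : LipschitzWith 1 fun x => ramp (x - c) := by
    simpa [Function.comp_def] using lipschitzWith_ramp.comp (LipschitzWith.id.sub (LipschitzWith.const c))
  have h2 : LipschitzWith 1 fun x => ramp (x - c - 1) := by
    simpa [sub_sub, Function.comp_def] using
      lipschitzWith_ramp.comp (LipschitzWith.id.sub (LipschitzWith.const (c + 1)))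
  have := h1.sub h2
  rwa [one_add_one_eq_two] at this

theorem abs_tent_le (x : ℝ) : |tent x| ≤ 1 := by
  have h1 := ramp_mem_Icc x
  have h2 := ramp_mem_Icc (x - 1)
  rw [tent, abs_le]
  constructor <;> linarith [h1.1, h1.2, h2.1, h2.2]

theorem tent_eq_zero {x : ℝ} (h : x ∉ Icc (0 : ℝ) 2) : tent x = 0 := by
  rw [mem_Icc, not_and_or, not_le, not_le] at h
  rcases h with h | h
  · rw [tent, ramp_of_nonpos h.le, ramp_of_nonpos (by linarith), sub_zero]
  · rw [tent, ramp_of_one_le (by linarith), ramp_of_one_le (by linarith), sub_self]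

theorem sum_tent_eq_one {x : ℝ} {n : ℕ} (h1 : 1 ≤ x) (hn : x ≤ n) :
    ∑ j ∈ Finset.range n, tent (x - j) = 1 := by
  have : ∀ j : ℕ, tent (x - j) = ramp (x - j) - ramp (x - (j + 1 : ℕ)) := fun j => by
    rw [tent, Nat.cast_add, Nat.cast_one, sub_sub]
  simp_rw [this]
  rw [Finset.sum_range_sub' (fun j : ℕ => ramp (x - j)), Nat.cast_zero, sub_zero,
    ramp_of_one_le h1, ramp_of_nonpos (by linarith), sub_zero]

/-- The seminorm `‖·‖_{[-R, R]}` only admits test functions with support of diameter at most `2`; a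
partition of unity extends the bound to all test functions supported in `[-R, R]`. -/
theorem abs_integral_le_of_wNorm_le_Icc {η : LocalMeasure} {R : ℝ} (hR : 0 < R) {ε : ℝ}
    (hε : 0 ≤ ε) (h : wNorm η (Icc (-R) R) ≤ ENNReal.ofReal ε) {v v' : ℝ → ℝ}
    (hv : HasDensity volume v v') (hv' : ∀ᵐ x, |v' x| ≤ 1) (hI : tsupport v ⊆ Icc (-R) R)
    (hvb : ∀ x, |v x| ≤ 2 * R) : |η.integral v| ≤ (2 * R + 2) * ((4 * R + 1) * ε) := by
  set n := ⌈2 * R + 1⌉₊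
  have hn : 2 * R + 1 ≤ n := Nat.le_ceil _
  have hn' : (n : ℝ) ≤ 2 * R + 2 := by
    have := (Nat.ceil_lt_add_one (a := 2 * R + 1) (by positivity)).le
    linarith
  set φ : ℕ → ℝ → ℝ := fun j x => v x * tent (x - (j - R - 1)) with hφ
  have hts : ∀ j, tsupport (φ j) ⊆ tsupport v := fun j =>
    closure_mono fun x hx hx' => hx (by simp [hφ, hx'])
  have hφc : ∀ j, Continuous (φ j) := fun j =>
    hv.continuous.mul (lipschitzWith_tent_sub _).continuous
  have hsum : ∀ x, v x = ∑ j ∈ Finset.range n, φ j x := by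
    intro x
    by_cases hx : x ∈ Icc (-R) R
    · have := sum_tent_eq_one (x := x + R + 1) (n := n) (by linarith [hx.1]) (by linarith [hx.2])
      rw [← Finset.mul_sum]
      have e : ∀ j : ℕ, tent (x - (j - R - 1)) = tent (x + R + 1 - j) := fun j => by ring_nf
      simp_rw [e, this, mul_one]
    · simp [hφ, eq_zero_of_tsupport_subset hI hx]
  have hone : ∀ j, |η.integral (φ j)| ≤ (4 * R + 1) * ε := by
    intro j
    have hd := hasDensity_of_lipschitzWith (lipschitzWith_tent_sub (j - R - 1))
    refine abs_integral_le_of_wNorm_le hε h (hv.mul hd) (by positivity) ?_ ((hts j).trans hI)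
      (j := j - R - 1) ?_
    · filter_upwards [hv'] with x hx
      have h1 : |deriv (fun x => tent (x - (j - R - 1))) x| ≤ 2 :=
        norm_deriv_le_of_lipschitz (lipschitzWith_tent_sub (j - R - 1))
      refine (abs_add_le _ _).trans ?_
      rw [abs_mul, abs_mul]
      have h2 := mul_le_mul (hvb x) h1 (abs_nonneg _) (by positivity)
      have h3 := mul_le_mul (abs_tent_le (x - (j - R - 1))) hx (abs_nonneg _) zero_le_one
      linarith
    · refine closure_minimal (fun x hx => ?_) isClosed_Icc
      by_contra hx'
      refine hx ?_
      simp only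
      rw [tent_eq_zero, mul_zero]
      intro h'
      exact hx' ⟨by linarith [h'.1], by linarith [h'.2]⟩
  have hint : ∀ (m : Measure ℝ) [IsLocallyFiniteMeasure m],
      ∫ x, v x ∂m = ∑ j ∈ Finset.range n, ∫ x, φ j x ∂m := by
    intro m _
    simp_rw [hsum]
    exact integral_finsetSum _ fun j _ => (hφc j).integrable_of_hasCompactSupport
      (hasCompactSupport_of_tsupport_subset_Icc ((hts j).trans hI))
  have e : η.integral v = ∑ j ∈ Finset.range n, η.integral (φ j) := by
    simp only [LocalMeasure.integral]
    rw [hint, hint, Finset.sum_sub_distrib]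
  rw [e]
  refine (Finset.abs_sum_le_sum_abs _ _).trans ((Finset.sum_le_sum fun j _ => hone j).trans ?_)
  rw [Finset.sum_const, Finset.card_range, nsmul_eq_mul]
  exact mul_le_mul_of_nonneg_right hn' (by positivity)

/-- Integration by parts for a test function. -/
theorem integral_eq_neg_integral_mul_cdf (μ : LocalMeasure) {v v' : ℝ → ℝ}
    (hv : HasDensity volume v v') {p q : ℝ} (hsupp : ∀ x, x ∉ Ioo p q → v x = 0) :
    μ.integral v = -∫ x in p..q, v' x * μ.cdf x := by
  have hs : Function.support v ⊆ Ioc p q := fun x hx => by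
    by_contra h
    exact hx (hsupp x fun h' => h ⟨h'.1, h'.2.le⟩)
  have h := μ.integralFromTo_eq hv p q
  rw [LocalMeasure.integralFromTo, intervalIntegral.integral_eq_integral_of_support_subset hs,
    intervalIntegral.integral_eq_integral_of_support_subset hs, hsupp p (by simp),
    hsupp q (by simp)] at h
  rw [LocalMeasure.integral, h]
  simp

theorem integral_sub_translate_eq (μ : LocalMeasure) (r : ℝ) {v v' : ℝ → ℝ}
    (hv : HasDensity volume v v') {p q : ℝ} (hsupp : ∀ x, x ∉ Ioo p q → v x = 0) :
    (μ - μ.translate r).integral v = -∫ x in p..q, v' x * (μ.cdf x - μ.cdf (x + r)) := by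
  have hc : HasCompactSupport v := HasCompactSupport.intro isCompact_Icc (K := Icc p q) fun x hx =>
    hsupp x fun h => hx ⟨h.1.le, h.2.le⟩
  have hvr : HasDensity volume (fun x => v (x - r)) fun x => v' (x - r) := by
    simpa only [sub_eq_add_neg] using hv.comp_add_right (-r)
  have h2 := integral_eq_neg_integral_mul_cdf μ hvr (p := p + r) (q := q + r) fun x hx =>
    hsupp _ fun h => hx ⟨by linarith [h.1], by linarith [h.2]⟩
  rw [← intervalIntegral.integral_comp_add_right] at h2
  simp only [add_sub_cancel_right] at h2
  have hb : ∀ c : ℝ, IntervalIntegrable (fun x => v' x * μ.cdf (x + c)) volume p q := by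
    intro c
    have : LocallyIntegrable (fun x => μ.cdf (x + c) * v' x) volume := by
      refine locallyIntegrable_bounded_mul hv.1
        (μ.measurable_cdf.comp (measurable_add_const c)).aestronglyMeasurable fun p q => ?_
      obtain ⟨B, hB, h⟩ := μ.exists_bound_cdf (p + c) (q + c)
      exact ⟨B, hB, fun t ht => h (t + c) ⟨by linarith [ht.1], by linarith [ht.2]⟩⟩
    simp_rw [mul_comm _ (v' _)] at this
    exact intervalIntegrable_of_locallyIntegrable this p q
  rw [μ.integral_sub_translate r hv.continuous hc, h2, integral_eq_neg_integral_mul_cdf μ hv hsupp]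
  simp_rw [mul_sub]
  rw [intervalIntegral.integral_sub (by simpa using hb 0) (hb r)]
  ring

/-- A dual description of the `L_1` norm modulo constants: there is a test function `v` with
`|v'| ≤ 1` that detects the distance of `φ` to a constant. -/
theorem exists_testFunction {φ : ℝ → ℝ} (hm : Measurable φ) {R : ℝ} (hR : 0 < R)
    (hφ : IntervalIntegrable φ volume (-R) R) :
    ∃ (c : ℝ) (v v' : ℝ → ℝ), HasDensity volume v v' ∧ (∀ x, |v' x| ≤ 1) ∧
      (∀ x, x ∉ Ioo (-R) R → v x = 0) ∧ (∀ x, |v x| ≤ 2 * R) ∧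
      ∫ x in (-R)..R, |φ x + c| = 2 * ∫ x in (-R)..R, v' x * φ x := by
  -- `φ + c` has mean zero; its sign, minus the mean of the sign, is integrated to give `v`
  set c : ℝ := -((∫ x in (-R)..R, φ x) / (2 * R)) with hc
  set h : ℝ → ℝ := fun x => SignType.sign (φ x + c) with hh
  have hhm : Measurable h := by
    have e : h = fun x => if 0 < φ x + c then 1 else if φ x + c < 0 then -1 else 0 := by
      funext x
      simp only [hh, sign_apply]
      split_ifs <;> simp
    rw [e]
    exact Measurable.ite (measurableSet_lt measurable_const (hm.add_const c)) measurable_const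
      (Measurable.ite (measurableSet_lt (hm.add_const c) measurable_const) measurable_const
        measurable_const)
  have hh1 : ∀ x, |h x| ≤ 1 := by
    intro x
    simp only [hh]
    rcases SignType.trichotomy (SignType.sign (φ x + c)) with h | h | h <;> rw [h] <;> simp
  have hhi : IntervalIntegrable h volume (-R) R := intervalIntegrable_of_locallyIntegrable
    (locallyIntegrable_of_bound hhm.aestronglyMeasurable
      fun _ _ => ⟨1, zero_le_one, fun x _ => hh1 x⟩) _ _
  have hle : -R ≤ R := by linarith
  set m : ℝ := (∫ x in (-R)..R, h x) / (2 * R) with hm'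
  have hm1 : |m| ≤ 1 := by
    have := intervalIntegral.norm_integral_le_of_norm_le_const (a := -R) (b := R) (f := h)
      (C := 1) fun x _ => hh1 x
    rw [Real.norm_eq_abs, sub_neg_eq_add, abs_of_pos (by linarith : (0 : ℝ) < R + R)] at this
    rw [hm', abs_div, abs_of_pos (by linarith : (0 : ℝ) < 2 * R), div_le_one (by linarith)]
    linarith
  set g : ℝ → ℝ := (Ioc (-R) R).indicator fun x => (h x - m) / 2 with hg
  have hgm : Measurable g := ((hhm.sub_const m).div_const 2).indicator measurableSet_Ioc
  have hg1 : ∀ x, |g x| ≤ 1 := by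
    intro x
    by_cases hx : x ∈ Ioc (-R) R
    · rw [hg, indicator_of_mem hx, abs_div, abs_two]
      have := abs_sub (h x) m
      linarith [hh1 x]
    · rw [hg, indicator_of_notMem hx, abs_zero]; exact zero_le_one
  have hgl : LocallyIntegrable g volume := locallyIntegrable_of_bound hgm.aestronglyMeasurable
      fun _ _ => ⟨1, zero_le_one, fun x _ => hg1 x⟩
  have hgcongr : ∀ ψ : ℝ → ℝ, ∫ x in (-R)..R, g x * ψ x = ∫ x in (-R)..R, (h x - m) / 2 * ψ x := by
    intro ψ
    rw [intervalIntegral.integral_of_le hle, intervalIntegral.integral_of_le hle]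
    exact setIntegral_congr_fun measurableSet_Ioc fun x hx => by
      simp only [hg, indicator_of_mem hx]
  have hg0 : ∫ x in (-R)..R, g x = 0 := by
    have := hgcongr fun _ => 1
    simp only [mul_one] at this
    rw [this, intervalIntegral.integral_div, intervalIntegral.integral_sub hhi (by simp), hm']
    simp only [intervalIntegral.integral_const, smul_eq_mul]
    field_simp
    ring
  have hd := hasDensity_integral hgl (-R)
  have hzero : ∀ x, x ∉ Ioo (-R) R → ∫ y in (-R)..x, g y = 0 := by
    intro x hx
    rw [mem_Ioo, not_and_or, not_lt, not_lt] at hx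
    rcases hx with hx | hx
    · refine intervalIntegral.integral_zero_ae (Eventually.of_forall fun y hy => ?_)
      rw [uIoc_of_ge hx] at hy
      exact indicator_of_notMem (fun h' => not_lt.2 hy.2 h'.1) _
    · rw [← intervalIntegral.integral_add_adjacent_intervals
        (intervalIntegrable_of_locallyIntegrable hgl (-R) R)
        (intervalIntegrable_of_locallyIntegrable hgl R x), hg0, zero_add]
      refine intervalIntegral.integral_zero_ae (Eventually.of_forall fun y hy => ?_)
      rw [uIoc_of_le hx] at hy
      exact indicator_of_notMem (fun h' => not_lt.2 h'.2 hy.1) _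
  refine ⟨c, _, g, hd, hg1, hzero, fun x => ?_, ?_⟩
  · by_cases hx : x ∈ Ioo (-R) R
    · have := intervalIntegral.norm_integral_le_of_norm_le_const (a := -R) (b := x) (f := g)
        (C := 1) fun x _ => hg1 x
      rw [Real.norm_eq_abs, abs_of_pos (by linarith [hx.1] : (0 : ℝ) < x - -R)] at this
      linarith [hx.2]
    · rw [hzero x hx, abs_zero]; linarith
  · have hgφ : ∫ x in (-R)..R, g x * φ x = ∫ x in (-R)..R, g x * (φ x + c) := by
      simp_rw [mul_add]
      have i1 : IntervalIntegrable (fun x => g x * φ x) volume (-R) R :=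
        ⟨hφ.1.bdd_mul (c := 1) hgm.aestronglyMeasurable.restrict
            (Eventually.of_forall fun x => hg1 x),
          hφ.2.bdd_mul (c := 1) hgm.aestronglyMeasurable.restrict
            (Eventually.of_forall fun x => hg1 x)⟩
      rw [intervalIntegral.integral_add i1
        ((intervalIntegrable_of_locallyIntegrable hgl (-R) R).mul_const c),
        intervalIntegral.integral_mul_const, hg0, zero_mul, add_zero]
    have hφc : IntervalIntegrable (fun x => φ x + c) volume (-R) R := hφ.add (by simp)
    have hφ0 : ∫ x in (-R)..R, (φ x + c) = 0 := by
      rw [intervalIntegral.integral_add hφ (by simp), hc]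
      simp only [intervalIntegral.integral_const, smul_eq_mul]
      field_simp
      ring
    have e : ∀ x, (h x - m) / 2 * (φ x + c) = |φ x + c| / 2 - m / 2 * (φ x + c) := by
      intro x
      have : h x * (φ x + c) = |φ x + c| := by
        simp only [hh]; exact sign_mul_self _
      linear_combination this / 2
    rw [hgφ, hgcongr]
    simp_rw [e]
    rw [intervalIntegral.integral_sub (hφc.abs.div_const 2) (hφc.const_mul _),
      intervalIntegral.integral_const_mul, hφ0, intervalIntegral.integral_div]
    ring

/-- Smallness of `μ - μ(· + r)` in the weak seminorm means that the difference of the distribution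
functions is close to a constant in `L_1`. -/
theorem exists_const_integral_abs_cdf_sub_le (μ : LocalMeasure) (r : ℝ) {R : ℝ} (hR : 0 < R)
    {ε : ℝ} (hε : 0 ≤ ε)
    (h : wNorm (μ - μ.translate r) (Icc (-R) R) ≤ ENNReal.ofReal ε) :
    ∃ c : ℝ, ∫ x in (-R)..R, |μ.cdf x - μ.cdf (x + r) + c| ≤
      2 * ((2 * R + 2) * ((4 * R + 1) * ε)) := by
  have hm : Measurable fun x => μ.cdf x - μ.cdf (x + r) :=
    μ.measurable_cdf.sub (μ.measurable_cdf.comp (measurable_add_const r))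
  have hi : IntervalIntegrable (fun x => μ.cdf x - μ.cdf (x + r)) volume (-R) R := by
    refine intervalIntegrable_of_locallyIntegrable
      (locallyIntegrable_of_bound hm.aestronglyMeasurable fun p q => ?_) _ _
    obtain ⟨B, hB, h1⟩ := μ.exists_bound_cdf p q
    obtain ⟨C, hC, h2⟩ := μ.exists_bound_cdf (p + r) (q + r)
    exact ⟨B + C, by positivity, fun t ht => (abs_sub _ _).trans
      (add_le_add (h1 t ht) (h2 (t + r) ⟨by linarith [ht.1], by linarith [ht.2]⟩))⟩
  obtain ⟨c, v, v', hv, hv1, hsupp, hvb, heq⟩ := exists_testFunction hm hR hi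
  refine ⟨c, ?_⟩
  have hI : tsupport v ⊆ Icc (-R) R := closure_minimal (fun x hx => by
    by_contra h'
    exact hx (hsupp x fun h'' => h' ⟨h''.1.le, h''.2.le⟩)) isClosed_Icc
  have := abs_integral_le_of_wNorm_le_Icc hR hε h hv (Eventually.of_forall hv1) hI hvb
  rw [integral_sub_translate_eq μ r hv hsupp, abs_neg] at this
  rw [heq]
  exact mul_le_mul_of_nonneg_left ((le_abs_self _).trans this) zero_le_two

end SturmLiouville

/-! ### Translates as approximate solutions -/

namespace SturmLiouville

variable {𝕜 : Type*} [RCLike 𝕜]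

theorem intervalIntegral_comp_add_of_map_eq {ρ : Measure ℝ} {r : ℝ}
    (hρ : ρ.map (fun x => x - r) = ρ) {f : ℝ → 𝕜} (hf : Continuous f) (s t : ℝ) :
    ∫ x in s + r..t + r, f x ∂ρ = ∫ x in s..t, f (x + r) ∂ρ := by
  have key : ∀ s t : ℝ, ∫ x in Ioc (s + r) (t + r), f x ∂ρ = ∫ x in Ioc s t, f (x + r) ∂ρ := by
    intro s t
    conv_rhs => rw [← hρ]
    rw [setIntegral_map measurableSet_Ioc (by fun_prop) (by fun_prop)]
    simp only [preimage_sub_const_Ioc, sub_add_cancel]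
  rw [intervalIntegral, intervalIntegral, key, key]

/-- The defect of periodicity: the difference of the distribution functions of `μ` and of its
translate by `r`, up to a constant that is at disposal because `cdf` is normalized at `0`. It
vanishes for a suitable `c` if `μ` is `r`-periodic. -/
noncomputable def defect (μ : LocalMeasure) (r c x : ℝ) : ℝ := μ.cdf x - μ.cdf (x + r) + c

theorem measurable_defect (μ : LocalMeasure) (r c : ℝ) : Measurable (defect μ r c) :=
  (μ.measurable_cdf.sub (μ.measurable_cdf.comp (measurable_add_const r))).add_const c

theorem exists_bound_defect (μ : LocalMeasure) (r c p q : ℝ) :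
    ∃ B, 0 ≤ B ∧ ∀ t ∈ Icc p q, |defect μ r c t| ≤ B := by
  obtain ⟨B, hB, h1⟩ := μ.exists_bound_cdf p q
  obtain ⟨C, hC, h2⟩ := μ.exists_bound_cdf (p + r) (q + r)
  refine ⟨B + C + |c|, by positivity, fun t ht => (abs_add_le _ _).trans
    (add_le_add ((abs_sub _ _).trans (add_le_add (h1 t ht) (h2 (t + r) ?_))) le_rfl)⟩
  exact ⟨by linarith [ht.1], by linarith [ht.2]⟩

/-- The translate of a solution, corrected by a shear with the defect of periodicity, is an
approximate solution of the original system. The shear turns the difference of the measures `μ` and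
`μ(· + r)` into terms that only involve the `L_1` norm of the defect, and this is what the weak
seminorm controls. -/
theorem ApproxSolution.shift {μ : LocalMeasure} {ρ : Measure ℝ} [IsLocallyFiniteMeasure ρ]
    {z : 𝕜} {k : ℝ → 𝕜} (hk : IsChargeDensity μ ρ z k) {b : ℝ → ℝ} {β : ℝ} (hb : ∀ x, |b x| ≤ β)
    (hbm : AEStronglyMeasurable b volume) {u w : ℝ → 𝕜}
    (h : ApproxSolution (μ.variation + ρ) (fun x => (b x : 𝕜)) k u w 0 0) {r : ℝ}
    (hρ : ρ.map (fun x => x - r) = ρ) (c : ℝ) :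
    ApproxSolution (μ.variation + ρ) (fun x => (b x : 𝕜)) k (fun x => u (x + r))
      (fun x => w (x + r) + (defect μ r c x : 𝕜) * u (x + r))
      (fun x => ((b (x + r) - b x : ℝ) : 𝕜) * w (x + r) -
        (b x : 𝕜) * ((defect μ r c x : 𝕜) * u (x + r)))
      (fun x => (defect μ r c x : 𝕜) * ((b (x + r) : 𝕜) * w (x + r))) := by
  have hβ : 0 ≤ β := (abs_nonneg _).trans (hb 0)
  have hu : HasDensity volume u fun x => (b x : 𝕜) * w x := by simpa using h.left
  have huc := hu.continuous
  have hur := hu.comp_add_right r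
  have hurc := hur.continuous
  have cm : Measurable fun x : ℝ => (x : 𝕜) := RCLike.measurable_ofReal
  have hφm : Measurable fun x => (defect μ r c x : 𝕜) := cm.comp (measurable_defect μ r c)
  have hφb : ∀ p q : ℝ, ∃ B, 0 ≤ B ∧ ∀ t ∈ Icc p q, ‖(defect μ r c t : 𝕜)‖ ≤ B := by
    simpa only [RCLike.norm_ofReal] using exists_bound_defect μ r c
  have hWl : LocallyIntegrable (fun x => w (x + r) + (defect μ r c x : 𝕜) * u (x + r)) volume := by
    refine LocallyIntegrable.add (locallyIntegrable_of_bound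
      (h.measurable.comp (measurable_add_const r)).aestronglyMeasurable fun p q => ?_)
      (locallyIntegrable_bounded_mul hurc.locallyIntegrable hφm.aestronglyMeasurable hφb)
    obtain ⟨B, hB, hB'⟩ := h.exists_bound (p + r) (q + r)
    exact ⟨B, hB, fun t ht => hB' _ ⟨by linarith [ht.1], by linarith [ht.2]⟩⟩
  have hbW := locallyIntegrable_bounded_mul hWl
    (RCLike.continuous_ofReal.comp_aestronglyMeasurable hbm : AEStronglyMeasurable
      (fun x => (b x : 𝕜)) volume)
    fun _ _ => ⟨β, hβ, fun t _ => by rw [RCLike.norm_ofReal]; exact hb t⟩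
  have hg : LocallyIntegrable
      (fun x => (defect μ r c x : 𝕜) * ((b (x + r) : 𝕜) * w (x + r))) volume :=
    locallyIntegrable_bounded_mul hur.1 hφm.aestronglyMeasurable hφb
  refine ⟨?_, ?_, _, hasDensity_integral hg 0, ?_⟩
  · have e : ∀ x, ((b (x + r) - b x : ℝ) : 𝕜) * w (x + r) -
        (b x : 𝕜) * ((defect μ r c x : 𝕜) * u (x + r)) = (b (x + r) : 𝕜) * w (x + r) -
        (b x : 𝕜) * (w (x + r) + (defect μ r c x : 𝕜) * u (x + r)) := fun x => by
      push_cast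
      ring
    simp_rw [e]
    exact hur.1.sub hbW
  · convert hur using 2 with x
    push_cast
    ring
  · refine .of_sub_eq (hk.locallyIntegrable_mul hurc) fun s t => ?_
    have e1 := h.right_sub_eq (s + r) (t + r)
    simp only [Pi.zero_apply, intervalIntegral.integral_zero, add_zero] at e1
    rw [← hk.integral_eq u huc, μ.integralFromTo_eq hu, ← intervalIntegral.integral_comp_add_right,
      intervalIntegral_comp_add_of_map_eq hρ huc] at e1
    rw [← hk.integral_eq _ hurc, μ.integralFromTo_eq hur]
    have e2 := (hasDensity_integral hg 0).sub_eq s t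
    have hΦ : ∀ d : ℝ, IntervalIntegrable
        (fun x => (b (x + r) : 𝕜) * w (x + r) * (μ.cdf (x + d) : 𝕜)) volume s t := by
      intro d
      have : LocallyIntegrable (fun x => (μ.cdf (x + d) : 𝕜) * ((b (x + r) : 𝕜) * w (x + r)))
          volume := by
        refine locallyIntegrable_bounded_mul hur.1 (cm.comp
          (μ.measurable_cdf.comp (measurable_add_const d))).aestronglyMeasurable fun p q => ?_
        obtain ⟨B, hB, hB'⟩ := μ.exists_bound_cdf (p + d) (q + d)
        refine ⟨B, hB, fun t ht => ?_⟩
        rw [RCLike.norm_ofReal]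
        exact hB' _ ⟨by linarith [ht.1], by linarith [ht.2]⟩
      simp_rw [mul_comm (μ.cdf _ : 𝕜)] at this
      exact intervalIntegrable_of_locallyIntegrable this s t
    have hΦ0 := hΦ 0
    simp only [add_zero] at hΦ0
    -- the integral of the last error term, split into the terms left by integration by parts
    have e3 : ∫ x in s..t, (defect μ r c x : 𝕜) * ((b (x + r) : 𝕜) * w (x + r)) =
        (∫ x in s..t, (b (x + r) : 𝕜) * w (x + r) * (μ.cdf x : 𝕜)) -
        (∫ x in s..t, (b (x + r) : 𝕜) * w (x + r) * (μ.cdf (x + r) : 𝕜)) +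
        (c : 𝕜) * (u (t + r) - u (s + r)) := by
      rw [hur.sub_eq s t, ← intervalIntegral.integral_const_mul,
        ← intervalIntegral.integral_sub hΦ0 (hΦ r), ← intervalIntegral.integral_add
          (hΦ0.sub (hΦ r)) ((hur.intervalIntegrable s t).const_mul _)]
      congr 1
      funext x
      simp only [defect]
      push_cast
      ring
    rw [e3] at e2
    have hd : ∀ x, (defect μ r c x : 𝕜) = μ.cdf x - μ.cdf (x + r) + c := fun x => by
      simp [defect]
    linear_combination e1 - e2 + u (t + r) * hd t - u (s + r) * hd s

/-- Both error terms of a translate are controlled by the defects of periodicity of `b` and `μ`. -/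
theorem integral_norm_shift_error_le {b φ : ℝ → ℝ} {β M r p q s t : ℝ} {u w : ℝ → 𝕜}
    (hM : 0 ≤ M) (hb : ∀ x, |b x| ≤ β) (hbi : IntegrableOn (fun x => |b (x + r) - b x|) (Ioc p q))
    (hφi : IntegrableOn (fun x => |φ x|) (Ioc p q))
    (hu : ∀ x ∈ Ioc p q, ‖u (x + r)‖ ≤ M) (hw : ∀ x ∈ Ioc p q, ‖w (x + r)‖ ≤ M)
    (hst : uIoc s t ⊆ Ioc p q) :
    (∫ x in uIoc s t, ‖((b (x + r) - b x : ℝ) : 𝕜) * w (x + r) -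
        (b x : 𝕜) * ((φ x : 𝕜) * u (x + r))‖ ≤
      M * ((∫ x in Ioc p q, |b (x + r) - b x|) + β * ∫ x in Ioc p q, |φ x|)) ∧
    ∫ x in uIoc s t, ‖(φ x : 𝕜) * ((b (x + r) : 𝕜) * w (x + r))‖ ≤
      M * ((∫ x in Ioc p q, |b (x + r) - b x|) + β * ∫ x in Ioc p q, |φ x|) := by
  have hβ : 0 ≤ β := (abs_nonneg _).trans (hb 0)
  have hi : IntegrableOn (fun x => M * (|b (x + r) - b x| + β * |φ x|)) (Ioc p q) :=
    (hbi.add (hφi.const_mul β)).const_mul M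
  have e : M * ((∫ x in Ioc p q, |b (x + r) - b x|) + β * ∫ x in Ioc p q, |φ x|) =
      ∫ x in Ioc p q, M * (|b (x + r) - b x| + β * |φ x|) := by
    rw [integral_const_mul, integral_add hbi (hφi.const_mul β), integral_const_mul]
  have key : ∀ F : ℝ → ℝ, (∀ x, 0 ≤ F x) →
      (∀ x ∈ Ioc p q, F x ≤ M * (|b (x + r) - b x| + β * |φ x|)) →
      ∫ x in uIoc s t, F x ≤ ∫ x in Ioc p q, M * (|b (x + r) - b x| + β * |φ x|) := by
    intro F hF0 hF
    refine le_trans (integral_mono_of_nonneg (Eventually.of_forall hF0) (hi.mono_set hst)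
      (ae_restrict_of_forall_mem measurableSet_uIoc fun x hx => hF x (hst hx))) ?_
    exact setIntegral_mono_set hi (Eventually.of_forall fun x => by positivity) hst.eventuallyLE
  rw [e]
  refine ⟨key _ (fun _ => norm_nonneg _) fun x hx => ?_, key _ (fun _ => norm_nonneg _)
    fun x hx => ?_⟩
  · refine (norm_sub_le _ _).trans ?_
    simp only [norm_mul, RCLike.norm_ofReal]
    have h1 := mul_le_mul_of_nonneg_left (hw x hx) (abs_nonneg (b (x + r) - b x))
    have h2 := mul_le_mul (hb x) (mul_le_mul_of_nonneg_left (hu x hx) (abs_nonneg (φ x)))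
      (by positivity) hβ
    linarith
  · simp only [norm_mul, RCLike.norm_ofReal]
    have h2 := mul_le_mul_of_nonneg_left
      (mul_le_mul (hb (x + r)) (hw x hx) (norm_nonneg _) hβ) (abs_nonneg (φ x))
    have h3 : 0 ≤ M * |b (x + r) - b x| := by positivity
    linarith

/-- If the determinant of `(p, q)` and a fixed vector `(x₀, y₀) ≠ 0` is small, then `(p, q)` is
almost a multiple of `(x₀, y₀)`. -/
theorem exists_almost_multiple {x₀ y₀ : 𝕜} (h : ¬ (x₀ = 0 ∧ y₀ = 0)) :
    ∃ K : ℝ, 0 ≤ K ∧ ∀ p q : 𝕜, ∃ d : 𝕜, ‖d‖ ≤ K * (‖p‖ + ‖q‖) ∧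
      ‖p - d * x₀‖ + ‖q - d * y₀‖ ≤ K * ‖p * y₀ - q * x₀‖ := by
  by_cases hx : x₀ = 0
  · have hy : y₀ ≠ 0 := fun hy => h ⟨hx, hy⟩
    refine ⟨‖y₀‖⁻¹, by positivity, fun p q => ⟨q / y₀, ?_, ?_⟩⟩
    · rw [norm_div, div_eq_inv_mul]
      exact mul_le_mul_of_nonneg_left (by linarith [norm_nonneg p]) (by positivity)
    · have hy' : ‖y₀‖ ≠ 0 := norm_ne_zero_iff.2 hy
      rw [hx, mul_zero, sub_zero, mul_zero, sub_zero, div_mul_cancel₀ _ hy, sub_self, norm_zero,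
        add_zero, norm_mul, mul_comm ‖p‖, inv_mul_cancel_left₀ hy']
  · refine ⟨‖x₀‖⁻¹, by positivity, fun p q => ⟨p / x₀, ?_, ?_⟩⟩
    · rw [norm_div, div_eq_inv_mul]
      exact mul_le_mul_of_nonneg_left (by linarith [norm_nonneg q]) (by positivity)
    · have e : q - p / x₀ * y₀ = -(x₀⁻¹ * (p * y₀ - q * x₀)) := by
        field_simp
        ring
      rw [e, div_mul_cancel₀ _ hx, sub_self, norm_zero, zero_add, norm_neg, norm_mul, norm_inv]

end SturmLiouville

/-! ### The Gordon estimate -/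

namespace SturmLiouville

variable {𝕜 : Type*} [RCLike 𝕜]

theorem map_add_eq_of_map_sub_eq {ρ : Measure ℝ} {r : ℝ} (hρ : ρ.map (fun x => x - r) = ρ) :
    ρ.map (fun x => x - -r) = ρ := by
  conv_lhs => rw [← hρ]
  rw [Measure.map_map (by fun_prop) (by fun_prop)]
  have : (fun x : ℝ => x - -r) ∘ (fun x => x - r) = id := by
    funext x
    simp
  rw [this, Measure.map_id]

theorem defect_neg (μ : LocalMeasure) (r c x : ℝ) :
    defect μ (-r) (-c) x = -defect μ r c (x - r) := by
  simp only [defect, sub_add_cancel, ← sub_eq_add_neg]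
  ring

theorem integrableOn_of_bound {f : ℝ → ℝ} (hf : Measurable f)
    (hb : ∀ p q : ℝ, ∃ B, 0 ≤ B ∧ ∀ t ∈ Icc p q, |f t| ≤ B) (p q : ℝ) :
    IntegrableOn f (Ioc p q) :=
  ((locallyIntegrable_of_bound hf.aestronglyMeasurable hb).integrableOn_isCompact
    isCompact_Icc).mono_set Ioc_subset_Icc_self

theorem integrableOn_abs_shift_sub {b : ℝ → ℝ} {β : ℝ} (hb : ∀ x, |b x| ≤ β) (hbm : Measurable b)
    (r p q : ℝ) : IntegrableOn (fun x => |b (x + r) - b x|) (Ioc p q) := by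
  refine (integrableOn_of_bound ((hbm.comp (measurable_add_const r)).sub hbm)
    (fun _ _ => ⟨2 * β, ?_, fun t _ => ?_⟩) p q).abs
  · have := (abs_nonneg _).trans (hb 0)
    positivity
  · have := abs_sub (b (t + r)) (b t)
    simp only [Function.comp_apply, Pi.sub_apply]
    linarith [hb (t + r), hb t]

theorem integrableOn_abs_defect (μ : LocalMeasure) (r c p q : ℝ) :
    IntegrableOn (fun x => |defect μ r c x|) (Ioc p q) :=
  (integrableOn_of_bound (measurable_defect μ r c) (exists_bound_defect μ r c) p q).abs

/-- The quantitative form of Gordon's argument. If the coefficients are periodic up to the error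
`∫ |b(· + r) - b| + β ∫ |φ|` on `[-r, r]`, then the translates of a solution by `r` and by `-r` are
approximate solutions; by the Wronskian their sum is at `0` almost a multiple `d` of the solution,
hence the same holds at `r`, which bounds the solution at `0` by its values at `-r`, `r`, `2 r`. -/
theorem gordon_estimate {μ : LocalMeasure} {ρ : Measure ℝ} [IsLocallyFiniteMeasure ρ]
    {z : 𝕜} {k : ℝ → 𝕜} (hk : IsChargeDensity μ ρ z k) {b : ℝ → ℝ} {β : ℝ} (hb : ∀ x, |b x| ≤ β)
    (hbm : Measurable b) {u w : ℝ → 𝕜}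
    (h : ApproxSolution (μ.variation + ρ) (fun x => (b x : 𝕜)) k u w 0 0) {r : ℝ} (hr : 0 < r)
    (hρ : ρ.map (fun x => x - r) = ρ) (c : ℝ) {A γ : ℝ} (hA : 0 ≤ A)
    (hgrow : ∀ u w f g : ℝ → 𝕜, ApproxSolution (μ.variation + ρ) (fun x => (b x : 𝕜)) k u w f g →
      ∀ s t δ : ℝ, 0 ≤ δ → ∫ x in uIoc s t, ‖f x‖ ≤ δ → ∫ x in uIoc s t, ‖g x‖ ≤ δ →
      ‖u t‖ + ‖w t‖ ≤ A * Real.exp (γ * |t - s|) * (‖u s‖ + ‖w s‖ + δ))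
    {K : ℝ} (hK₀ : 0 ≤ K) (hK : ∀ p q : 𝕜, ∃ d : 𝕜, ‖d‖ ≤ K * (‖p‖ + ‖q‖) ∧
      ‖p - d * u 0‖ + ‖q - d * w 0‖ ≤ K * ‖p * w 0 - q * u 0‖)
    {M D P : ℝ} (hM : ∀ x ∈ Icc (-(2 * r)) (2 * r), ‖u x‖ + ‖w x‖ ≤ M)
    (hD : (∫ x in Ioc (-r) r, |b (x + r) - b x|) + β * ∫ x in Ioc (-r) r, |defect μ r c x| ≤ D)
    (hP : ∀ x ∈ ({-r, 0, r} : Set ℝ), |defect μ r c x| ≤ P) :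
    ‖u 0‖ + ‖w 0‖ ≤ (1 + P) * ((1 + P) * (‖u (2 * r)‖ + ‖w (2 * r)‖) +
      K * (1 + P) * (‖u r‖ + ‖w r‖ + (‖u (-r)‖ + ‖w (-r)‖)) * (‖u r‖ + ‖w r‖) +
      A * Real.exp (γ * r) * ((2 * K * M + 2) * (M * D))) := by
  set φ := defect μ r c with hφ
  have hβ : 0 ≤ β := (abs_nonneg _).trans (hb 0)
  have hP0 : 0 ≤ P := (abs_nonneg _).trans (hP 0 (by simp))
  have hMu : ∀ x ∈ Icc (-(2 * r)) (2 * r), ‖u x‖ ≤ M := fun x hx => by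
    linarith [hM x hx, norm_nonneg (w x)]
  have hMw : ∀ x ∈ Icc (-(2 * r)) (2 * r), ‖w x‖ ≤ M := fun x hx => by
    linarith [hM x hx, norm_nonneg (u x)]
  have hM0 : 0 ≤ M := (norm_nonneg _).trans (hMu 0 ⟨by linarith, by linarith⟩)
  have i1 := integrableOn_abs_shift_sub hb hbm r
  have i2 := integrableOn_abs_defect μ r c
  have i3 := integrableOn_abs_shift_sub hb hbm (-r)
  have i4 := integrableOn_abs_defect μ (-r) (-c)
  have hD0 : 0 ≤ D := le_trans (add_nonneg (integral_nonneg fun _ => abs_nonneg _)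
    (mul_nonneg hβ (integral_nonneg fun _ => abs_nonneg _))) hD
  have hδ : 0 ≤ M * D := mul_nonneg hM0 hD0
  -- the translate by `-r` uses the constant `-c`, so that its defect is `-φ(· - r)`
  have hY := h.shift hk hb hbm.aestronglyMeasurable hρ c
  have hZ := h.shift hk hb hbm.aestronglyMeasurable (map_add_eq_of_map_sub_eq hρ) (-c)
  have eY : ∀ s t : ℝ, uIoc s t ⊆ Ioc (-r) r →
      (∫ x in uIoc s t, ‖((b (x + r) - b x : ℝ) : 𝕜) * w (x + r) -
        (b x : 𝕜) * ((φ x : 𝕜) * u (x + r))‖ ≤ M * D) ∧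
      ∫ x in uIoc s t, ‖(φ x : 𝕜) * ((b (x + r) : 𝕜) * w (x + r))‖ ≤ M * D := by
    intro s t hst
    have := integral_norm_shift_error_le (𝕜 := 𝕜) (u := u) (w := w) hM0 hb (i1 (-r) r)
      (i2 (-r) r) (fun x hx => hMu _ ⟨by linarith [hx.1], by linarith [hx.2]⟩)
      (fun x hx => hMw _ ⟨by linarith [hx.1], by linarith [hx.2]⟩) hst
    have hle := mul_le_mul_of_nonneg_left hD hM0
    exact ⟨this.1.trans hle, this.2.trans hle⟩
  have eZ := integral_norm_shift_error_le (𝕜 := 𝕜) (u := u) (w := w) (s := 0) (t := r) hM0 hb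
      (i3 0 r) (i4 0 r) (fun x hx => hMu _ ⟨by linarith [hx.1], by linarith [hx.2]⟩)
      (fun x hx => hMw _ ⟨by linarith [hx.1], by linarith [hx.2]⟩) (by rw [uIoc_of_le hr.le])
  have hDZ : (∫ x in Ioc 0 r, |b (x + -r) - b x|) +
      β * ∫ x in Ioc 0 r, |defect μ (-r) (-c) x| ≤ D := by
    refine le_trans (add_le_add ?_ (mul_le_mul_of_nonneg_left ?_ hβ)) hD
    · have e : ∫ x in Ioc 0 r, |b (x + -r) - b x| = ∫ x in Ioc (-r) 0, |b (x + r) - b x| := by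
        rw [← intervalIntegral.integral_of_le hr.le, ← intervalIntegral.integral_of_le (by linarith)]
        have := intervalIntegral.integral_comp_sub_right (a := 0) (b := r)
          (fun x => |b (x + r) - b x|) r
        rw [zero_sub, sub_self] at this
        rw [← this]
        congr 1
        funext x
        rw [sub_add_cancel, abs_sub_comm, sub_eq_add_neg x]
      rw [e]
      exact setIntegral_mono_set (i1 _ _) (Eventually.of_forall fun _ => abs_nonneg _)
        (Ioc_subset_Ioc_right hr.le).eventuallyLE
    · have e : ∫ x in Ioc 0 r, |defect μ (-r) (-c) x| = ∫ x in Ioc (-r) 0, |φ x| := by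
        rw [← intervalIntegral.integral_of_le hr.le, ← intervalIntegral.integral_of_le (by linarith)]
        have := intervalIntegral.integral_comp_sub_right (a := 0) (b := r) (fun x => |φ x|) r
        rw [zero_sub, sub_self] at this
        rw [← this]
        congr 1
        funext x
        rw [defect_neg, abs_neg]
      rw [e]
      exact setIntegral_mono_set (i2 _ _) (Eventually.of_forall fun _ => abs_nonneg _)
        (Ioc_subset_Ioc_right hr.le).eventuallyLE
  have hle := mul_le_mul_of_nonneg_left hDZ hM0
  have eZ1 := eZ.1.trans hle
  have eZ2 := eZ.2.trans hle
  have eY0 := eY 0 r (by rw [uIoc_of_le hr.le]; exact Ioc_subset_Ioc_left (by linarith))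
  -- the Wronskian of the solution and its translate is almost constant
  have hW := hY.wronskian_sub h (-r) 0
  have eYm := eY (-r) 0 (by rw [uIoc_of_le (by linarith)]; exact Ioc_subset_Ioc_right hr.le)
  have hWn : ‖(u (0 + r) * w 0 - u 0 * (w (0 + r) + (φ 0 : 𝕜) * u (0 + r))) -
      (u (-r + r) * w (-r) - u (-r) * (w (-r + r) + (φ (-r) : 𝕜) * u (-r + r)))‖ ≤
      2 * M * (M * D) := by
    rw [hW]
    simp only [Pi.zero_apply, mul_zero, zero_mul, add_zero, zero_add]
    have j1 := ((hY.locallyIntegrable.integrableOn_isCompact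
      (isCompact_uIcc (a := -r) (b := 0))).mono_set uIoc_subset_uIcc).norm
    have j2 := ((hY.locallyIntegrable_right.integrableOn_isCompact
      (isCompact_uIcc (a := -r) (b := 0))).mono_set uIoc_subset_uIcc).norm
    have hint := integral_add (j1.const_mul M) (j2.const_mul M)
    rw [integral_const_mul, integral_const_mul] at hint
    refine intervalIntegral.norm_integral_le_integral_norm_uIoc.trans ?_
    refine le_trans (integral_mono_of_nonneg (Eventually.of_forall fun _ => norm_nonneg _)
      ((j1.const_mul M).add (j2.const_mul M)) (ae_restrict_of_forall_mem measurableSet_uIoc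
      fun x hx => ?_)) (hint.le.trans ?_)
    · rw [uIoc_of_le (by linarith)] at hx
      have hx' : x ∈ Icc (-(2 * r)) (2 * r) := ⟨by linarith [hx.1], by linarith [hx.2]⟩
      refine (norm_sub_le _ _).trans ?_
      rw [norm_mul, norm_mul (u x)]
      exact add_le_add ((mul_comm _ _).trans_le
        (mul_le_mul_of_nonneg_right (hMw x hx') (norm_nonneg _)))
        (mul_le_mul_of_nonneg_right (hMu x hx') (norm_nonneg _))
    · have h1 := mul_le_mul_of_nonneg_left eYm.1 hM0
      have h2 := mul_le_mul_of_nonneg_left eYm.2 hM0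
      linarith
  rw [zero_add, neg_add_cancel] at hWn
  -- `(p, q)` is the sum of the corrected translates at `0`; its determinant with `(u 0, w 0)` is the
  -- increment of the Wronskian over `[-r, 0]`
  set p : 𝕜 := u r + u (-r) with hp
  set q : 𝕜 := w r + (φ 0 : 𝕜) * u r + (w (-r) - (φ (-r) : 𝕜) * u (-r)) with hq
  obtain ⟨d, hd, hdpq⟩ := hK p q
  have hdet : p * w 0 - q * u 0 = (u r * w 0 - u 0 * (w r + (φ 0 : 𝕜) * u r)) -
      (u 0 * w (-r) - u (-r) * (w 0 + (φ (-r) : 𝕜) * u 0)) := by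
    rw [hp, hq]; ring
  rw [hdet] at hdpq
  have hdpq' : ‖p - d * u 0‖ + ‖q - d * w 0‖ ≤ K * (2 * M * (M * D)) :=
    hdpq.trans (mul_le_mul_of_nonneg_left hWn hK₀)
  -- the sum of the translates minus the multiple of the solution stays small up to `r`
  have hE := (hY.add hZ).add (h.const_mul (-d))
  have herr : ∀ F G : ℝ → 𝕜, LocallyIntegrable F volume → LocallyIntegrable G volume →
      ∫ x in uIoc 0 r, ‖F x‖ ≤ M * D → ∫ x in uIoc 0 r, ‖G x‖ ≤ M * D →
      ∫ x in uIoc 0 r, ‖F x + G x + -d * (0 : ℝ → 𝕜) x‖ ≤ 2 * (M * D) := by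
    intro F G hF hG hF' hG'
    have j1 := ((hF.integrableOn_isCompact (isCompact_uIcc (a := 0) (b := r))).mono_set
      uIoc_subset_uIcc).norm
    have j2 := ((hG.integrableOn_isCompact (isCompact_uIcc (a := 0) (b := r))).mono_set
      uIoc_subset_uIcc).norm
    refine le_trans (integral_mono_of_nonneg (Eventually.of_forall fun _ => norm_nonneg _)
      (j1.add j2) (Eventually.of_forall fun x => ?_)) ((integral_add j1 j2).le.trans (by linarith))
    simp only [Pi.zero_apply, mul_zero, add_zero]
    exact norm_add_le _ _
  have hEr := hgrow _ _ _ _ hE 0 r (2 * (M * D)) (by positivity)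
    (herr _ _ hY.locallyIntegrable hZ.locallyIntegrable eY0.1 eZ1)
    (herr _ _ hY.locallyIntegrable_right hZ.locallyIntegrable_right eY0.2 eZ2)
  simp only [defect_neg, zero_add, zero_sub, sub_self, ← hφ, add_neg_cancel, sub_zero,
    abs_of_pos hr] at hEr
  rw [← two_mul] at hEr
  have a1 : u r + u (-r) + -d * u 0 = p - d * u 0 := by rw [hp]; ring
  have a2 : w r + (φ 0 : 𝕜) * u r + (w (-r) + ((-φ (-r) : ℝ) : 𝕜) * u (-r)) + -d * w 0 =
      q - d * w 0 := by rw [hq]; push_cast; ring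
  rw [a1, a2] at hEr
  set e₁ : 𝕜 := u (2 * r) + u 0 + -d * u r with he₁
  set e₂ : 𝕜 := w (2 * r) + (φ r : 𝕜) * u (2 * r) + (w 0 + ((-φ 0 : ℝ) : 𝕜) * u 0) + -d * w r
    with he₂
  set X := A * Real.exp (γ * r)
  have hX : 0 ≤ X := by positivity
  have hE' : ‖e₁‖ + ‖e₂‖ ≤ X * ((2 * K * M + 2) * (M * D)) := by
    refine hEr.trans (mul_le_mul_of_nonneg_left ?_ hX)
    linarith
  have nφ : ∀ x ∈ ({-r, 0, r} : Set ℝ), ∀ y : 𝕜, ‖(φ x : 𝕜) * y‖ ≤ P * ‖y‖ := by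
    intro x hx y
    rw [norm_mul, RCLike.norm_ofReal]
    exact mul_le_mul_of_nonneg_right (hP x hx) (norm_nonneg _)
  have hpq : ‖p‖ + ‖q‖ ≤ (1 + P) * (‖u r‖ + ‖w r‖ + (‖u (-r)‖ + ‖w (-r)‖)) := by
    have h1 := norm_add_le (u r) (u (-r))
    have h2 := norm_add_le (w r + (φ 0 : 𝕜) * u r) (w (-r) - (φ (-r) : 𝕜) * u (-r))
    have h3 := norm_add_le (w r) ((φ 0 : 𝕜) * u r)
    have h4 := norm_sub_le (w (-r)) ((φ (-r) : 𝕜) * u (-r))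
    have h5 := nφ 0 (by simp) (u r)
    have h6 := nφ (-r) (by simp) (u (-r))
    have h7 : 0 ≤ P * (‖w r‖ + ‖w (-r)‖) := by positivity
    linarith
  have hd' : ‖d‖ ≤ K * (1 + P) * (‖u r‖ + ‖w r‖ + (‖u (-r)‖ + ‖w (-r)‖)) := by
    rw [mul_assoc]
    exact hd.trans (mul_le_mul_of_nonneg_left hpq hK₀)
  have hu0 : ‖u 0‖ ≤ ‖u (2 * r)‖ + ‖d‖ * ‖u r‖ + ‖e₁‖ := by
    have e : u 0 = e₁ - u (2 * r) + d * u r := by rw [he₁]; ring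
    have h1 := norm_add_le (e₁ - u (2 * r)) (d * u r)
    have h2 := norm_sub_le e₁ (u (2 * r))
    rw [← e, norm_mul] at h1
    linarith
  have hw0 : ‖w 0‖ ≤ ‖w (2 * r)‖ + P * ‖u (2 * r)‖ + P * ‖u 0‖ + ‖d‖ * ‖w r‖ + ‖e₂‖ := by
    have e : w 0 = e₂ - w (2 * r) - (φ r : 𝕜) * u (2 * r) + (φ 0 : 𝕜) * u 0 + d * w r := by
      rw [he₂]; push_cast; ring
    have h1 := norm_add_le (e₂ - w (2 * r) - (φ r : 𝕜) * u (2 * r) + (φ 0 : 𝕜) * u 0) (d * w r)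
    have h2 := norm_add_le (e₂ - w (2 * r) - (φ r : 𝕜) * u (2 * r)) ((φ 0 : 𝕜) * u 0)
    have h3 := norm_sub_le (e₂ - w (2 * r)) ((φ r : 𝕜) * u (2 * r))
    have h4 := norm_sub_le e₂ (w (2 * r))
    rw [← e, norm_mul] at h1
    linarith [nφ 0 (by simp) (u 0), nφ r (by simp) (u (2 * r))]
  have hdn : ‖d‖ * (‖u r‖ + ‖w r‖) ≤
      K * (1 + P) * (‖u r‖ + ‖w r‖ + (‖u (-r)‖ + ‖w (-r)‖)) * (‖u r‖ + ‖w r‖) :=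
    mul_le_mul_of_nonneg_right hd' (by positivity)
  have s1 := mul_le_mul_of_nonneg_left hu0 hP0
  have s2 : 0 ≤ P * ‖w (2 * r)‖ := by positivity
  have s3 : 0 ≤ P * (‖d‖ * ‖w r‖) := by positivity
  have s4 : 0 ≤ P * ‖e₂‖ := by positivity
  have s5 : 0 ≤ P * (P * ‖u (2 * r)‖ + P * ‖w (2 * r)‖) := by positivity
  have hfin : ‖u 0‖ + ‖w 0‖ ≤ (1 + P) * ((1 + P) * (‖u (2 * r)‖ + ‖w (2 * r)‖) +
      ‖d‖ * (‖u r‖ + ‖w r‖) + (‖e₁‖ + ‖e₂‖)) := by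
    have s6 : 0 ≤ P * ‖u (2 * r)‖ := by positivity
    linarith
  refine hfin.trans (mul_le_mul_of_nonneg_left ?_ (by positivity))
  linarith

end SturmLiouville

/-! ### Decay of solutions in `L_p` of a periodic measure -/

namespace SturmLiouville

variable {𝕜 : Type*} [RCLike 𝕜] {ρ : Measure ℝ}

theorem exists_pos_period (h : (periods ρ).Nonempty) :
    ∃ T : ℝ, 0 < T ∧ ρ.map (fun x => x - T) = ρ := by
  obtain ⟨r, hr, hρ⟩ := h
  rcases lt_or_gt_of_ne hr with h | h
  · exact ⟨-r, by linarith, map_add_eq_of_map_sub_eq hρ⟩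
  · exact ⟨r, h, hρ⟩

theorem measure_ball_add_intCast_mul {T : ℝ} (hρ : ρ.map (fun x => x - T) = ρ) (x ε : ℝ) (n : ℤ) :
    ρ (Metric.ball (x + n * T) ε) = ρ (Metric.ball x ε) := by
  have h1 : ∀ y, ρ (Metric.ball (y + T) ε) = ρ (Metric.ball y ε) := by
    intro y
    conv_rhs => rw [← hρ]
    rw [Measure.map_apply (by fun_prop) measurableSet_ball]
    congr 1
    ext s
    simp only [Metric.mem_ball, Real.dist_eq, mem_preimage]
    rw [sub_sub, add_comm T]
  induction n using Int.induction_on with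
  | zero => simp
  | succ i ih =>
    rw [← ih, ← h1 (x + (i : ℤ) * T)]
    congr 2
    push_cast
    ring
  | pred i ih =>
    rw [← ih, ← h1]
    congr 2
    push_cast
    ring

theorem add_intCast_mul_mem_support {T : ℝ} (hρ : ρ.map (fun x => x - T) = ρ) {x : ℝ}
    (hx : x ∈ ρ.support) (n : ℤ) : x + n * T ∈ ρ.support := by
  rw [Metric.nhds_basis_ball.mem_measureSupport] at hx ⊢
  intro ε hε
  rw [measure_ball_add_intCast_mul hρ]
  exact hx ε hε

/-- For a periodic measure, balls of a fixed radius around points of the support have measure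
bounded below. -/
theorem exists_le_measure_ball {T : ℝ} (hT : 0 < T) (hρ : ρ.map (fun x => x - T) = ρ) {ε : ℝ}
    (hε : 0 < ε) : ∃ m : ℝ≥0∞, 0 < m ∧ ∀ x ∈ ρ.support, m ≤ ρ (Metric.ball x ε) := by
  have hc : IsCompact (Icc 0 T ∩ ρ.support) := isCompact_Icc.inter_right Measure.isClosed_support
  obtain ⟨m, hm, h⟩ : ∃ m : ℝ≥0∞, 0 < m ∧ ∀ x ∈ Icc 0 T ∩ ρ.support, m ≤ ρ (Metric.ball x ε) := by
    refine hc.induction_on (p := fun s => ∃ m : ℝ≥0∞, 0 < m ∧ ∀ x ∈ s, m ≤ ρ (Metric.ball x ε))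
      ⟨1, one_pos, by simp⟩ ?_ ?_ ?_
    · rintro s t hst ⟨m, hm, h⟩
      exact ⟨m, hm, fun x hx => h x (hst hx)⟩
    · rintro s t ⟨m, hm, h⟩ ⟨m', hm', h'⟩
      refine ⟨min m m', lt_min hm hm', fun x hx => ?_⟩
      rcases hx with hx | hx
      · exact (min_le_left _ _).trans (h x hx)
      · exact (min_le_right _ _).trans (h' x hx)
    · intro x hx
      have hx' := hx.2
      rw [Metric.nhds_basis_ball.mem_measureSupport] at hx'
      refine ⟨Metric.ball x (ε / 2), mem_nhdsWithin_of_mem_nhds (Metric.ball_mem_nhds x (by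
        positivity)), ρ (Metric.ball x (ε / 2)), hx' _ (by positivity), fun y hy => ?_⟩
      refine measure_mono fun s hs => ?_
      rw [Metric.mem_ball] at *
      have := dist_triangle_right s y x
      linarith
  refine ⟨m, hm, fun x hx => ?_⟩
  have hmem : x + (-⌊x / T⌋ : ℤ) * T ∈ Icc 0 T ∩ ρ.support := by
    refine ⟨⟨?_, ?_⟩, add_intCast_mul_mem_support hρ hx _⟩
    · have := Int.floor_le (x / T)
      rw [le_div_iff₀ hT] at this
      push_cast
      linarith
    · have := (Int.lt_floor_add_one (x / T)).le
      rw [div_le_iff₀ hT] at this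
      push_cast
      linarith
  rw [← measure_ball_add_intCast_mul hρ x ε (-⌊x / T⌋ : ℤ)]
  exact h _ hmem

/-- A continuous function in `L_p` of a periodic measure becomes small near all points of the
support that are far away. -/
theorem exists_norm_lt_of_memLp {T : ℝ} (hT : 0 < T) (hρ : ρ.map (fun x => x - T) = ρ)
    {p : ℝ≥0∞} (hp0 : p ≠ 0) (hp : p ≠ ∞) {u : ℝ → 𝕜} (huc : Continuous u) (hu : MemLp u p ρ)
    {ε κ : ℝ} (hε : 0 < ε) (hκ : 0 < κ) :
    ∃ R : ℝ, ∀ x ∈ ρ.support, R ≤ |x| → ∃ y, |y - x| < ε ∧ ‖u y‖ < κ := by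
  obtain ⟨m, hm, hball⟩ := exists_le_measure_ball hT hρ hε
  set S : ℕ → Set ℝ := fun n => {y | κ ≤ ‖u y‖ ∧ (n : ℝ) ≤ |y|} with hS
  have hSm : ∀ n, MeasurableSet (S n) := fun n =>
    ((isClosed_le continuous_const huc.norm).inter
      (isClosed_le continuous_const continuous_abs)).measurableSet
  have hanti : Antitone S := fun i j hij y hy => ⟨hy.1, (Nat.cast_le.2 hij).trans hy.2⟩
  have hfin : ρ (S 0) ≠ ∞ := by
    have := hu.meas_ge_lt_top hp0 hp (ε := ⟨κ, hκ.le⟩) (NNReal.coe_ne_zero.1 hκ.ne')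
    refine ((measure_mono fun y hy => ?_).trans_lt this).ne
    exact hy.1
  have hlim := tendsto_measure_iInter_atTop (μ := ρ) (fun n => (hSm n).nullMeasurableSet) hanti
    ⟨0, hfin⟩
  have hempty : ⋂ n, S n = ∅ := by
    refine eq_empty_iff_forall_notMem.2 fun y hy => ?_
    obtain ⟨n, hn⟩ := exists_nat_gt |y|
    exact (not_le.2 hn) (mem_iInter.1 hy n).2
  rw [hempty, measure_empty] at hlim
  obtain ⟨n, hn⟩ := (hlim.eventually (gt_mem_nhds hm)).exists
  refine ⟨n + ε, fun x hx hxn => ?_⟩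
  by_contra! hcon
  refine (not_le.2 hn) ((hball x hx).trans (measure_mono fun y hy => ?_))
  rw [Metric.mem_ball, Real.dist_eq] at hy
  refine ⟨hcon y hy, ?_⟩
  have := abs_sub_abs_le_abs_sub x y
  rw [abs_sub_comm] at this
  linarith

theorem measure_Ioc_add_natCast_le {ν : Measure ℝ} {Λ : ℝ} (hΛ : 0 ≤ Λ)
    (hν : ∀ t, ν (Ioc t (t + 1)) ≤ ENNReal.ofReal Λ) (n : ℕ) (t : ℝ) :
    ν (Ioc t (t + n)) ≤ ENNReal.ofReal (n * Λ) := by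
  induction n with
  | zero => simp
  | succ n ih =>
    have e : Ioc t (t + (n + 1 : ℕ)) ⊆ Ioc t (t + n) ∪ Ioc (t + n) (t + n + 1) := by
      intro y hy
      rcases le_or_gt y (t + n) with h | h
      · exact .inl ⟨hy.1, h⟩
      · exact .inr ⟨h, by have := hy.2; push_cast at this; linarith⟩
    refine (measure_mono e).trans ((measure_union_le _ _).trans ((add_le_add ih (hν _)).trans ?_))
    rw [← ENNReal.ofReal_add (by positivity) hΛ]
    refine ENNReal.ofReal_le_ofReal ?_
    push_cast
    linarith

/-- A solution whose first component lies in `L_p(ℝ, ρ)` tends to `0` at `±∞`, together with its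
quasi-derivative. Smallness of `u` on the support of `ρ` makes `w` almost constant over a period,
because `μ` lives on that support; the constant is small, since `u` is small at both ends of a
period and `u' = b w` with `b` bounded below. -/
theorem exists_forall_norm_le {μ : LocalMeasure} [IsLocallyFiniteMeasure ρ] (hρ0 : ρ ≠ 0)
    (hper : (periods ρ).Nonempty) (hsupp : μ.variation.support ⊆ ρ.support) {z : 𝕜} {k : ℝ → 𝕜}
    (hk : IsChargeDensity μ ρ z k) {b : ℝ → ℝ} {β b₀ : ℝ} (hb : ∀ x, |b x| ≤ β) (hb₀ : 0 < b₀)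
    (hbb : ∀ x, b₀ ≤ b x) (hbm : Measurable b) {u w : ℝ → 𝕜}
    (h : ApproxSolution (μ.variation + ρ) (fun x => (b x : 𝕜)) k u w 0 0) {Λ : ℝ} (hΛ : 0 ≤ Λ)
    (hν : ∀ t, (μ.variation + ρ) (Ioc t (t + 1)) ≤ ENNReal.ofReal Λ) {A γ : ℝ} (hA : 0 < A)
    (hγ : 0 ≤ γ) (hgrow : ∀ s t : ℝ,
      ‖u t‖ + ‖w t‖ ≤ A * Real.exp (γ * |t - s|) * (‖u s‖ + ‖w s‖))
    {p : ℝ≥0∞} (hp0 : p ≠ 0) (hp : p ≠ ∞) (hu : MemLp u p ρ) {η : ℝ} (hη : 0 < η) :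
    ∃ R : ℝ, ∀ t, R ≤ |t| → ‖u t‖ + ‖w t‖ ≤ η := by
  obtain ⟨T, hT, hρ⟩ := exists_pos_period hper
  obtain ⟨x₀, hx₀⟩ := Measure.nonempty_support hρ0
  have hβ : 0 < β := hb₀.trans_le ((hbb 0).trans ((le_abs_self _).trans (hb 0)))
  have hud : HasDensity volume u fun x => (b x : 𝕜) * w x := by simpa using h.left
  set G := A * Real.exp (γ * (T + 1))
  have hG : 0 < G := by positivity
  set κ := 2 + ‖z‖
  have hκ : 0 ≤ κ := by positivity
  set Λ' := ⌈T⌉₊ * Λ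
  have hΛ' : 0 ≤ Λ' := by positivity
  set C := 1 + (2 + β * T * (κ * Λ')) / (b₀ * T) with hC
  have hC0 : 0 < C := by positivity
  -- `C * σ` below bounds `N`, and `σ` involves `N` again: `ε` is so small that this is absorbed
  set ε := min 1 (1 / (2 * C * β * G)) with hε
  have hε0 : 0 < ε := lt_min one_pos (by positivity)
  have hε1 : ε ≤ 1 := min_le_left _ _
  have hε2 : C * (β * G * ε) ≤ 1 / 2 := by
    have : ε ≤ 1 / (2 * C * β * G) := min_le_right _ _
    rw [le_div_iff₀ (by positivity)] at this
    linarith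
  set ζ := η / (2 * C * G)
  have hζ : 0 < ζ := by positivity
  obtain ⟨R, hR⟩ := exists_norm_lt_of_memLp hT hρ hp0 hp hud.continuous hu hε0 hζ
  refine ⟨R + 2 * T, fun t ht => ?_⟩
  -- a point of the support at most one period to the left of `t`
  set n := ⌊(t - x₀) / T⌋
  set x := x₀ + n * T with hx
  have hx1 : x ≤ t := by
    have := Int.floor_le ((t - x₀) / T)
    rw [le_div_iff₀ hT] at this
    linarith
  have hx2 : t ≤ x + T := by
    have := (Int.lt_floor_add_one ((t - x₀) / T)).le
    rw [div_le_iff₀ hT] at this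
    linarith
  have hxs : x ∈ ρ.support := add_intCast_mul_mem_support hρ hx₀ n
  have hxs' : x + T ∈ ρ.support := by
    simpa using add_intCast_mul_mem_support hρ hxs 1
  set N := ‖u x‖ + ‖w x‖ with hN
  have hN0 : 0 ≤ N := by positivity
  have hgrow' : ∀ s ∈ Icc (x - 1) (x + T + 1), ‖u s‖ + ‖w s‖ ≤ G * N := by
    intro s hs
    refine (hgrow x s).trans (mul_le_mul_of_nonneg_right ?_ hN0)
    refine mul_le_mul_of_nonneg_left (Real.exp_le_exp.2 (mul_le_mul_of_nonneg_left ?_ hγ)) hA.le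
    rw [abs_le]
    constructor <;> linarith [hs.1, hs.2]
  have hlip : ∀ s ∈ Icc (x - 1) (x + T + 1), ∀ s' ∈ Icc (x - 1) (x + T + 1),
      ‖u s' - u s‖ ≤ β * (G * N) * |s' - s| := by
    intro s hs s' hs'
    rw [hud.sub_eq]
    refine intervalIntegral.norm_integral_le_of_norm_le_const fun y hy => ?_
    have hy' := (uIcc_subset_Icc hs hs') (uIoc_subset_uIcc hy)
    rw [norm_mul, RCLike.norm_ofReal]
    exact mul_le_mul (hb y) (by linarith [hgrow' y hy', norm_nonneg (u y)]) (norm_nonneg _) hβ.le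
  set σ := ζ + β * (G * N) * ε with hσ
  have hσ0 : 0 ≤ σ := by positivity
  have hus : ∀ y ∈ ρ.support, y ∈ Icc x (x + T) → ‖u y‖ ≤ σ := by
    intro y hy hyx
    obtain ⟨y', hy', huy'⟩ := hR y hy (by
      have := abs_sub_abs_le_abs_sub t y
      have h2 : |t - y| ≤ T := by rw [abs_le]; constructor <;> linarith [hyx.1, hyx.2]
      linarith)
    have h3 := abs_lt.1 hy'
    have h1 := hlip y' ⟨by linarith [hyx.1], by linarith [hyx.2]⟩ y
      ⟨by linarith [hyx.1], by linarith [hyx.2]⟩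
    have h2 := norm_add_le (u y') (u y - u y')
    rw [add_sub_cancel] at h2
    rw [abs_sub_comm] at h1
    have h4 := mul_le_mul_of_nonneg_left hy'.le (by positivity : 0 ≤ β * (G * N))
    linarith
  have hae : ∀ᵐ y ∂(μ.variation + ρ), y ∈ ρ.support := by
    rw [ae_add_measure_iff]
    exact ⟨mem_of_superset (Measure.support_mem_ae (μ := μ.variation)) hsupp,
      Measure.support_mem_ae⟩
  have hw : ∀ s ∈ Icc x (x + T), ‖w s - w x‖ ≤ κ * σ * Λ' := by
    intro s hs
    have e := h.right_sub_eq x s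
    simp only [Pi.zero_apply, intervalIntegral.integral_zero, add_zero] at e
    have hmeas : (μ.variation + ρ) (Ioc x s) ≤ ENNReal.ofReal Λ' := by
      refine (measure_mono (Ioc_subset_Ioc_right ?_)).trans
        (measure_Ioc_add_natCast_le hΛ hν ⌈T⌉₊ x)
      linarith [hs.2, Nat.le_ceil T]
    rw [e, intervalIntegral.integral_of_le hs.1]
    refine (norm_setIntegral_le_of_norm_le_const_ae (C := κ * σ)
      (hmeas.trans_lt ENNReal.ofReal_lt_top) ?_).trans ?_
    · filter_upwards [ae_restrict_of_ae hae, ae_restrict_mem measurableSet_Ioc] with y hy hyx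
      rw [norm_mul]
      exact mul_le_mul (hk.norm_le y) (hus y hy ⟨hyx.1.le, hyx.2.trans hs.2⟩) (norm_nonneg _) hκ
    · exact mul_le_mul_of_nonneg_left (ENNReal.toReal_le_of_le_ofReal hΛ' hmeas) (by positivity)
  -- `u' = b w` and the smallness of `u` at the two ends of a period show that `w` is small at `x`
  have hux := hus x hxs ⟨le_rfl, by linarith⟩
  have huT := hus _ hxs' ⟨by linarith, le_rfl⟩
  have hbl : LocallyIntegrable b volume := locallyIntegrable_of_bound hbm.aestronglyMeasurable
    fun _ _ => ⟨β, hβ.le, fun y _ => hb y⟩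
  have hbl' : LocallyIntegrable (fun y => (b y : 𝕜)) volume :=
    locallyIntegrable_of_bound (RCLike.measurable_ofReal.comp hbm).aestronglyMeasurable
      fun _ _ => ⟨β, hβ.le, fun y _ => by rw [RCLike.norm_ofReal]; exact hb y⟩
  have hbint : b₀ * T ≤ ∫ y in x..x + T, b y := by
    have := intervalIntegral.integral_mono_on (a := x) (b := x + T) (μ := volume)
      (f := fun _ => b₀) (g := b) (by linarith) (by simp)
      (intervalIntegrable_of_locallyIntegrable hbl _ _) fun y _ => hbb y
    simpa [mul_comm] using this
  have hsplit : ((∫ y in x..x + T, b y : ℝ) : 𝕜) * w x =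
      u (x + T) - u x - ∫ y in x..x + T, (b y : 𝕜) * (w y - w x) := by
    rw [hud.sub_eq]
    simp_rw [mul_sub]
    rw [intervalIntegral.integral_sub (hud.intervalIntegrable _ _)
      ((intervalIntegrable_of_locallyIntegrable hbl' _ _).mul_const _),
      intervalIntegral.integral_mul_const, intervalIntegral.integral_of_le (by linarith),
      intervalIntegral.integral_of_le (by linarith), intervalIntegral.integral_of_le (by linarith),
      integral_ofReal]
    ring
  have hwx : b₀ * T * ‖w x‖ ≤ 2 * σ + β * (κ * σ * Λ') * T := by
    have h1 : ‖∫ y in x..x + T, (b y : 𝕜) * (w y - w x)‖ ≤ β * (κ * σ * Λ') * |x + T - x| := by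
      refine intervalIntegral.norm_integral_le_of_norm_le_const fun y hy => ?_
      rw [uIoc_of_le (by linarith)] at hy
      rw [norm_mul, RCLike.norm_ofReal]
      exact mul_le_mul (hb y) (hw y ⟨hy.1.le, hy.2⟩) (norm_nonneg _) hβ.le
    rw [add_sub_cancel_left, abs_of_pos hT] at h1
    have h2 := congrArg norm hsplit
    rw [norm_mul, RCLike.norm_ofReal, abs_of_nonneg (le_trans (by positivity) hbint)] at h2
    have h3 := norm_sub_le (u (x + T) - u x) (∫ y in x..x + T, (b y : 𝕜) * (w y - w x))
    have h4 := norm_sub_le (u (x + T)) (u x)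
    have h5 := mul_le_mul_of_nonneg_right hbint (norm_nonneg (w x))
    linarith
  have hNC : N ≤ C * σ := by
    have h1 : ‖w x‖ ≤ (2 * σ + β * (κ * σ * Λ') * T) / (b₀ * T) := by
      rw [le_div_iff₀ (by positivity)]; linarith
    have h2 : C * σ = σ + (2 * σ + β * (κ * σ * Λ') * T) / (b₀ * T) := by
      rw [hC]; ring
    linarith
  have hN2 : N ≤ 2 * C * ζ := by
    have h1 : C * (β * G * ε) * N ≤ 1 / 2 * N := mul_le_mul_of_nonneg_right hε2 hN0
    have h2 : C * σ = C * ζ + C * (β * G * ε) * N := by rw [hσ]; ring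
    linarith
  refine (hgrow' t ⟨by linarith, by linarith⟩).trans ((mul_le_mul_of_nonneg_left hN2 hG.le).trans ?_)
  refine le_of_eq ?_
  simp only [ζ]
  field_simp

end SturmLiouville

/-! ### Absence of eigenvalues under the Gordon condition -/

namespace SturmLiouville

variable {𝕜 : Type*} [RCLike 𝕜] {ρ : Measure ℝ}

theorem exists_ae_abs_le_of_memLp_top {f : ℝ → ℝ} (hf : MemLp f ∞ volume) :
    ∃ B : ℝ, 0 ≤ B ∧ ∀ᵐ x, |f x| ≤ B := by
  refine ⟨(eLpNorm f ∞ volume).toReal, ENNReal.toReal_nonneg, ?_⟩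
  filter_upwards [enorm_ae_le_eLpNormEssSup f volume] with x hx
  rw [← eLpNorm_exponent_top] at hx
  have := ENNReal.toReal_mono hf.2.ne hx
  rwa [toReal_enorm, Real.norm_eq_abs] at this

/-- The reciprocal of an admissible coefficient `a` agrees almost everywhere with a measurable
function that is bounded above and bounded away from `0` everywhere. -/
theorem Admissible.exists_reciprocal {a : ℝ → ℝ} {μ : LocalMeasure} (h : Admissible ρ a μ) :
    ∃ (b : ℝ → ℝ) (b₀ β : ℝ), Measurable b ∧ 0 < b₀ ∧ (∀ x, b₀ ≤ b x) ∧ (∀ x, |b x| ≤ β) ∧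
      b =ᵐ[volume] fun x => (a x)⁻¹ := by
  obtain ⟨B, hB, hBa⟩ := exists_ae_abs_le_of_memLp_top h.memLp
  obtain ⟨β, hβ, hβa⟩ := exists_ae_abs_le_of_memLp_top h.memLp_inv
  obtain ⟨f, hfm, hf⟩ := h.memLp_inv.1.aemeasurable
  have hb₀ : (0 : ℝ) < 1 / (B + 1) := by positivity
  refine ⟨fun x => max (1 / (B + 1)) (min β (f x)), 1 / (B + 1), max (1 / (B + 1)) β,
    measurable_const.max (measurable_const.min hfm), hb₀, fun x => le_max_left _ _, fun x => ?_, ?_⟩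
  · rw [abs_of_pos (hb₀.trans_le (le_max_left _ _))]
    exact max_le_max le_rfl (min_le_left _ _)
  · filter_upwards [hBa, hβa, hf, h.ne_zero] with x h1 h2 h3 h4
    have hpos : 0 < a x := lt_of_le_of_ne (h.nonneg x) (Ne.symm h4)
    rw [abs_of_pos hpos] at h1
    rw [abs_of_pos (inv_pos.2 hpos)] at h2
    rw [← h3, min_eq_right h2, max_eq_right]
    rw [one_div]
    exact inv_anti₀ hpos (by linarith)

/-- The `L_1` bound for `a - a(· + r)` carries over to `b = 1 / a`. -/
theorem integral_abs_shift_sub_le {a b : ℝ → ℝ} {β r ε : ℝ} (hε : 0 ≤ ε)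
    (hb : ∀ x, |b x| ≤ β) (hbm : Measurable b) (ha : ∀ᵐ x, a x ≠ 0)
    (hab : b =ᵐ[volume] fun x => (a x)⁻¹)
    (h : eLpNorm (fun x => a x - a (x + r)) 1 (volume.restrict (Ioo (-r) r)) ≤ ENNReal.ofReal ε) :
    ∫ x in Ioc (-r) r, |b (x + r) - b x| ≤ β ^ 2 * ε := by
  have hβ : 0 ≤ β := (abs_nonneg _).trans (hb 0)
  have hshift : ∀ {P : ℝ → Prop}, (∀ᵐ x, P x) → ∀ᵐ x, P (x + r) := fun hP =>
    (measurePreserving_add_right volume r).quasiMeasurePreserving.ae hP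
  have hle : ∀ᵐ x, ‖b (x + r) - b x‖ₑ ≤ ENNReal.ofReal (β ^ 2) * ‖a x - a (x + r)‖ₑ := by
    filter_upwards [hab, hshift hab, ha, hshift ha] with x h1 h2 h3 h4
    have e : b (x + r) - b x = b x * b (x + r) * (a x - a (x + r)) := by
      rw [h1, h2]
      field_simp
    rw [e, enorm_mul]
    refine mul_le_mul_left ?_ _
    rw [Real.enorm_eq_ofReal_abs, abs_mul, sq]
    exact ENNReal.ofReal_le_ofReal (mul_le_mul (hb _) (hb _) (abs_nonneg _) hβ)
  rw [integral_Ioc_eq_integral_Ioo]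
  rw [← ENNReal.ofReal_le_ofReal_iff (by positivity)]
  have h1 := ofReal_integral_norm_eq_lintegral_enorm
    (f := fun x => b (x + r) - b x) (μ := volume.restrict (Ioo (-r) r)) (by
    have := integrableOn_of_bound ((hbm.comp (measurable_add_const r)).sub hbm)
      (fun _ _ => ⟨2 * β, by positivity, fun t _ => by
        have := abs_sub (b (t + r)) (b t)
        simp only [Function.comp_apply, Pi.sub_apply]
        linarith [hb (t + r), hb t]⟩) (-r) r
    exact this.mono_set Ioo_subset_Ioc_self)
  simp only [Real.norm_eq_abs] at h1
  rw [h1, ENNReal.ofReal_mul (by positivity)]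
  refine (lintegral_mono_ae (ae_restrict_of_ae hle)).trans ?_
  rw [lintegral_const_mul' _ _ ENNReal.ofReal_ne_top, ← eLpNorm_one_eq_lintegral_enorm]
  exact mul_le_mul_right h _

/-- The defect of periodicity is bounded pointwise by its `L_1` norm and the local bound for
`|μ|`. -/
theorem abs_defect_le {μ : LocalMeasure} {Λ : ℝ} (hΛ : 0 ≤ Λ)
    (hμ : ∀ t, μ.variation (Ioc t (t + 1)) ≤ ENNReal.ofReal Λ) {r c : ℝ} (hr : 1 ≤ r) {t : ℝ}
    (ht : t ∈ Icc (-r) r) :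
    |defect μ r c t| ≤ (∫ x in Ioc (-r) r, |defect μ r c x|) + 2 * Λ := by
  have hcdf : ∀ x y, |x - y| ≤ 1 → |μ.cdf x - μ.cdf y| ≤ Λ := by
    intro x y hxy
    refine (μ.abs_cdf_sub_le y x).trans (ENNReal.toReal_le_of_le_ofReal hΛ
      ((measure_mono ?_).trans (hμ (min y x))))
    refine Ioc_subset_Ioc_right ?_
    have := max_sub_min_eq_abs' y x
    rw [abs_sub_comm] at this
    linarith
  have hdef : ∀ x, |t - x| ≤ 1 → |defect μ r c t| ≤ |defect μ r c x| + 2 * Λ := by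
    intro x hx
    have e : defect μ r c t = defect μ r c x + ((μ.cdf t - μ.cdf x) -
        (μ.cdf (t + r) - μ.cdf (x + r))) := by
      simp only [defect]; ring
    have h1 := hcdf t x hx
    have h2 := hcdf (t + r) (x + r) (by rwa [add_sub_add_right_eq_sub])
    rw [e]
    have h3 := abs_add_le (defect μ r c x) ((μ.cdf t - μ.cdf x) - (μ.cdf (t + r) - μ.cdf (x + r)))
    have h4 := abs_sub (μ.cdf t - μ.cdf x) (μ.cdf (t + r) - μ.cdf (x + r))
    linarith
  -- average over a unit interval in `[-r, r]` that contains `t`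
  obtain ⟨s, hs1, hs2, hs3⟩ : ∃ s, -r ≤ s ∧ s + 1 ≤ r ∧ t ∈ Icc s (s + 1) := by
    rcases le_total (-r) (t - 1) with h | h
    · exact ⟨t - 1, h, by linarith [ht.2], by linarith, by linarith⟩
    · exact ⟨-r, le_rfl, by linarith, ht.1, by linarith⟩
  have hi := integrableOn_abs_defect μ r c
  have h1 : ∫ x in Ioc s (s + 1), |defect μ r c t| ≤
      ∫ x in Ioc s (s + 1), (|defect μ r c x| + 2 * Λ) := by
    refine setIntegral_mono_on (integrable_const _) ((hi _ _).add (integrable_const _)) measurableSet_Ioc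
      fun x hx => hdef x ?_
    rw [abs_le]
    constructor <;> linarith [hs3.1, hs3.2, hx.1, hx.2]
  rw [integral_add (hi _ _) (integrable_const _)] at h1
  simp only [setIntegral_const, Real.volume_real_Ioc, smul_eq_mul, add_sub_cancel_left,
    zero_le_one, sup_of_le_left, one_mul] at h1
  have h2 : ∫ x in Ioc s (s + 1), |defect μ r c x| ≤ ∫ x in Ioc (-r) r, |defect μ r c x| :=
    setIntegral_mono_set (hi _ _) (Eventually.of_forall fun _ => abs_nonneg _)
      (Ioc_subset_Ioc hs1 hs2).eventuallyLE
  linarith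

theorem le_ofReal_of_exp_mul_le {E : ℝ≥0∞} {x ε : ℝ}
    (h : ENNReal.ofReal (Real.exp x) * E ≤ ENNReal.ofReal ε) :
    E ≤ ENNReal.ofReal (ε * Real.exp (-x)) := by
  have h1 := mul_le_mul_right h (ENNReal.ofReal (Real.exp (-x)))
  rw [← mul_assoc, ← ENNReal.ofReal_mul (Real.exp_pos _).le, ← Real.exp_add, neg_add_cancel,
    Real.exp_zero, ENNReal.ofReal_one, one_mul, ← ENNReal.ofReal_mul (Real.exp_pos _).le] at h1
  rwa [mul_comm ε]

/-- Absence of eigenvalues under the weak Gordon condition for all weights. -/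
theorem not_isEigenvalue_of_gordon [IsLocallyFiniteMeasure ρ] (hρ0 : ρ ≠ 0)
    (hunif : unifNorm ρ < ∞) (hper : (periods ρ).Nonempty) {p : ℝ≥0∞} (hp0 : p ≠ 0) (hp : p ≠ ∞)
    {a : ℝ → ℝ} {μ : LocalMeasure} (hadm : Admissible ρ a μ)
    (hG : GordonForAllWeights ρ a μ) (z : 𝕜) : ¬ IsEigenvalue p ρ a μ z := by
  intro hz
  obtain ⟨b, b₀, β, hbm, hb₀, hbb, hb, hab⟩ := hadm.exists_reciprocal
  have hβ : 0 ≤ β := (abs_nonneg _).trans (hb 0)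
  obtain ⟨k, hk⟩ := exists_isChargeDensity μ ρ z
  obtain ⟨u, w, h, hup, hu0⟩ := exists_solution_of_isEigenvalue hadm.ne_zero hab hk hz
  set Λ := (unifNorm μ.variation + unifNorm ρ).toReal
  have hΛ : 0 ≤ Λ := ENNReal.toReal_nonneg
  have hΛ' : ENNReal.ofReal Λ = unifNorm μ.variation + unifNorm ρ :=
    ENNReal.ofReal_toReal (ENNReal.add_lt_top.2 ⟨hadm.unif, hunif⟩).ne
  have hle : ∀ (m : Measure ℝ) (t : ℝ), m (Ioc t (t + 1)) ≤ unifNorm m := fun m t =>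
    le_iSup (fun t => m (Ioc t (t + 1))) t
  have hν : ∀ t, (μ.variation + ρ) (Ioc t (t + 1)) ≤ ENNReal.ofReal Λ := fun t => by
    rw [hΛ']; exact add_le_add (hle _ t) (hle _ t)
  have hμΛ : ∀ t, μ.variation (Ioc t (t + 1)) ≤ ENNReal.ofReal Λ := fun t =>
    le_trans (Measure.le_add_right le_rfl _) (hν t)
  obtain ⟨A, γ, hA, hγ, hgrow'⟩ := exists_growth_bound 𝕜 β (2 + ‖z‖) Λ
  have hgrow : ∀ u w f g : ℝ → 𝕜,
      ApproxSolution (μ.variation + ρ) (fun x => (b x : 𝕜)) k u w f g →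
      ∀ s t δ : ℝ, 0 ≤ δ → ∫ x in uIoc s t, ‖f x‖ ≤ δ → ∫ x in uIoc s t, ‖g x‖ ≤ δ →
      ‖u t‖ + ‖w t‖ ≤ A * Real.exp (γ * |t - s|) * (‖u s‖ + ‖w s‖ + δ) :=
    fun u w f g h => hgrow' _ _ _ u w f g h
      (fun x => by rw [RCLike.norm_ofReal]; exact hb x) hk.norm_le hν
  have hgrow0 : ∀ s t : ℝ,
      ‖u t‖ + ‖w t‖ ≤ A * Real.exp (γ * |t - s|) * (‖u s‖ + ‖w s‖) := by
    intro s t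
    simpa using hgrow u w 0 0 h s t 0 le_rfl (by simp) (by simp)
  set N := ‖u 0‖ + ‖w 0‖ with hN
  have hN0 : 0 ≤ N := by positivity
  have hne : ¬ (u 0 = 0 ∧ w 0 = 0) := by
    rintro ⟨h1, h2⟩
    refine hu0 (Eventually.of_forall fun t => ?_)
    have := hgrow0 0 t
    rw [h1, h2, norm_zero, add_zero, mul_zero] at this
    exact norm_le_zero_iff.1 (by linarith [norm_nonneg (w t)])
  have hNpos : 0 < N := by
    refine lt_of_le_of_ne hN0 fun h0 => hne ?_
    have h1 := norm_nonneg (u 0)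
    have h2 := norm_nonneg (w 0)
    exact ⟨norm_le_zero_iff.1 (by linarith), norm_le_zero_iff.1 (by linarith)⟩
  obtain ⟨K, hK₀, hK⟩ := exists_almost_multiple hne
  set P := 1 + 2 * Λ with hP
  have hP0 : 0 ≤ P := by positivity
  set Cst := (1 + P) * ((1 + P) + 2 * (K * (1 + P)) +
    A * ((2 * K * (A * N) + 2) * (A * N * (β ^ 2 + 16 * β)))) with hCst
  have hCst0 : 0 ≤ Cst := by positivity
  suffices key : ∀ η : ℝ, 0 < η → η ≤ 1 → N ≤ Cst * η by
    have h1 := key (min 1 (N / (2 * (Cst + 1)))) (lt_min one_pos (by positivity)) (min_le_left _ _)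
    have h2 : min 1 (N / (2 * (Cst + 1))) ≤ N / (2 * (Cst + 1)) := min_le_right _ _
    have h3 := h1.trans (mul_le_mul_of_nonneg_left h2 hCst0)
    rw [mul_div_assoc', le_div_iff₀ (by positivity)] at h3
    nlinarith
  intro η hη hη1
  -- the error in the Gordon estimate grows like `exp (γ r) M ^ 2` with `M` of size `exp (2 γ r)`;
  -- this accounts for `5 γ`, and the summand `2` absorbs the polynomial factors from the seminorm
  obtain ⟨r, hrper, hrpos, hrtop, hrlim⟩ := hG (5 * γ + 2) (by linarith)
  obtain ⟨R, hR⟩ := exists_forall_norm_le hρ0 hper hadm.support_subset hk hb hb₀ hbb hbm h hΛ hν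
    (by linarith) (by linarith) hgrow0 hp0 hp hup hη
  obtain ⟨m, hm1, hm2⟩ := ((hrlim.eventually_le_const (u := ENNReal.ofReal (η / 16))
    (ENNReal.ofReal_pos.2 (by positivity))).and (hrtop.eventually_ge_atTop (max R 1))).exists
  have hr := hrpos m
  set s := r m
  have hsR : R ≤ s := (le_max_left _ _).trans hm2
  have hs1 : 1 ≤ s := (le_max_right _ _).trans hm2
  set ε := η / 16 * Real.exp (-((5 * γ + 2) * s)) with hε
  have hε0 : 0 ≤ ε := by positivity
  have hab_le := integral_abs_shift_sub_le hε0 hb hbm hadm.ne_zero hab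
    (le_ofReal_of_exp_mul_le ((mul_le_mul_right le_self_add _).trans hm1))
  obtain ⟨c, hc⟩ := exists_const_integral_abs_cdf_sub_le μ s hr hε0
    (le_ofReal_of_exp_mul_le ((mul_le_mul_right le_add_self _).trans hm1))
  rw [intervalIntegral.integral_of_le (by linarith)] at hc
  change ∫ x in Ioc (-s) s, |defect μ s c x| ≤ _ at hc
  have hpoly : 2 * ((2 * s + 2) * ((4 * s + 1) * ε)) ≤ 16 * (Real.exp (2 * s) * ε) := by
    have h1 : s + 1 ≤ Real.exp s := Real.add_one_le_exp s
    have h2 : (s + 1) * (s + 1) ≤ Real.exp s * Real.exp s :=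
      mul_le_mul h1 h1 (by linarith) (Real.exp_pos _).le
    rw [← Real.exp_add, ← two_mul] at h2
    have h3 : 2 * ((2 * s + 2) * (4 * s + 1)) ≤ 16 * Real.exp (2 * s) := by nlinarith
    have := mul_le_mul_of_nonneg_right h3 hε0
    linarith
  have hexp : Real.exp (2 * s) * ε = η / 16 * Real.exp (-(5 * γ * s)) := by
    rw [hε, mul_left_comm, ← Real.exp_add]
    congr 2
    ring
  have hexp1 : Real.exp (-(5 * γ * s)) ≤ 1 := Real.exp_le_one_iff.2 (by
    have : 0 ≤ 5 * γ * s := by positivity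
    linarith)
  have hφ1 : ∫ x in Ioc (-s) s, |defect μ s c x| ≤ η * Real.exp (-(5 * γ * s)) := by
    rw [hexp] at hpoly
    linarith
  have hφ2 : ∫ x in Ioc (-s) s, |defect μ s c x| ≤ 1 := by
    have := mul_le_mul hη1 hexp1 (Real.exp_pos _).le zero_le_one
    linarith
  have hεle : ε ≤ η * Real.exp (-(5 * γ * s)) := by
    have h1 : (1 : ℝ) ≤ Real.exp (2 * s) := Real.one_le_exp (by linarith)
    have h2 : ε ≤ Real.exp (2 * s) * ε := le_mul_of_one_le_left hε0 h1
    have h3 : 0 ≤ η * Real.exp (-(5 * γ * s)) := by positivity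
    linarith
  set D := (β ^ 2 + 16 * β) * (η * Real.exp (-(5 * γ * s))) with hD
  have hDle : (∫ x in Ioc (-s) s, |b (x + s) - b x|) + β * ∫ x in Ioc (-s) s, |defect μ s c x| ≤
      D := by
    have h1 := mul_le_mul_of_nonneg_left hεle (sq_nonneg β)
    have h2 := mul_le_mul_of_nonneg_left hφ1 hβ
    have h3 : 0 ≤ β * (η * Real.exp (-(5 * γ * s))) := by positivity
    rw [hD]
    linarith
  set M := A * Real.exp (γ * (2 * s)) * N with hM
  have hMle : ∀ x ∈ Icc (-(2 * s)) (2 * s), ‖u x‖ + ‖w x‖ ≤ M := by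
    intro x hx
    refine (hgrow0 0 x).trans (mul_le_mul_of_nonneg_right ?_ hN0)
    refine mul_le_mul_of_nonneg_left (Real.exp_le_exp.2 (mul_le_mul_of_nonneg_left ?_
      (by linarith))) (by linarith)
    rw [sub_zero]
    exact abs_le.2 hx
  have hPle : ∀ x ∈ ({-s, 0, s} : Set ℝ), |defect μ s c x| ≤ P := by
    intro x hx
    have hx' : x ∈ Icc (-s) s := by
      rcases hx with rfl | rfl | rfl
      · exact ⟨le_rfl, by linarith⟩
      · exact ⟨by linarith, hr.le⟩
      · exact ⟨by linarith, le_rfl⟩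
    refine (abs_defect_le hΛ hμΛ hs1 hx').trans ?_
    rw [hP]
    linarith
  have hfin := gordon_estimate hk hb hbm h hr (hrper m).2 c (by linarith) hgrow hK₀ hK hMle hDle hPle
  have n1 := hR (2 * s) (by rw [abs_of_pos (by linarith)]; linarith)
  have n2 := hR s (by rw [abs_of_pos hr]; linarith)
  have n3 := hR (-s) (by rw [abs_neg, abs_of_pos hr]; linarith)
  refine hfin.trans ?_
  rw [hCst, mul_assoc (1 + P)]
  refine mul_le_mul_of_nonneg_left ?_ (by positivity)
  have t1 : (1 + P) * (‖u (2 * s)‖ + ‖w (2 * s)‖) ≤ (1 + P) * η :=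
    mul_le_mul_of_nonneg_left n1 (by positivity)
  have t2 : K * (1 + P) * (‖u s‖ + ‖w s‖ + (‖u (-s)‖ + ‖w (-s)‖)) * (‖u s‖ + ‖w s‖) ≤
      2 * (K * (1 + P)) * η := by
    have h1 : (‖u s‖ + ‖w s‖ + (‖u (-s)‖ + ‖w (-s)‖)) * (‖u s‖ + ‖w s‖) ≤ 2 * η :=
      (mul_le_mul (add_le_add n2 n3) (n2.trans hη1) (by positivity) (by positivity)).trans
        (by linarith)
    have := mul_le_mul_of_nonneg_left h1 (by positivity : 0 ≤ K * (1 + P))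
    linarith
  have t3 : A * Real.exp (γ * s) * ((2 * K * M + 2) * (M * D)) ≤
      A * ((2 * K * (A * N) + 2) * (A * N * (β ^ 2 + 16 * β))) * η := by
    have h1 : (1 : ℝ) ≤ Real.exp (γ * (2 * s)) := Real.one_le_exp (by positivity)
    have h2 : 2 * K * M + 2 ≤ (2 * K * (A * N) + 2) * Real.exp (γ * (2 * s)) := by
      rw [hM]
      linarith
    have hD0 : 0 ≤ D := by positivity
    have hM0 : 0 ≤ M := by positivity
    have h3 := mul_le_mul_of_nonneg_right h2 (mul_nonneg hM0 hD0)
    have h4 := mul_le_mul_of_nonneg_left h3 (by positivity : 0 ≤ A * Real.exp (γ * s))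
    refine h4.trans (le_of_eq ?_)
    have h5 : Real.exp (γ * s) * Real.exp (γ * (2 * s)) * Real.exp (γ * (2 * s)) *
        Real.exp (-(5 * γ * s)) = 1 := by
      rw [← Real.exp_add, ← Real.exp_add, ← Real.exp_add, ← Real.exp_zero]
      congr 1
      ring
    rw [hM, hD]
    linear_combination (A * ((2 * K * (A * N) + 2) * (A * N * (β ^ 2 + 16 * β))) * η) * h5
  linarith

end SturmLiouville

/-! ### Periods, translations and Liouville approximations -/

namespace LocalMeasure

variable {μ : LocalMeasure}

/-- A translation by a period can be split off. -/
theorem Periodic.translate_add {r : ℝ} (h : μ.Periodic r) (s : ℝ) {B : Set ℝ} (hB : MeasurableSet B)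
    (hb : Bornology.IsBounded B) : μ.translate (s + r) B = μ.translate s B := by
  have h1 := h ((fun x => x - s) ⁻¹' B) ((by fun_prop : Measurable fun x : ℝ => x - s) hB)
    (isBounded_preimage_sub hb s)
  refine Eq.trans ?_ h1
  change μ _ = μ _
  congr 1
  ext x
  simp only [mem_preimage]
  rw [sub_sub, add_comm s]

theorem Periodic.nat_mul {r : ℝ} (h : μ.Periodic r) (n : ℕ) : μ.Periodic (n * r) := by
  induction n with
  | zero =>
    intro B _ _
    change μ _ = μ _
    congr 1
    ext x
    simp
  | succ n ih =>
    intro B hB hb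
    rw [Nat.cast_succ, add_one_mul, h.translate_add _ hB hb, ih B hB hb]

end LocalMeasure

namespace SturmLiouville

variable {ρ : Measure ℝ}

theorem nat_mul_mem_periods {τ : ℝ} (hτ : τ ∈ periods ρ) {n : ℕ} (hn : 0 < n) :
    n * τ ∈ periods ρ := by
  refine ⟨mul_ne_zero (Nat.cast_ne_zero.2 hn.ne') hτ.1, ?_⟩
  clear hn
  induction n with
  | zero => simp
  | succ n ih =>
    have : (fun x : ℝ => x - (n + 1 : ℕ) * τ) = (fun x => x - τ) ∘ fun x => x - n * τ := by
      funext x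
      simp only [Function.comp_apply]
      push_cast
      ring
    rw [this, ← Measure.map_map (by fun_prop) (by fun_prop), ih, hτ.2]

theorem Admissible.add {a₁ a₂ : ℝ → ℝ} {μ₁ μ₂ : LocalMeasure} (h₁ : Admissible ρ a₁ μ₁)
    (h₂ : Admissible ρ a₂ μ₂) : Admissible ρ (a₁ + a₂) (μ₁ + μ₂) where
  nonneg x := add_nonneg (h₁.nonneg x) (h₂.nonneg x)
  memLp := h₁.memLp.add h₂.memLp
  ne_zero := by
    filter_upwards [h₁.ne_zero] with x hx
    have := lt_of_le_of_ne (h₁.nonneg x) (Ne.symm hx)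
    exact (add_pos_of_pos_of_nonneg this (h₂.nonneg x)).ne'
  memLp_inv := by
    refine h₁.memLp_inv.of_le (h₁.memLp.add h₂.memLp).1.aemeasurable.inv.aestronglyMeasurable ?_
    filter_upwards [h₁.ne_zero] with x hx
    have h := lt_of_le_of_ne (h₁.nonneg x) (Ne.symm hx)
    have h' := add_pos_of_pos_of_nonneg h (h₂.nonneg x)
    simp only [Pi.add_apply, norm_inv, Real.norm_eq_abs]
    rw [abs_of_pos h, abs_of_pos h']
    exact inv_anti₀ h (le_add_of_nonneg_right (h₂.nonneg x))
  unif := by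
    refine lt_of_le_of_lt (iSup_le fun t => ?_) (ENNReal.add_lt_top.2 ⟨h₁.unif, h₂.unif⟩)
    refine (LocalMeasure.variation_add_le μ₁ μ₂ _).trans (add_le_add ?_ ?_)
    · exact le_iSup (fun t => μ₁.variation (Ioc t (t + 1))) t
    · exact le_iSup (fun t => μ₂.variation (Ioc t (t + 1))) t
  support_subset := by
    refine (Measure.support_mono (LocalMeasure.variation_add_le μ₁ μ₂)).trans ?_
    rw [Measure.support_add]
    exact union_subset h₁.support_subset h₂.support_subset

theorem abs_integral_le_of_abs_le (μ : LocalMeasure) {Λ : ℝ} (hΛ : 0 ≤ Λ)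
    (hμ : ∀ t, μ.variation (Ioc t (t + 1)) ≤ ENNReal.ofReal Λ) {f : ℝ → ℝ} {C : ℝ} (hC : 0 ≤ C)
    (hf : ∀ x, |f x| ≤ C) {t : ℝ} {n : ℕ} (hsupp : ∀ x, x ∉ Ioc t (t + n) → f x = 0) :
    |μ.integral f| ≤ C * (n * Λ) := by
  have key : ∀ (m : Measure ℝ) [IsLocallyFiniteMeasure m],
      |∫ x, f x ∂m| ≤ C * m.real (Ioc t (t + n)) := by
    intro m _
    rw [← setIntegral_eq_integral_of_forall_compl_eq_zero hsupp]
    exact norm_setIntegral_le_of_norm_le_const (f := f) measure_Ioc_lt_top fun x _ => hf x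
  refine (abs_sub _ _).trans ((add_le_add (key _) (key _)).trans ?_)
  rw [← mul_add]
  refine mul_le_mul_of_nonneg_left ?_ hC
  have h := ENNReal.toReal_le_of_le_ofReal (by positivity) (measure_Ioc_add_natCast_le hΛ hμ n t)
  rwa [LocalMeasure.variation, ← measureReal_def,
    measureReal_add_apply measure_Ioc_lt_top.ne measure_Ioc_lt_top.ne] at h

theorem HasDensity.abs_sub_le {v v' : ℝ → ℝ} (hv : HasDensity volume v v')
    (hv' : ∀ᵐ x, |v' x| ≤ 1) (s t : ℝ) : |v t - v s| ≤ |t - s| := by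
  rw [hv.sub_eq, ← one_mul |t - s|]
  exact intervalIntegral.norm_integral_le_of_norm_le_const_ae (f := v') (hv'.mono fun x hx _ => hx)

/-- In the weak seminorm, a local measure is Lipschitz continuous under translations. -/
theorem wNorm_le_of_translate {η μ : LocalMeasure} {s : ℝ} (hs : |s| ≤ 1)
    (hη : ∀ B, MeasurableSet B → Bornology.IsBounded B → (μ - μ.translate s) B = η B) {Λ : ℝ}
    (hΛ : 0 ≤ Λ) (hμ : ∀ t, μ.variation (Ioc t (t + 1)) ≤ ENNReal.ofReal Λ) (I : Set ℝ) :
    wNorm η I ≤ ENNReal.ofReal (7 * Λ * |s|) := by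
  have := LocalMeasure.isLocallyFiniteMeasure_map_sub μ.posPart s
  have := LocalMeasure.isLocallyFiniteMeasure_map_sub μ.negPart s
  refine iSup₂_le fun v hv => ?_
  obtain ⟨-, hdiam, v', hd, hv'⟩ := hv
  have hvc := hd.continuous
  obtain ⟨x₀, hx₀⟩ : ∃ x₀, tsupport v ⊆ Icc (x₀ - 2) (x₀ + 2) := by
    rcases (tsupport v).eq_empty_or_nonempty with h | ⟨x₀, hx₀⟩
    · exact ⟨0, by simp [h]⟩
    · refine ⟨x₀, fun y hy => ?_⟩
      have := (Metric.edist_le_ediam_of_mem hy hx₀).trans hdiam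
      rw [edist_dist, ← ENNReal.ofReal_ofNat, ENNReal.ofReal_le_ofReal_iff (by norm_num),
        Real.dist_eq, abs_le] at this
      exact ⟨by linarith [this.1], by linarith [this.2]⟩
  have hc := hasCompactSupport_of_tsupport_subset_Icc hx₀
  have hcs : HasCompactSupport fun x => v (x - s) := by
    simpa [Function.comp_def, sub_eq_add_neg] using hc.comp_homeomorph (Homeomorph.addRight (-s))
  have hdiff := μ.isDifference_posPart_negPart.sub (μ.isDifference_posPart_negPart.translate s)
  have e1 : η.integral v = (μ - μ.translate s).integral v := by
    rw [hdiff.integral_eq hvc hc, (LocalMeasure.isDifference_congr hη hdiff).integral_eq hvc hc]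
  have hi : ∀ (m : Measure ℝ) [IsLocallyFiniteMeasure m], Integrable v m ∧
      Integrable (fun x => v (x - s)) m := fun m _ =>
    ⟨hvc.integrable_of_hasCompactSupport hc, (hvc.comp (by fun_prop :
      Continuous fun x : ℝ => x - s)).integrable_of_hasCompactSupport hcs⟩
  have e2 : η.integral v = μ.integral fun x => v x - v (x - s) := by
    rw [e1, μ.integral_sub_translate s hvc hc]
    simp only [LocalMeasure.integral]
    rw [integral_sub (hi _).1 (hi _).2, integral_sub (hi _).1 (hi _).2]
    ring
  have hs' := abs_le.1 hs
  -- `v` and its translate by `s` vanish outside `[x₀ - 3, x₀ + 3]`, which `7` unit intervals cover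
  have h := abs_integral_le_of_abs_le μ hΛ hμ (f := fun x => v x - v (x - s)) (C := |s|)
    (abs_nonneg _) (fun x => by simpa using hd.abs_sub_le hv' (x - s) x) (t := x₀ - 4) (n := 7)
    fun x hx => by
      rw [eq_zero_of_tsupport_subset hx₀, eq_zero_of_tsupport_subset hx₀, sub_zero]
      · exact fun h => hx ⟨by linarith [h.1], by push_cast; linarith [h.2]⟩
      · exact fun h => hx ⟨by linarith [h.1], by push_cast; linarith [h.2]⟩
  rw [e2, Real.enorm_eq_ofReal_abs]
  refine ENNReal.ofReal_le_ofReal (h.trans (le_of_eq ?_))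
  push_cast
  ring

theorem eLpNorm_shift_le {a₁ a₂ : ℝ → ℝ} {r s c β : ℝ} (hc : 0 ≤ c)
    (h₁ : ∀ x, a₁ (x + r) = a₁ x) (h₂ : ∀ x, a₂ (x + r) = a₂ (x + s))
    (hold : ∀ x y, |a₂ x - a₂ y| ≤ c * |x - y| ^ β) :
    eLpNorm (fun x => (a₁ + a₂) x - (a₁ + a₂) (x + r)) 1 (volume.restrict (Ioo (-r) r)) ≤
      ENNReal.ofReal (c * |s| ^ β * (2 * r)) := by
  rw [eLpNorm_one_eq_lintegral_enorm]
  have hle : ∀ x, ‖(a₁ + a₂) x - (a₁ + a₂) (x + r)‖ₑ ≤ ENNReal.ofReal (c * |s| ^ β) := by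
    intro x
    rw [Real.enorm_eq_ofReal_abs]
    refine ENNReal.ofReal_le_ofReal ?_
    have := hold x (x + s)
    rw [sub_add_cancel_left, abs_neg] at this
    simpa [h₁ x, h₂ x] using this
  refine (lintegral_mono hle).trans ?_
  rw [setLIntegral_const, Real.volume_Ioo, ← ENNReal.ofReal_mul (by positivity)]
  refine ENNReal.ofReal_le_ofReal (le_of_eq ?_)
  ring

/-- A strong Liouville number has rational approximations `n / q` with numerator and denominator
of comparable size, `q → ∞`, and a superexponentially small error. -/
theorem StrongLiouville.exists_approx {α : ℝ} (h : StrongLiouville α) (hα : 0 < α)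
    (hirr : Irrational α) :
    ∃ (B : ℝ) (n q : ℕ → ℕ), 0 < B ∧ Tendsto q atTop atTop ∧
      ∀ᶠ m : ℕ in atTop, 0 < q m ∧ α * q m ≤ 2 * n m ∧ (n m : ℝ) ≤ 2 * α * q m ∧
        |n m - q m * α| ≤ B * (2 / m) ^ q m := by
  obtain ⟨B, hB, num, den, hden, happ⟩ := h
  have hlim : Tendsto (fun m : ℕ => B / (m : ℝ)) atTop (𝓝 0) :=
    tendsto_const_div_atTop_nhds_zero_nat B
  have hle : ∀ m : ℕ, 1 ≤ m → |α - (num m : ℝ) / (den m : ℝ)| ≤ B / m := by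
    intro m hm
    refine (happ m hm).trans (div_le_div_of_nonneg_left hB.le (by positivity) ?_)
    have h1 : (1 : ℝ) ≤ m := by exact_mod_cast hm
    exact le_self_pow₀ h1 (hden m).ne'
  refine ⟨B, fun m => (num m).toNat, den, hB, ?_, ?_⟩
  · -- an irrational number keeps its distance from the fractions with bounded denominator
    refine tendsto_atTop.2 fun N => ?_
    obtain ⟨ε, hε, hirr'⟩ : ∃ ε : ℝ, 0 < ε ∧ ∀ k ≤ N, ∀ j : ℤ, ε ≤ dist α (j / k) := by
      have := (hirr.eventually_forall_le_dist_cast_div_of_denom_le N).filter_mono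
        (nhdsWithin_le_nhds (s := Ioi 0))
      obtain ⟨ε, h1, h2⟩ := (this.and self_mem_nhdsWithin).exists
      exact ⟨ε, h2, h1⟩
    filter_upwards [hlim.eventually_lt_const hε, eventually_ge_atTop 1] with m hm hm1
    by_contra! hcon
    have := hirr' (den m) hcon.le (num m)
    rw [Real.dist_eq] at this
    linarith [hle m hm1]
  · filter_upwards [hlim.eventually_lt_const (half_pos hα), eventually_ge_atTop 1] with m hm hm1
    have hq : (0 : ℝ) < den m := by exact_mod_cast hden m
    have h1 := abs_le.1 ((hle m hm1).trans hm.le)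
    have h2 : α / 2 ≤ (num m : ℝ) / den m := by linarith [h1.2]
    have h3 : (num m : ℝ) / den m ≤ 2 * α := by linarith [h1.1]
    rw [le_div_iff₀ hq] at h2
    rw [div_le_iff₀ hq] at h3
    have hpos : (0 : ℝ) < num m := lt_of_lt_of_le (by positivity) h2
    have hnum : (((num m).toNat : ℕ) : ℝ) = num m := by
      have : ((num m).toNat : ℤ) = num m := Int.toNat_of_nonneg (by exact_mod_cast hpos.le)
      exact_mod_cast this
    rw [hnum]
    refine ⟨hden m, by linarith, h3, ?_⟩
    have e : (num m : ℝ) - den m * α = -(den m * (α - num m / den m)) := by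
      field_simp
      ring
    rw [e, abs_neg, abs_mul, abs_of_pos hq]
    -- multiplying by the denominator costs the factor `q ≤ 2 ^ q`
    have h4 : (den m : ℝ) ≤ 2 ^ den m := by exact_mod_cast Nat.lt_two_pow_self.le
    calc (den m : ℝ) * |α - num m / den m| ≤ 2 ^ den m * (B / m ^ den m) :=
          mul_le_mul h4 (happ m hm1) (abs_nonneg _) (by positivity)
      _ = B * (2 / m) ^ den m := by rw [div_pow]; ring

end SturmLiouville

/-! ### Sums of periodic pairs -/

namespace SturmLiouville

variable {ρ : Measure ℝ}

/-- The sum of a `τ`-periodic and an `α τ`-periodic pair satisfies the weak Gordon condition for all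
weights if `α` is a strong Liouville number: if `n / q` approximates `α`, then a translation by
`n τ` does not change the first pair, and acts on the second one as the translation by the tiny
number `n τ - q α τ`. -/
theorem gordonForAllWeights_add {τ α : ℝ} (hτ : τ ∈ periods ρ) (hτ0 : 0 < τ) (hα : 0 < α)
    (hirr : Irrational α) (hL : StrongLiouville α) {a₁ a₂ : ℝ → ℝ} {μ₁ μ₂ : LocalMeasure}
    (h₂ : Admissible ρ a₂ μ₂) (ha₁ : Function.Periodic a₁ τ) (hμ₁ : μ₁.Periodic τ)
    (ha₂ : Function.Periodic a₂ (α * τ)) (hμ₂ : μ₂.Periodic (α * τ)) {β c : ℝ} (hβ : 0 < β)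
    (hc : 0 < c) (hold : ∀ x y : ℝ, |a₂ x - a₂ y| ≤ c * |x - y| ^ β) :
    GordonForAllWeights ρ (a₁ + a₂) (μ₁ + μ₂) := by
  intro C hC
  obtain ⟨B, n, q, hB, hq, hev⟩ := hL.exists_approx hα hirr
  set Λ := (unifNorm μ₂.variation).toReal
  have hΛ : 0 ≤ Λ := ENNReal.toReal_nonneg
  have hμΛ : ∀ t, μ₂.variation (Ioc t (t + 1)) ≤ ENNReal.ofReal Λ := fun t => by
    rw [ENNReal.ofReal_toReal h₂.unif.ne]
    exact le_iSup (fun t => μ₂.variation (Ioc t (t + 1))) t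
  -- for `|s| ≤ 1`, both `|s| ^ β` and `|s|` are at most `|s| ^ β'`
  set β' := min β 1
  have hβ' : 0 < β' := lt_min hβ one_pos
  -- `exp (C r)`, and a factor `r`, are absorbed in `Q ^ q`, since `r ≤ 2 α τ q`
  set Q := Real.exp ((C + 1) * (2 * α * τ))
  set K := (2 * c + 7 * Λ) * (τ * B) ^ β'
  have hK : 0 ≤ K := by positivity
  set x : ℕ → ℝ := fun m => Q * (2 / (m : ℝ)) ^ β'
  have h2m : Tendsto (fun m : ℕ => 2 / (m : ℝ)) atTop (𝓝 0) :=
    tendsto_const_div_atTop_nhds_zero_nat 2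
  have hx : Tendsto x atTop (𝓝 0) := by
    have := (h2m.rpow_const (p := β') (.inr hβ'.le)).const_mul Q
    rwa [Real.zero_rpow hβ'.ne', mul_zero] at this
  have hτB : Tendsto (fun m : ℕ => τ * B * (2 / (m : ℝ))) atTop (𝓝 0) := by
    simpa using h2m.const_mul (τ * B)
  have hmain : ∀ᶠ m : ℕ in atTop, 0 < n m ∧ ENNReal.ofReal (Real.exp (C * (n m * τ))) *
      (eLpNorm (fun y => (a₁ + a₂) y - (a₁ + a₂) (y + n m * τ)) 1
        (volume.restrict (Ioo (-(n m * τ)) (n m * τ))) +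
        wNorm ((μ₁ + μ₂) - (μ₁ + μ₂).translate (n m * τ)) (Icc (-(n m * τ)) (n m * τ))) ≤
      ENNReal.ofReal (K * x m) := by
    filter_upwards [hev, eventually_ge_atTop 2, hx.eventually_le_const one_pos,
      hτB.eventually_le_const one_pos] with m hm hm2 hx1 hτB1
    obtain ⟨hq0, hqn, hnq, happ⟩ := hm
    have hm2' : (2 : ℝ) ≤ m := by exact_mod_cast hm2
    have h2m0 : (0 : ℝ) ≤ 2 / m := by positivity
    have h2m1 : 2 / (m : ℝ) ≤ 1 := (div_le_one (by linarith)).2 hm2'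
    have hn0 : 0 < n m := by
      have h1 : (0 : ℝ) < α * q m := mul_pos hα (by exact_mod_cast hq0)
      have h2 : (0 : ℝ) < n m := by linarith
      exact_mod_cast h2
    refine ⟨hn0, ?_⟩
    set r : ℝ := n m * τ with hr
    have hr0 : 0 ≤ r := by positivity
    set s : ℝ := r - q m * (α * τ) with hs
    have hrs : s + q m * (α * τ) = r := by rw [hs]; ring
    have hs_le : |s| ≤ τ * B * (2 / m) ^ q m := by
      have e : s = τ * (n m - q m * α) := by rw [hs, hr]; ring
      rw [e, abs_mul, abs_of_pos hτ0, mul_assoc]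
      exact mul_le_mul_of_nonneg_left happ hτ0.le
    have hs1 : |s| ≤ 1 := hs_le.trans ((mul_le_mul_of_nonneg_left
      (pow_le_of_le_one h2m0 h2m1 hq0.ne') (by positivity)).trans hτB1)
    have hE1 : eLpNorm (fun y => (a₁ + a₂) y - (a₁ + a₂) (y + r)) 1
        (volume.restrict (Ioo (-r) r)) ≤ ENNReal.ofReal (c * |s| ^ β * (2 * r)) := by
      refine eLpNorm_shift_le hc.le (ha₁.nat_mul (n m)) (fun y => ?_) hold
      rw [← hrs, ← add_assoc]
      exact ha₂.nat_mul (q m) _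
    have hE2 : wNorm ((μ₁ + μ₂) - (μ₁ + μ₂).translate r) (Icc (-r) r) ≤
        ENNReal.ofReal (7 * Λ * |s|) := by
      refine wNorm_le_of_translate hs1 (fun A hA hb => ?_) hΛ hμΛ _
      change μ₂ A - μ₂.translate s A = (μ₁ A + μ₂ A) - (μ₁.translate r A + μ₂.translate r A)
      rw [hμ₁.nat_mul (n m) A hA hb, ← hrs, (hμ₂.nat_mul (q m)).translate_add s hA hb]
      ring
    refine (mul_le_mul_right (add_le_add hE1 hE2) _).trans ?_
    rw [← ENNReal.ofReal_add (by positivity) (by positivity),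
      ← ENNReal.ofReal_mul (Real.exp_pos _).le]
    refine ENNReal.ofReal_le_ofReal ?_
    have hsβ : |s| ^ β ≤ |s| ^ β' :=
      Real.rpow_le_rpow_of_exponent_ge' (abs_nonneg s) hs1 hβ'.le (min_le_left _ _)
    have hs1' : |s| ≤ |s| ^ β' := by
      have := Real.rpow_le_rpow_of_exponent_ge' (abs_nonneg s) hs1 hβ'.le (min_le_right β 1)
      rwa [Real.rpow_one] at this
    have hexp1 : (1 : ℝ) ≤ Real.exp r := Real.one_le_exp hr0
    have hexpr : r ≤ Real.exp r := by linarith [Real.add_one_le_exp r]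
    have hsβ0 : 0 ≤ |s| ^ β' := by positivity
    have hsum : c * |s| ^ β * (2 * r) + 7 * Λ * |s| ≤
        (2 * c + 7 * Λ) * (Real.exp r * |s| ^ β') := by
      have h1 : |s| ^ β * r ≤ |s| ^ β' * Real.exp r := mul_le_mul hsβ hexpr hr0 hsβ0
      have h2 : |s| * 1 ≤ |s| ^ β' * Real.exp r := mul_le_mul hs1' hexp1 zero_le_one hsβ0
      have h3 := mul_le_mul_of_nonneg_left h1 hc.le
      have h4 := mul_le_mul_of_nonneg_left h2 hΛ
      linarith
    have hQ : Real.exp (C * r) * Real.exp r ≤ Q ^ q m := by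
      rw [← Real.exp_add, ← Real.exp_nat_mul]
      refine Real.exp_le_exp.2 ?_
      have : r ≤ 2 * α * q m * τ := mul_le_mul_of_nonneg_right hnq hτ0.le
      have := mul_le_mul_of_nonneg_left this (by positivity : 0 ≤ C + 1)
      linarith
    have hsβ2 : |s| ^ β' ≤ (τ * B) ^ β' * ((2 / (m : ℝ)) ^ β') ^ q m := by
      refine (Real.rpow_le_rpow (abs_nonneg _) hs_le hβ'.le).trans (le_of_eq ?_)
      rw [Real.mul_rpow (by positivity) (by positivity), Real.rpow_pow_comm h2m0]
    have hx0 : 0 ≤ x m := by positivity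
    calc Real.exp (C * r) * (c * |s| ^ β * (2 * r) + 7 * Λ * |s|)
        ≤ Real.exp (C * r) * ((2 * c + 7 * Λ) * (Real.exp r * |s| ^ β')) :=
          mul_le_mul_of_nonneg_left hsum (Real.exp_pos _).le
      _ = (2 * c + 7 * Λ) * ((Real.exp (C * r) * Real.exp r) * |s| ^ β') := by ring
      _ ≤ (2 * c + 7 * Λ) * (Q ^ q m * ((τ * B) ^ β' * ((2 / (m : ℝ)) ^ β') ^ q m)) :=
          mul_le_mul_of_nonneg_left (mul_le_mul hQ hsβ2 hsβ0 (by positivity)) (by positivity)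
      _ = K * x m ^ q m := by simp only [K, x, mul_pow]; ring
      _ ≤ K * x m := mul_le_mul_of_nonneg_left (pow_le_of_le_one hx0 hx1 hq0.ne') hK
  obtain ⟨N, hN⟩ := eventually_atTop.1 hmain
  refine ⟨fun m => n (m + N) * τ,
    fun m => nat_mul_mem_periods hτ (hN (m + N) (Nat.le_add_left _ _)).1, fun m => ?_, ?_, ?_⟩
  · exact mul_pos (Nat.cast_pos.2 (hN (m + N) (Nat.le_add_left _ _)).1) hτ0
  · refine Tendsto.comp (g := fun m => (n m : ℝ) * τ) ?_ (tendsto_add_atTop_nat N)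
    refine Tendsto.atTop_mul_const hτ0 ?_
    refine tendsto_atTop_mono' _ (f₁ := fun m => α / 2 * (q m : ℝ)) ?_
      ((tendsto_natCast_atTop_atTop.comp hq).const_mul_atTop (by positivity))
    filter_upwards [hev] with m hm
    linarith [hm.2.1]
  · refine tendsto_of_tendsto_of_tendsto_of_le_of_le tendsto_const_nhds
      (h := fun m => ENNReal.ofReal (K * x (m + N))) ?_ (fun _ => zero_le)
      fun m => (hN (m + N) (Nat.le_add_left _ _)).2
    have := (ENNReal.tendsto_ofReal (hx.const_mul K)).comp (tendsto_add_atTop_nat N)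
    rwa [mul_zero, ENNReal.ofReal_zero] at this

end SturmLiouville

theorem corollary4p4 {𝕜 : Type*} [RCLike 𝕜] (p : ℝ≥0∞) (hp_one : 1 ≤ p) (hp_top : p ≠ ∞)
    (ρ : Measure ℝ) [IsLocallyFiniteMeasure ρ] (hρ_ne : ρ ≠ 0)
    (hρ_unif : SturmLiouville.unifNorm ρ < ∞) (hρ_per : (SturmLiouville.periods ρ).Nonempty) :
    (∀ (a : ℝ → ℝ) (μ : LocalMeasure), SturmLiouville.Admissible ρ a μ →
      SturmLiouville.GordonForAllWeights ρ a μ →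
        ∀ z : 𝕜, ¬ SturmLiouville.IsEigenvalue p ρ a μ z) ∧
    (∀ (τ α : ℝ), τ ∈ SturmLiouville.periods ρ → 0 < τ → 0 < α → Irrational α →
      SturmLiouville.StrongLiouville α →
      ∀ (a₁ a₂ : ℝ → ℝ) (μ₁ μ₂ : LocalMeasure),
        SturmLiouville.Admissible ρ a₁ μ₁ → SturmLiouville.Admissible ρ a₂ μ₂ →
        Function.Periodic a₁ τ → μ₁.Periodic τ →
        Function.Periodic a₂ (α * τ) → μ₂.Periodic (α * τ) →
        (∃ β c : ℝ, 0 < β ∧ 0 < c ∧ ∀ x y : ℝ, |a₂ x - a₂ y| ≤ c * |x - y| ^ β) →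
          SturmLiouville.Admissible ρ (a₁ + a₂) (μ₁ + μ₂) ∧
          SturmLiouville.GordonForAllWeights ρ (a₁ + a₂) (μ₁ + μ₂) ∧
          ∀ z : 𝕜, ¬ SturmLiouville.IsEigenvalue p ρ (a₁ + a₂) (μ₁ + μ₂) z) := by
  have hp0 : p ≠ 0 := (zero_lt_one.trans_le hp_one).ne'
  refine ⟨fun a μ hadm hG z =>
    SturmLiouville.not_isEigenvalue_of_gordon hρ_ne hρ_unif hρ_per hp0 hp_top hadm hG z, ?_⟩
  rintro τ α hτ hτ0 hα hirr hL a₁ a₂ μ₁ μ₂ h₁ h₂ ha₁ hμ₁ ha₂ hμ₂ ⟨β, c, hβ, hc, hold⟩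
  have hadm := h₁.add h₂
  have hG := SturmLiouville.gordonForAllWeights_add hτ hτ0 hα hirr hL h₂ ha₁ hμ₁ ha₂ hμ₂ hβ hc hold
  exact ⟨hadm, hG, fun z =>
    SturmLiouville.not_isEigenvalue_of_gordon hρ_ne hρ_unif hρ_per hp0 hp_top hadm hG z⟩
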